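/- **Notation.** A strict partition is a finite strictly decreasing sequence $\lambda=(\lambda_1>\lambda_2>\dots>\lambda_\ell>0)$ of positive integers; $\ell(\lambda)=\ell$ is its number of parts, $\mathsf{SD}_\lambda=\{(i,j): 0<i\le j<i+\lambda_i\}$ its shifted diagram and $|\lambda|=|\mathsf{SD}_\lambda|$. Write $\mu\subseteq\lambda$ if $\mu_i\le\lambda_i$ for all $i$ (with missing parts read as $0$), and then $\mathsf{SD}_{\lambda/\mu}=\mathsf{SD}_\lambda\setminus\mathsf{SD}_\mu$, $|\lambda/\mu|=|\mathsf{SD}_{\lambda/\mu}|$. Fillings use the alphabet $1'<1<2'<2<\cdots$. A semistandard shifted tableau of shape $\lambda/\mu$ is a filling of $\mathsf{SD}_{\lambda/\mu}$ with weakly increasing rows and columns, no unprimed number repeated in a column and no primed number repeated in a row. A semistandard set-valued shifted tableau of shape $\lambda$ is a filling of $\mathsf{SD}_\lambda$ by nonempty finite sets of letters with the same conditions, where sets $S,S'$ are weakly increasing if $\max S\le\min S'$; $|T|$ is the total number of letters, and $x^T=\prod_i x_i^{m_i}$ with $m_i$ the number of letters $i$ or $i'$ in $T$. Let $\beta$ be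 an indeterminate and let $$GQ_\lambda=\sum_T\beta^{|T|-|\lambda|}x^T\in\mathbb Z[\beta][[x_1,x_2,\dots]],$$ the sum being over all semistandard set-valued shifted tableaux $T$ of shape $\lambda$; let $GP_\lambda$ be the same sum restricted to the $T$ with no primed number in a diagonal box $(j,j)$. Let $a^\lambda_{\mu\nu},b^\lambda_{\mu\nu}$ be the unique integers, zero when $|\lambda|<|\mu|+|\nu|$, such that (with possibly infinite sums) $$GP_\mu GP_\nu=\sum_\lambda a^\lambda_{\mu\nu}\beta^{|\lambda|-|\mu|-|\nu|}GP_\lambda,\qquad GQ_\mu GQ_\nu=\sum_\lambda b^\lambda_{\mu\nu}\beta^{|\lambda|-|\mu|-|\nu|}GQ_\lambda .$$ Let $gp_\lambda,gq_\lambda\in\mathbb Z[\beta][[x_1,x_2,\dots]]$ be the unique power series, indexed by strict partitions, with $$\sum_\lambda GQ_\lambda(x)\,gp_\lambda(y)=\sum_\lambda GP_\lambda(x)\,gq_\lambda(y)=\prod_{i,j\ge1}\frac{1-\overline{x_i}\,y_j}{1-x_iy_j},\qquad \overline{x}=\frac{-x}{1+\beta x},$$ and put $$gq_{\lambda/\mu}=\sum_\nu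 a^\lambda_{\mu\nu}\beta^{|\lambda|-|\mu|-|\nu|}gq_\nu,\qquad gp_{\lambda/\mu}=\sum_\nu b^\lambda_{\mu\nu}\beta^{|\lambda|-|\mu|-|\nu|}gp_\nu .$$ Let $\omega$ be the operator sending a (possibly infinite) $\mathbb Z[\beta]$-linear combination $\sum_\kappa c_\kappa s_\kappa$ of Schur functions to $\sum_\kappa c_\kappa s_{\kappa^\top}$, and put $jq_{\lambda/\mu}=\omega(gq_{\lambda/\mu})$, $jp_{\lambda/\mu}=\omega(gp_{\lambda/\mu})$. For $\mu\subseteq\lambda$, a shifted bar tableau of shape $\lambda/\mu$ is a pair $T=(V,\Pi)$, where $V$ is a semistandard shifted tableau of shape $\lambda/\mu$ and $\Pi$ is a set partition of $\mathsf{SD}_{\lambda/\mu}$ each of whose blocks is a set of adjacent boxes (a contiguous bar in one row or one column) with the same entry in $V$. Put $|T|=|\Pi|$ and $x^T=\prod_i x_i^{b_i}$, where $b_i$ is the number of blocks whose entry is $i$ or $i'$. Let $\mathrm{ShBT}_Q(\lambda/\mu)$ be the set of all of these, and $\mathrm{ShBT}_P(\lambda/\mu)$ the subset of those for which $V$ has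 no primed diagonal entries. **Theorem.** 1. Suppose that $jq_{\lambda/\mu}=\sum_{T\in \mathrm{ShBT}_Q(\lambda/\mu)}(-\beta)^{|\lambda/\mu|-|T|}x^T$ for all strict partitions $\mu\subseteq\lambda$. Then $a^\lambda_{\mu\nu}=0$ for all strict partitions $\lambda,\mu,\nu$ with $\ell(\lambda)>\ell(\mu)+\ell(\nu)$. 2. Suppose that $jp_{\lambda/\mu}=\sum_{T\in \mathrm{ShBT}_P(\lambda/\mu)}(-\beta)^{|\lambda/\mu|-|T|}x^T$ for all strict partitions $\mu\subseteq\lambda$. Then $b^\lambda_{\mu\nu}=0$ for all strict partitions $\lambda,\mu,\nu$ with $\ell(\lambda)>\ell(\mu)+\ell(\nu)$. -/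

import Mathlib

open Polynomial

/-! ### Strict partitions and shifted diagrams -/

/-- A strict partition `part 0 > part 1 > ... > part (ℓ - 1) > 0`, extended by zeros
(rows are numbered from `0`). -/
@[ext]
structure StrictPartition where
  /-- The parts. -/
  part : ℕ → ℕ
  part_succ_lt : ∀ i, part i ≠ 0 → part (i + 1) < part i
  part_succ_eq_zero : ∀ i, part i = 0 → part (i + 1) = 0

namespace StrictPartition

/-- The number of nonzero parts. -/
noncomputable def length (l : StrictPartition) : ℕ := {i | 0 < l.part i}.ncard

/-- The shifted diagram: all boxes `(i, j)` with `i ≤ j < i + part i`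
(rows and columns are numbered from `0`). -/
def shiftedDiagram (l : StrictPartition) : Finset (ℕ × ℕ) :=
  (Finset.range (l.part 0) ×ˢ Finset.range (l.part 0)).filter
    fun p => p.1 ≤ p.2 ∧ p.2 < p.1 + l.part p.1

theorem add_part_le (l : StrictPartition) (i : ℕ) (hi : l.part i ≠ 0) :
    i + l.part i ≤ l.part 0 := by
  induction i with
  | zero => simp
  | succ k ih =>
    have h0 : l.part k ≠ 0 := fun h => hi (l.part_succ_eq_zero k h)
    have h1 := l.part_succ_lt k h0
    have h2 := ih h0
    omega

/-- The bounding box in the definition of `shiftedDiagram` is harmless. -/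
theorem mem_shiftedDiagram (l : StrictPartition) (p : ℕ × ℕ) :
    p ∈ l.shiftedDiagram ↔ p.1 ≤ p.2 ∧ p.2 < p.1 + l.part p.1 := by
  simp only [shiftedDiagram, Finset.mem_filter, Finset.mem_product, Finset.mem_range,
    and_iff_right_iff_imp]
  rintro ⟨h1, h2⟩
  have h := l.add_part_le p.1 (by omega)
  omega

/-- The size `|λ|`. -/
def size (l : StrictPartition) : ℕ := l.shiftedDiagram.card

/-- Containment `μ ⊆ λ` of strict partitions. -/
instance : HasSubset StrictPartition := ⟨fun m l => ∀ i, m.part i ≤ l.part i⟩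

/-- The empty partition. -/
instance : EmptyCollection StrictPartition := ⟨⟨fun _ => 0, by simp, by simp⟩⟩

/-- The shifted skew diagram of `λ/μ`. -/
def skewDiagram (l m : StrictPartition) : Finset (ℕ × ℕ) := l.shiftedDiagram \ m.shiftedDiagram

end StrictPartition

/-! ### Fillings by positive half-integers

The ordered alphabet `1' < 1 < 2' < 2 < ...` is encoded by the natural numbers `0 < 1 < 2 < 3 < ...`:
the even number `2 * k` stands for `(k + 1)'` and the odd number `2 * k + 1` stands for `k + 1`.
Both contribute to the variable with index `k`, so that `X k` is the variable `x_{k+1}`. -/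

/-- The letter `e` is primed. -/
def IsPrimed (e : ℕ) : Prop := Even e

/-- The index of the variable attached to the letter `e`. -/
def varIndex (e : ℕ) : ℕ := e / 2

/-- Semistandard set-valued shifted tableaux on a set `D` of boxes. -/
structure SetTableau (D : Finset (ℕ × ℕ)) where
  /-- The entries. -/
  entry : D → Finset ℕ
  nonempty : ∀ p, (entry p).Nonempty
  row_weak : ∀ p q : D, p.1.1 = q.1.1 → p.1.2 < q.1.2 → ∀ a ∈ entry p, ∀ b ∈ entry q, a ≤ b
  col_weak : ∀ p q : D, p.1.2 = q.1.2 → p.1.1 < q.1.1 → ∀ a ∈ entry p, ∀ b ∈ entry q, a ≤ b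
  /-- No unprimed number occurs in two boxes of a column. -/
  col_strict : ∀ p q : D, p ≠ q → p.1.2 = q.1.2 → ∀ a ∈ entry p, a ∈ entry q → IsPrimed a
  /-- No primed number occurs in two boxes of a row. -/
  row_strict : ∀ p q : D, p ≠ q → p.1.1 = q.1.1 → ∀ a ∈ entry p, a ∈ entry q → ¬ IsPrimed a

namespace SetTableau

variable {D : Finset (ℕ × ℕ)}

/-- No primed number occurs in a diagonal box. -/
def DiagonalUnprimed (T : SetTableau D) : Prop :=
  ∀ p : D, p.1.1 = p.1.2 → ∀ a ∈ T.entry p, ¬ IsPrimed a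

/-- The exponent of the variable with index `k` in the weight `x^T`. -/
def weight (T : SetTableau D) (k : ℕ) : ℕ := ∑ p, ((T.entry p).filter fun a => varIndex a = k).card

/-- The number `|T|` of all entries. -/
def degree (T : SetTableau D) : ℕ := ∑ p, (T.entry p).card

end SetTableau

/-- A bar: a nonempty set of contiguous boxes in a single row or in a single column. -/
def IsBar (B : Finset (ℕ × ℕ)) : Prop :=
  ∃ i a b : ℕ, a ≤ b ∧ (B = {i} ×ˢ Finset.Icc a b ∨ B = Finset.Icc a b ×ˢ {i})

/-- Shifted bar tableaux on a set `D` of boxes: pairs of a semistandard shifted tableau `V`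
(the function `entry`) and a partition of `D` whose blocks are sets of adjacent boxes with the
same entry. (As `V` is semistandard, equal entries occur in adjacent boxes only
along a row or only along a column, so such a set is a bar.) -/
structure BarTableau (D : Finset (ℕ × ℕ)) where
  /-- The entries of the semistandard shifted tableau. -/
  entry : D → ℕ
  row_weak : ∀ p q : D, p.1.1 = q.1.1 → p.1.2 < q.1.2 → entry p ≤ entry q
  col_weak : ∀ p q : D, p.1.2 = q.1.2 → p.1.1 < q.1.1 → entry p ≤ entry q
  /-- No unprimed number occurs twice in a column. -/
  col_strict : ∀ p q : D, p ≠ q → p.1.2 = q.1.2 → entry p = entry q → IsPrimed (entry p)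
  /-- No primed number occurs twice in a row. -/
  row_strict : ∀ p q : D, p ≠ q → p.1.1 = q.1.1 → entry p = entry q → ¬ IsPrimed (entry p)
  /-- The partition of `D` into blocks. -/
  blocks : Finpartition D
  isBar : ∀ B ∈ blocks.parts, IsBar B
  entry_eq : ∀ B ∈ blocks.parts, ∀ p q : D, p.1 ∈ B → q.1 ∈ B → entry p = entry q

namespace BarTableau

variable {D : Finset (ℕ × ℕ)}

/-- No primed number occurs in a diagonal box. -/
def DiagonalUnprimed (T : BarTableau D) : Prop :=
  ∀ p : D, p.1.1 = p.1.2 → ¬ IsPrimed (T.entry p)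

/-- The exponent of the variable with index `k` in the weight `x^T`: the number of blocks filled by
letters with index `k`. -/
def weight (T : BarTableau D) (k : ℕ) : ℕ :=
  (T.blocks.parts.filter fun B => ∃ p : D, p.1 ∈ B ∧ varIndex (T.entry p) = k).card

/-- The number `|T|` of blocks. -/
def degree (T : BarTableau D) : ℕ := T.blocks.parts.card

end BarTableau

/-! ### Power series over `ℤ[β]`, with `β` the polynomial variable -/

/-- Power series in `x_1, x_2, ...` over `ℤ[β]`. -/
abbrev Series : Type := MvPowerSeries ℕ ℤ[X]

/-- The generating function `∑ T, c T * x ^ (w T)`; for all families below only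
finitely many `T` have a given weight. -/
noncomputable def genFun {τ : Type*} (w : τ → ℕ → ℕ) (c : τ → ℤ[X]) : Series :=
  fun m : ℕ →₀ ℕ => ∑ᶠ T : {T : τ // ∀ k, w T k = m k}, c T.1

section Topology

open scoped MvPowerSeries.WithPiTopology

/-- `g` is the sum of the (possibly infinite) family `f`, with respect to coefficientwise
stabilization. -/
def HasFormalSum {ι σ : Type*} (f : ι → MvPowerSeries σ ℤ[X]) (g : MvPowerSeries σ ℤ[X]) : Prop :=
  letI : TopologicalSpace ℤ[X] := ⊥
  HasSum f g

/-- The sum of a (possibly infinite) family of power series. -/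
noncomputable def formalSum {ι σ : Type*} (f : ι → MvPowerSeries σ ℤ[X]) : MvPowerSeries σ ℤ[X] :=
  letI : TopologicalSpace ℤ[X] := ⊥
  ∑' i, f i

/-- The product of a (possibly infinite) family of power series. -/
noncomputable def formalProd {ι σ : Type*} (f : ι → MvPowerSeries σ ℤ[X]) : MvPowerSeries σ ℤ[X] :=
  letI : TopologicalSpace ℤ[X] := ⊥
  ∏' i, f i

end Topology

/-- The unique object with property `P` (and `0` unless there is exactly one such object). -/
noncomputable def theUnique {α : Type*} [Zero α] (P : α → Prop) : α :=
  open Classical in if h : ∃! a, P a then h.choose else 0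

/-! ### The `K`-theoretic Schur `P`- and `Q`-functions -/

/-- The `K`-theoretic Schur `P`-function. -/
noncomputable def GP (l : StrictPartition) : Series :=
  genFun (τ := {T : SetTableau l.shiftedDiagram // T.DiagonalUnprimed})
    (fun T => T.1.weight) (fun T => X ^ (T.1.degree - l.size))

/-- The `K`-theoretic Schur `Q`-function. -/
noncomputable def GQ (l : StrictPartition) : Series :=
  genFun (τ := SetTableau l.shiftedDiagram)
    (fun T => T.weight) (fun T => X ^ (T.degree - l.size))

/-- `c` is the family of coefficients in
`G μ * G ν = ∑ λ, c λ * β ^ (|λ| - |μ| - |ν|) * G λ`, where no negative powers of `β` occur. -/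
def IsProductExpansion (G : StrictPartition → Series) (m n : StrictPartition)
    (c : StrictPartition → ℤ) : Prop :=
  (∀ l, l.size < m.size + n.size → c l = 0) ∧
  HasFormalSum (fun l => (C (c l) * X ^ (l.size - (m.size + n.size)) : ℤ[X]) • G l) (G m * G n)

/-- The integers `a^λ_{μν}` defined by
`GP μ * GP ν = ∑ λ, a^λ_{μν} * β ^ (|λ| - |μ| - |ν|) * GP λ`. -/
noncomputable def aCoeff (m n l : StrictPartition) : ℤ := theUnique (IsProductExpansion GP m n) l

/-- The integers `b^λ_{μν}` defined by
`GQ μ * GQ ν = ∑ λ, b^λ_{μν} * β ^ (|λ| - |μ| - |ν|) * GQ λ`. -/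
noncomputable def bCoeff (m n l : StrictPartition) : ℤ := theUnique (IsProductExpansion GQ m n) l

/-! ### The dual functions -/

/-- Power series in two sets of variables `x_i = X (Sum.inl i)` and `y_j = X (Sum.inr j)`. -/
abbrev Series₂ : Type := MvPowerSeries (ℕ ⊕ ℕ) ℤ[X]

/-- The embedding `f ↦ f(x)`. -/
noncomputable def inX (f : Series) : Series₂ :=
  haveI : Filter.TendstoCofinite (Sum.inl : ℕ → ℕ ⊕ ℕ) :=
    ⟨Sum.inl_injective.tendsto_cofinite⟩
  MvPowerSeries.rename (Sum.inl : ℕ → ℕ ⊕ ℕ) f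

/-- The embedding `f ↦ f(y)`. -/
noncomputable def inY (f : Series) : Series₂ :=
  haveI : Filter.TendstoCofinite (Sum.inr : ℕ → ℕ ⊕ ℕ) :=
    ⟨Sum.inr_injective.tendsto_cofinite⟩
  MvPowerSeries.rename (Sum.inr : ℕ → ℕ ⊕ ℕ) f

/-- The series `- x_i / (1 + β x_i)`. -/
noncomputable def xBar (i : ℕ) : Series₂ :=
  - MvPowerSeries.X (Sum.inl i) *
    MvPowerSeries.invOfUnit (1 + (X : ℤ[X]) • MvPowerSeries.X (Sum.inl i)) 1

/-- The product of all `(1 - xBar_i y_j) / (1 - x_i y_j)`. -/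
noncomputable def cauchyKernel : Series₂ :=
  formalProd fun p : ℕ × ℕ =>
    (1 - xBar p.1 * MvPowerSeries.X (Sum.inr p.2)) *
      MvPowerSeries.invOfUnit
        (1 - MvPowerSeries.X (Sum.inl p.1) * MvPowerSeries.X (Sum.inr p.2)) 1

/-- The Cauchy identity `∑ λ, G λ (x) * g λ (y) = cauchyKernel`. -/
def IsCauchyDual (G g : StrictPartition → Series) : Prop :=
  HasFormalSum (fun l => inX (G l) * inY (g l)) cauchyKernel

/-- The dual `K`-theoretic Schur `P`-functions: the unique family that is Cauchy dual to `GQ`. -/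
noncomputable def gp : StrictPartition → Series := theUnique (IsCauchyDual GQ)

/-- The dual `K`-theoretic Schur `Q`-functions: the unique family that is Cauchy dual to `GP`. -/
noncomputable def gq : StrictPartition → Series := theUnique (IsCauchyDual GP)

/-- `gq_{λ/μ} = ∑ ν, a^λ_{μν} * β ^ (|λ| - |μ| - |ν|) * gq ν`. -/
noncomputable def gqSkew (l m : StrictPartition) : Series :=
  ∑ᶠ n : StrictPartition, (C (aCoeff m n l) * X ^ (l.size - (m.size + n.size)) : ℤ[X]) • gq n

/-- `gp_{λ/μ} = ∑ ν, b^λ_{μν} * β ^ (|λ| - |μ| - |ν|) * gp ν`. -/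
noncomputable def gpSkew (l m : StrictPartition) : Series :=
  ∑ᶠ n : StrictPartition, (C (bCoeff m n l) * X ^ (l.size - (m.size + n.size)) : ℤ[X]) • gp n

/-! ### Schur functions and the operator `ω` -/

/-- The Schur function of a Young diagram. -/
noncomputable def schur (Y : YoungDiagram) : Series :=
  genFun (τ := SemistandardYoungTableau Y)
    (fun T k => (Y.cells.filter fun p => T p.1 p.2 = k).card) (fun _ => 1)

/-- The coefficients of `f` in its expansion into Schur functions. -/
noncomputable def schurCoeff (f : Series) : YoungDiagram → ℤ[X] :=
  theUnique fun c => HasFormalSum (fun Y => c Y • schur Y) f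

/-- The operator `ω`, sending `∑ c_Y s_Y` to `∑ c_Y s_{Yᵀ}`. -/
noncomputable def omega (f : Series) : Series :=
  formalSum fun Y : YoungDiagram => schurCoeff f Y • schur Y.transpose

/-- `jp_{λ/μ} = ω (gp_{λ/μ})`. -/
noncomputable def jpSkew (l m : StrictPartition) : Series := omega (gpSkew l m)

/-- `jq_{λ/μ} = ω (gq_{λ/μ})`. -/
noncomputable def jqSkew (l m : StrictPartition) : Series := omega (gqSkew l m)

/-! ### Generating functions of shifted bar tableaux -/

/-- The sum of `(-β) ^ (|λ/μ| - |T|) * x ^ T` over all shifted bar tableaux of shape `λ/μ`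
without primed diagonal entries. -/
noncomputable def barSeriesP (l m : StrictPartition) : Series :=
  genFun (τ := {T : BarTableau (l.skewDiagram m) // T.DiagonalUnprimed})
    (fun T => T.1.weight) (fun T => (-X) ^ ((l.skewDiagram m).card - T.1.degree))

/-- The sum of `(-β) ^ (|λ/μ| - |T|) * x ^ T` over all shifted bar tableaux of shape `λ/μ`. -/
noncomputable def barSeriesQ (l m : StrictPartition) : Series :=
  genFun (τ := BarTableau (l.skewDiagram m))
    (fun T => T.weight) (fun T => (-X) ^ ((l.skewDiagram m).card - T.degree))

/-!
The theorem is a consequence of the linear independence of generating functions of shifted bar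
tableaux, once the Cauchy identity has been transported along `ω`. Write `B_{λ/μ}` for the
generating function of the shifted bar tableaux of shape `λ/μ`, and `G`, `g` for `GP`, `gq` or for
`GQ`, `gp`; let `c^λ_{μν}` be the structure constants of the `G`.

* The rows of a tableau of shape `λ` show that the `B_λ` are unitriangular up to nonzero factors with
  respect to dominance. As the diagonal boxes of `λ/μ` need `ℓ(λ) - ℓ(μ)` different variables,
  `B_{λ/μ}` vanishes in fewer variables, and the `B_ν` with `ℓ(ν) ≤ N` are linearly independent in
  `N` variables (`coeff_barSeries_skew_eq_zero`, `eq_zero_of_sum_barSeries`). Cutting a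
  tableau along a variable gives the coproduct `B_λ(x, y) = ∑ B_κ(x) * B_{λ/κ}(y)`
  (`coeff_barSeries_add_shiftExp`).

* If `μ ⊆ λ`, the hypothesis reads `B_{λ/μ} = ∑ c^λ_{μν} β^{..} B_ν`. In `ℓ(λ) - ℓ(μ) - 1` variables
  the left-hand side is zero, so that `c^λ_{μν} = 0` unless `ℓ(ν) ≥ ℓ(λ) - ℓ(μ)`
  (`HasSkewBarExpansion.prodCoeff_eq_zero`).

* It remains to see that `c^λ_{μν} = 0` if `μ` is not contained in `λ`, about which the hypothesis
  says nothing. The Pieri rules show that multiplication by the coefficients (in `x`) of the Cauchy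
  kernel preserves expansions into Schur functions of `y` and is transformed by `ω` in the expected
  way (`exists_kernelCoeff_eq_schurSum`). Hence `∑ G_λ(x) B_λ(y)` is the product of all
  `(1 + x_i y_j) / (1 - y_j x_i / (1 + β x_i))`. This product is multiplicative in `y`, so the
  coproduct and the independence of the `B_κ` give
  `∑_{λ ⊇ κ} G_λ(x) B_{λ/κ}(y) = G_κ(x) ∑_ν G_ν(x) B_ν(y)`, and with the hypothesis
  `G_κ G_ν = ∑_{λ ⊇ κ} c^λ_{κν} β^{..} G_λ`. The expansion of `G_κ G_ν` being unique (otherwise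
  the constants are zero by convention), the constants vanish for `λ` not containing `κ`
  (`HasSkewBarExpansion.subset_of_prodCoeff_ne_zero`).

The families `gp` and `gq` are given as the unique Cauchy dual families. Their existence, and
`c^λ_{∅ν} = δ_{λν}`, follow from the hypothesis for `μ = ∅`, because `ω` would otherwise produce
`0` instead of `B_λ ≠ 0` (`HasSkewBarExpansion.skewDual_empty`, `HasSkewBarExpansion.isCauchyDual`).
-/

/-! ### Formal sums, products and generating functions -/

theorem coeff_genFun {τ : Type*} (w : τ → ℕ → ℕ) (c : τ → ℤ[X]) (m : ℕ →₀ ℕ) :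
    MvPowerSeries.coeff m (genFun w c) = ∑ᶠ T : {T : τ // ∀ k, w T k = m k}, c T.1 := rfl

theorem genFun_congr {τ τ' : Type*} (e : τ ≃ τ') {w : τ → ℕ → ℕ} {w' : τ' → ℕ → ℕ}
    {c : τ → ℤ[X]} {c' : τ' → ℤ[X]} (hw : ∀ T, w T = w' (e T)) (hc : ∀ T, c T = c' (e T)) :
    genFun w c = genFun w' c' := by
  funext m
  refine finsum_eq_of_bijective
    (fun T : {T : τ // ∀ k, w T k = m k} => (⟨e T.1, by rw [← hw]; exact T.2⟩ :
      {T : τ' // ∀ k, w' T k = m k})) ⟨?_, ?_⟩ fun T => hc T.1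
  · intro T T' h
    exact Subtype.ext (e.injective (congrArg Subtype.val h))
  · rintro ⟨T, hT⟩
    refine ⟨⟨e.symm T, fun k => ?_⟩, Subtype.ext (e.apply_symm_apply T)⟩
    rw [hw, e.apply_symm_apply, hT]

section

open scoped MvPowerSeries.WithPiTopology

/-- A family with only finitely many nonzero coefficients in each degree is summed
coefficient by coefficient. -/
theorem hasFormalSum_iff {ι σ : Type*} {f : ι → MvPowerSeries σ ℤ[X]} {g : MvPowerSeries σ ℤ[X]}
    (s : (σ →₀ ℕ) → Finset ι) (hs : ∀ d, ∀ i ∉ s d, MvPowerSeries.coeff d (f i) = 0) :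
    HasFormalSum f g ↔
      ∀ d, MvPowerSeries.coeff d g = ∑ i ∈ s d, MvPowerSeries.coeff d (f i) := by
  let _ : TopologicalSpace ℤ[X] := ⊥
  have : DiscreteTopology ℤ[X] := ⟨rfl⟩
  change HasSum f g ↔ _
  rw [MvPowerSeries.WithPiTopology.hasSum_iff_hasSum_coeff]
  refine forall_congr' fun d => ⟨fun h => ?_, fun h => ?_⟩
  · exact h.unique (hasSum_sum_of_ne_finset_zero (hs d))
  · rw [h]
    exact hasSum_sum_of_ne_finset_zero (hs d)

theorem HasFormalSum.formalSum_eq {ι σ : Type*} {f : ι → MvPowerSeries σ ℤ[X]}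
    {g : MvPowerSeries σ ℤ[X]} (h : HasFormalSum f g) : formalSum f = g := by
  let _ : TopologicalSpace ℤ[X] := ⊥
  have : DiscreteTopology ℤ[X] := ⟨rfl⟩
  exact HasSum.tsum_eq h

/-- An infinite product converges if each of its coefficients is eventually constant along the
finite partial products. -/
theorem coeff_formalProd {ι σ : Type*} {f : ι → MvPowerSeries σ ℤ[X]}
    (s : (σ →₀ ℕ) → Finset ι)
    (hs : ∀ d, ∀ t, s d ⊆ t → MvPowerSeries.coeff d (∏ i ∈ t, f i) =
      MvPowerSeries.coeff d (∏ i ∈ s d, f i)) (d : σ →₀ ℕ) :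
    MvPowerSeries.coeff d (formalProd f) = MvPowerSeries.coeff d (∏ i ∈ s d, f i) := by
  let _ : TopologicalSpace ℤ[X] := ⊥
  have : DiscreteTopology ℤ[X] := ⟨rfl⟩
  let g : MvPowerSeries σ ℤ[X] := fun d => MvPowerSeries.coeff d (∏ i ∈ s d, f i)
  have h : HasProd f g := by
    unfold HasProd
    rw [SummationFilter.unconditional_filter,
      MvPowerSeries.WithPiTopology.tendsto_iff_coeff_tendsto]
    intro d
    refine tendsto_const_nhds.congr' ?_
    filter_upwards [Filter.eventually_ge_atTop (s d)] with t ht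
    exact (hs d t ht).symm
  change MvPowerSeries.coeff d (∏' i, f i) = _
  rw [h.tprod_eq]
  rfl

end

/-- A nonzero value of `theUnique` is the unique solution. -/
theorem existsUnique_of_theUnique_ne_zero {α : Type*} [Zero α] {P : α → Prop}
    (h : theUnique P ≠ 0) : (∃! a, P a) ∧ P (theUnique P) := by
  classical
  by_cases hu : ∃! a, P a
  · refine ⟨hu, ?_⟩
    rw [theUnique, dif_pos hu]
    exact hu.choose_spec.1
  · exact absurd (by rw [theUnique, dif_neg hu]) h

theorem theUnique_eq {α : Type*} [Zero α] {P : α → Prop} {a : α} (ha : P a)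
    (hu : ∀ b, P b → b = a) : theUnique P = a := by
  classical
  have h : ∃! a, P a := ⟨a, ha, hu⟩
  rw [theUnique, dif_pos h]
  exact hu _ h.choose_spec.1

/-! ### Exponents supported on an initial or a final segment of the variables -/

/-- The exponent `m` moved to the variables with index at least `N`. -/
noncomputable def shiftExp (N : ℕ) (m : ℕ →₀ ℕ) : ℕ →₀ ℕ := m.mapDomain (· + N)

theorem shiftExp_add (N : ℕ) (m : ℕ →₀ ℕ) (k : ℕ) : shiftExp N m (k + N) = m k :=
  Finsupp.mapDomain_apply (add_left_injective N) m k

theorem shiftExp_of_lt {N k : ℕ} (m : ℕ →₀ ℕ) (hk : k < N) : shiftExp N m k = 0 := by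
  refine Finsupp.mapDomain_of_notMem_range _ _ ?_
  rintro ⟨a, ha⟩
  simp only at ha
  omega

/-- The exponent `m` involves only variables with index less than `N`. -/
def SuppLT (N : ℕ) (m : ℕ →₀ ℕ) : Prop := ∀ k, N ≤ k → m k = 0

theorem exists_suppLT (m : ℕ →₀ ℕ) : ∃ N, SuppLT N m := by
  refine ⟨m.support.sup id + 1, fun k hk => ?_⟩
  by_contra h
  have := Finset.le_sup (f := id) (Finsupp.mem_support_iff.2 h)
  simp only [id] at this
  omega

/-! ### Unitriangular families -/

/-- The partial sums of an exponent; comparing them is the dominance order. -/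
def partialSums (m : ℕ →₀ ℕ) (K : ℕ) : ℕ := ∑ k ∈ Finset.range K, m k

theorem partialSums_injective : Function.Injective partialSums := by
  intro m m' h
  ext k
  have h1 := congrFun h k
  have h2 := congrFun h (k + 1)
  simp only [partialSums, Finset.sum_range_succ] at h1 h2
  omega

/-- A relation between series that are triangular with respect to dominance of their leading
exponents `e i` is trivial. The relation is only required for the exponents of the members satisfying
`A`, provided that the other members do not involve these exponents. -/
theorem eq_zero_of_triangular {ι R : Type*} [CommRing R] [IsDomain R] {F : ι → (ℕ →₀ ℕ) → R}
    {e : ι → ℕ →₀ ℕ} (he : Function.Injective e) (hdiag : ∀ i, F i (e i) ≠ 0)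
    (htri : ∀ i j, F j (e i) ≠ 0 → partialSums (e i) ≤ partialSums (e j))
    (s : Finset ι) (d : ι → R) (A : ι → Prop)
    (hA : ∀ i j, A i → ¬ A j → F j (e i) = 0)
    (hrel : ∀ i, A i → ∑ j ∈ s, d j * F j (e i) = 0) :
    ∀ i ∈ s, A i → d i = 0 := by
  classical
  by_contra! hcon
  obtain ⟨i, hi, hAi, hdi⟩ := hcon
  obtain ⟨l, hl⟩ := (s.filter fun i => A i ∧ d i ≠ 0).exists_maximalFor
    (fun i => partialSums (e i)) ⟨i, by simp [hi, hAi, hdi]⟩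
  have hmem := hl.1
  simp only [Finset.mem_filter] at hmem
  refine mul_ne_zero hmem.2.2 (hdiag l) ?_
  rw [← hrel l hmem.2.1, Finset.sum_eq_single_of_mem (M := R) l hmem.1]
  intro j hj hjl
  by_contra hne
  have hF := right_ne_zero_of_mul hne
  have hAj : A j := by
    by_contra hAj
    exact hF (hA l j hmem.2.1 hAj)
  have hle := htri l j hF
  have hge := hl.2 (j := j) (by simp [hj, hAj, left_ne_zero_of_mul hne]) hle
  exact hjl (he (partialSums_injective (le_antisymm hge hle)))

/-! ### Strict partitions -/

namespace StrictPartition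

theorem part_antitone (l : StrictPartition) : Antitone l.part := by
  refine antitone_nat_of_succ_le fun i => ?_
  by_cases h : l.part i = 0
  · rw [l.part_succ_eq_zero i h]; exact Nat.zero_le _
  · exact (l.part_succ_lt i h).le

theorem part_eq_zero (l : StrictPartition) {i : ℕ} (hi : l.part 0 ≤ i) : l.part i = 0 := by
  by_contra h
  have := l.add_part_le i h
  omega

theorem pos_iff_lt_length (l : StrictPartition) (i : ℕ) : 0 < l.part i ↔ i < l.length := by
  have hex : ∃ n, l.part n = 0 := ⟨_, l.part_eq_zero le_rfl⟩
  have h : {i | 0 < l.part i} = Set.Iio (Nat.find hex) := by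
    ext j
    simp only [Set.mem_ofPred_eq, Set.mem_Iio]
    constructor
    · intro hj
      by_contra hcon
      have := l.part_antitone (not_lt.1 hcon)
      rw [Nat.find_spec hex] at this
      omega
    · intro hj
      exact Nat.pos_of_ne_zero (Nat.find_min hex hj)
  have hlen : l.length = Nat.find hex := by
    rw [length, h]
    simp [Set.ncard_eq_toFinset_card']
  rw [hlen]
  exact Set.ext_iff.1 h i

/-- The parts, as an exponent. -/
noncomputable def exp (l : StrictPartition) : ℕ →₀ ℕ :=
  Finsupp.onFinset (Finset.range (l.part 0)) l.part fun i hi => by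
    by_contra h
    exact hi (l.part_eq_zero (by simpa using h))

@[simp]
theorem exp_apply (l : StrictPartition) (i : ℕ) : l.exp i = l.part i := rfl

theorem exp_injective : Function.Injective exp := fun _ _ h =>
  StrictPartition.ext (funext fun i => DFunLike.congr_fun h i)

theorem suppLT_exp (l : StrictPartition) : SuppLT l.length l.exp := by
  intro k hk
  have := l.pos_iff_lt_length k
  rw [exp_apply]
  omega

theorem empty_subset (l : StrictPartition) : ∅ ⊆ l := fun _ => Nat.zero_le _

@[simp]
theorem empty_part (i : ℕ) : (∅ : StrictPartition).part i = 0 := rfl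

@[simp]
theorem shiftedDiagram_empty : (∅ : StrictPartition).shiftedDiagram = ∅ := rfl

@[simp]
theorem skewDiagram_empty (l : StrictPartition) : l.skewDiagram ∅ = l.shiftedDiagram := by
  simp [skewDiagram]

@[simp]
theorem size_empty : (∅ : StrictPartition).size = 0 := rfl

theorem shiftedDiagram_subset_iff {m l : StrictPartition} :
    m.shiftedDiagram ⊆ l.shiftedDiagram ↔ m ⊆ l := by
  constructor
  · intro h i
    by_contra hcon
    have := @h (i, i + l.part i) (by rw [mem_shiftedDiagram]; dsimp only; omega)
    rw [mem_shiftedDiagram] at this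
    dsimp only at this
    omega
  · intro h p hp
    rw [mem_shiftedDiagram] at hp ⊢
    have := h p.1
    omega

theorem shiftedDiagram_injective : Function.Injective shiftedDiagram := by
  intro m l h
  have h1 := shiftedDiagram_subset_iff.1 h.le
  have h2 := shiftedDiagram_subset_iff.1 h.ge
  exact StrictPartition.ext (funext fun i => le_antisymm (h1 i) (h2 i))

theorem card_row (l : StrictPartition) (i : ℕ) :
    (l.shiftedDiagram.filter fun p => p.1 = i).card = l.part i := by
  have : l.shiftedDiagram.filter (fun p => p.1 = i) =
      (Finset.range (l.part i)).image fun j => (i, i + j) := by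
    ext ⟨a, b⟩
    simp only [Finset.mem_filter, mem_shiftedDiagram, Finset.mem_image, Finset.mem_range,
      Prod.mk.injEq]
    constructor
    · rintro ⟨h, rfl⟩
      exact ⟨b - a, by omega, rfl, by omega⟩
    · rintro ⟨j, hj, rfl, rfl⟩
      omega
  rw [this, Finset.card_image_of_injective _ fun a b h => by simpa using h, Finset.card_range]

theorem finite_size_le (d : ℕ) : {l : StrictPartition | l.size ≤ d}.Finite := by
  refine Set.Finite.of_finite_image (f := shiftedDiagram) ?_ shiftedDiagram_injective.injOn
  refine (Finset.finite_toSet (Finset.range d ×ˢ Finset.range d).powerset).subset ?_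
  rintro _ ⟨l, hl, rfl⟩
  have h0 : l.part 0 ≤ d := by
    rw [← card_row]
    exact (Finset.card_filter_le _ _).trans hl
  simp only [Finset.coe_powerset, Set.mem_preimage, Set.mem_powerset_iff, Finset.coe_subset]
  intro p hp
  rw [shiftedDiagram, Finset.mem_filter, Finset.mem_product] at hp
  simp only [Finset.mem_range, Finset.mem_product] at hp ⊢
  omega

/-- The strict partitions of size at most `d`. -/
noncomputable def sizeLE (d : ℕ) : Finset StrictPartition := (finite_size_le d).toFinset

@[simp]
theorem mem_sizeLE {d : ℕ} {l : StrictPartition} : l ∈ sizeLE d ↔ l.size ≤ d := by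
  simp [sizeLE]

theorem size_le_of_subset {m l : StrictPartition} (h : m ⊆ l) : m.size ≤ l.size :=
  Finset.card_le_card (shiftedDiagram_subset_iff.2 h)

end StrictPartition

/-! ### Generating functions of bar tableaux -/

namespace BarTableau

variable {D : Finset (ℕ × ℕ)}

theorem ext_parts {T T' : BarTableau D} (h : T.entry = T'.entry)
    (h' : T.blocks.parts = T'.blocks.parts) : T = T' := by
  cases T
  cases T'
  obtain rfl : _ = _ := h
  obtain rfl := Finpartition.ext h'
  rfl

theorem exists_block (T : BarTableau D) (p : D) : ∃ B ∈ T.blocks.parts, p.1 ∈ B :=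
  T.blocks.exists_mem p.2

theorem weight_varIndex_pos (T : BarTableau D) (p : D) : 0 < T.weight (varIndex (T.entry p)) := by
  obtain ⟨B, hB, hp⟩ := T.exists_block p
  exact Finset.card_pos.2 ⟨B, Finset.mem_filter.2 ⟨hB, p, hp, rfl⟩⟩

/-- There are at most as many blocks as boxes filled by a given pair of letters `k'`, `k`. -/
theorem weight_le (T : BarTableau D) (k : ℕ) :
    T.weight k ≤ (Finset.univ.filter fun p : D => varIndex (T.entry p) = k).card := by
  classical
  refine Finset.card_le_card_of_surjOn (fun p => T.blocks.part p.1) ?_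
  intro B hB
  obtain ⟨hB, p, hpB, hp⟩ := Finset.mem_filter.1 hB
  exact ⟨p, by simp [hp], T.blocks.part_eq_of_mem hB hpB⟩

theorem finite_weight_eq (m : ℕ →₀ ℕ) : Finite {T : BarTableau D // ∀ k, T.weight k = m k} := by
  obtain ⟨N, hN⟩ := exists_suppLT m
  have hlt : ∀ (T : {T : BarTableau D // ∀ k, T.weight k = m k}) (p : D),
      T.1.entry p < 2 * N := by
    intro T p
    by_contra hcon
    have h1 := T.1.weight_varIndex_pos p
    rw [T.2, hN _ (by simp only [varIndex]; omega)] at h1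
    exact lt_irrefl _ h1
  refine Finite.of_injective (β := (D → Fin (2 * N)) × D.powerset.powerset)
    (fun T => (fun p => ⟨T.1.entry p, hlt T p⟩, ⟨T.1.blocks.parts, ?_⟩)) ?_
  · rw [Finset.mem_powerset]
    intro B hB
    exact Finset.mem_powerset.2 (T.1.blocks.subset hB)
  · intro T T' h
    simp only [Prod.mk.injEq, Subtype.mk.injEq] at h
    refine Subtype.ext (ext_parts (funext fun p => ?_) h.2)
    exact congrArg Fin.val (congrFun h.1 p)

/-- Along the main diagonal the letters increase by at least a full step `k' < k < (k + 1)'`. -/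
theorem varIndex_diagonal_lt (T : BarTableau D) {i : ℕ} (h1 : (i, i) ∈ D) (h2 : (i, i + 1) ∈ D)
    (h3 : (i + 1, i + 1) ∈ D) :
    varIndex (T.entry ⟨_, h1⟩) < varIndex (T.entry ⟨_, h3⟩) := by
  have a1 := T.row_weak ⟨_, h1⟩ ⟨_, h2⟩ rfl (Nat.lt_succ_self i)
  have a2 := T.col_weak ⟨_, h2⟩ ⟨_, h3⟩ rfl (Nat.lt_succ_self i)
  have a3 := T.row_strict ⟨_, h1⟩ ⟨_, h2⟩ (by simp) rfl
  have a4 := T.col_strict ⟨_, h2⟩ ⟨_, h3⟩ (by simp) rfl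
  simp only [IsPrimed, Nat.even_iff, varIndex] at a3 a4 ⊢
  omega

theorem row_le_varIndex {l : StrictPartition} (T : BarTableau l.shiftedDiagram)
    (p : l.shiftedDiagram) : p.1.1 ≤ varIndex (T.entry p) := by
  have key : ∀ i (h : (i, i) ∈ l.shiftedDiagram), i ≤ varIndex (T.entry ⟨_, h⟩) := by
    intro i
    induction i with
    | zero => simp
    | succ i ih =>
      intro h
      have h' := (l.mem_shiftedDiagram _).1 h
      dsimp only at h'
      have hpos : l.part i ≠ 0 := fun h0 => by
        have := l.part_succ_eq_zero i h0
        omega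
      have hlt := l.part_succ_lt i hpos
      have h1 : (i, i) ∈ l.shiftedDiagram := by rw [l.mem_shiftedDiagram]; dsimp only; omega
      have h2 : (i, i + 1) ∈ l.shiftedDiagram := by rw [l.mem_shiftedDiagram]; dsimp only; omega
      exact (ih h1).trans_lt (T.varIndex_diagonal_lt h1 h2 h)
  obtain ⟨⟨i, j⟩, hp⟩ := p
  have h' := (l.mem_shiftedDiagram _).1 hp
  dsimp only at h'
  have h1 : (i, i) ∈ l.shiftedDiagram := by rw [l.mem_shiftedDiagram]; dsimp only; omega
  refine (key i h1).trans (Nat.div_le_div_right ?_)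
  rcases h'.1.eq_or_lt with rfl | hlt
  · exact le_rfl
  · exact T.row_weak ⟨_, h1⟩ ⟨_, hp⟩ rfl hlt

theorem partialSums_le {l : StrictPartition} (T : BarTableau l.shiftedDiagram) {m : ℕ →₀ ℕ}
    (hT : ∀ k, T.weight k = m k) : partialSums m ≤ partialSums l.exp := by
  intro K
  calc partialSums m K
      ≤ ∑ k ∈ Finset.range K,
          (Finset.univ.filter fun p : l.shiftedDiagram => varIndex (T.entry p) = k).card :=
        Finset.sum_le_sum fun k _ => hT k ▸ T.weight_le k
    _ = (Finset.univ.filter fun p : l.shiftedDiagram => varIndex (T.entry p) < K).card := by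
        rw [Finset.card_eq_sum_card_fiberwise (t := Finset.range K)
          (f := fun p => varIndex (T.entry p)) (fun p hp => by simpa using hp)]
        refine Finset.sum_congr rfl fun k hk => congrArg Finset.card ?_
        ext p
        simp only [Finset.mem_filter, Finset.mem_univ, true_and, Finset.mem_range] at hk ⊢
        constructor
        · rintro rfl; exact ⟨hk, rfl⟩
        · exact fun h => h.2
    _ ≤ (l.shiftedDiagram.filter fun p => p.1 < K).card := by
        refine Finset.card_le_card_of_injOn Subtype.val ?_ Subtype.val_injective.injOn
        intro p hp
        simp only [Finset.coe_filter, Finset.mem_univ, true_and, Set.mem_ofPred_eq] at hp ⊢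
        exact ⟨p.2, (T.row_le_varIndex p).trans_lt hp⟩
    _ = partialSums l.exp K := by
        rw [Finset.card_eq_sum_card_fiberwise (t := Finset.range K)
          (f := fun p => p.1) (fun p hp => by simpa using (Finset.mem_filter.1 hp).2)]
        refine Finset.sum_congr rfl fun k hk => ?_
        rw [StrictPartition.exp_apply, ← l.card_row, Finset.filter_filter]
        congr 1
        ext p
        simp only [Finset.mem_filter, Finset.mem_range] at hk ⊢
        constructor
        · rintro ⟨h1, _, h2⟩; exact ⟨h1, h2⟩
        · rintro ⟨h1, rfl⟩; exact ⟨h1, hk, rfl⟩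

/-- The tableau whose `i`-th row is filled by the `i`-th unprimed letter, with all blocks of
size one. -/
def rowTableau (l : StrictPartition) : BarTableau l.shiftedDiagram where
  entry p := 2 * p.1.1 + 1
  row_weak p q h _ := by rw [h]
  col_weak p q _ h := by omega
  col_strict p q h h1 h2 := absurd (Subtype.ext (Prod.ext (by omega) h1)) h
  row_strict p q _ _ _ h := by
    rw [IsPrimed, Nat.even_iff] at h
    omega
  blocks := ⊥
  isBar B hB := by
    obtain ⟨p, -, rfl⟩ := Finpartition.mem_bot_iff.1 hB
    exact ⟨p.1, p.2, p.2, le_rfl, Or.inl (by simp)⟩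
  entry_eq B hB p q hp hq := by
    obtain ⟨r, -, rfl⟩ := Finpartition.mem_bot_iff.1 hB
    rw [Finset.mem_singleton] at hp hq
    rw [hp, hq]

theorem rowTableau_diagonalUnprimed (l : StrictPartition) : (rowTableau l).DiagonalUnprimed := by
  intro p _ h
  rw [IsPrimed, Nat.even_iff] at h
  dsimp only [rowTableau] at h
  omega

theorem weight_rowTableau (l : StrictPartition) (k : ℕ) : (rowTableau l).weight k = l.exp k := by
  rw [StrictPartition.exp_apply, ← l.card_row, weight]
  symm
  refine Finset.card_bij (fun p _ => {p}) ?_ ?_ ?_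
  · intro p hp
    rw [Finset.mem_filter] at hp
    refine Finset.mem_filter.2 ⟨Finpartition.mem_bot_iff.2 ⟨p, hp.1, rfl⟩, ⟨p, hp.1⟩, by simp, ?_⟩
    simp only [rowTableau, varIndex]
    omega
  · intro p _ q _ h
    exact Finset.singleton_injective h
  · intro B hB
    obtain ⟨hB, p, hpB, hp⟩ := Finset.mem_filter.1 hB
    obtain ⟨r, hr, rfl⟩ := Finpartition.mem_bot_iff.1 hB
    refine ⟨r, Finset.mem_filter.2 ⟨hr, ?_⟩, rfl⟩
    rw [Finset.mem_singleton] at hpB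
    simp only [rowTableau, varIndex] at hp
    rw [← hpB]
    omega

end BarTableau

/-- The bar tableaux on `D`; if `b` holds, only those without primed diagonal entries. -/
abbrev BarTableauOf (b : Prop) (D : Finset (ℕ × ℕ)) : Type :=
  {T : BarTableau D // b → T.DiagonalUnprimed}

/-- The sum of `(-β) ^ (|D| - |T|) * x ^ T` over the bar tableaux on `D`, which treats `barSeriesP`
(`b` true) and `barSeriesQ` (`b` false) at once. -/
noncomputable def barSeries (b : Prop) (D : Finset (ℕ × ℕ)) : Series :=
  genFun (τ := BarTableauOf b D) (fun T => T.1.weight) (fun T => (-X) ^ (D.card - T.1.degree))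

theorem barSeriesP_eq (l m : StrictPartition) :
    barSeriesP l m = barSeries True (l.skewDiagram m) :=
  genFun_congr (Equiv.subtypeEquivRight fun _ => by simp) (fun _ => rfl) fun _ => rfl

theorem barSeriesQ_eq (l m : StrictPartition) :
    barSeriesQ l m = barSeries False (l.skewDiagram m) :=
  genFun_congr (Equiv.subtypeUnivEquiv (by simp)).symm (fun _ => rfl) fun _ => rfl

instance finite_barTableauOf (b : Prop) (D : Finset (ℕ × ℕ)) (m : ℕ →₀ ℕ) :
    Finite {T : BarTableauOf b D // ∀ k, T.1.weight k = m k} := by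
  have := BarTableau.finite_weight_eq (D := D) m
  exact Finite.of_injective
    (fun T => (⟨T.1.1, T.2⟩ : {T : BarTableau D // ∀ k, T.weight k = m k}))
    fun T T' h => Subtype.ext (Subtype.ext (Subtype.mk.inj h))

theorem exists_of_coeff_barSeries_ne_zero {b : Prop} {D : Finset (ℕ × ℕ)} {m : ℕ →₀ ℕ}
    (h : MvPowerSeries.coeff m (barSeries b D) ≠ 0) :
    ∃ T : BarTableau D, ∀ k, T.weight k = m k := by
  by_contra! hcon
  refine h ?_
  rw [barSeries, coeff_genFun]
  have : IsEmpty {T : BarTableauOf b D // ∀ k, T.1.weight k = m k} :=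
    ⟨fun T => (hcon T.1.1).elim fun k hk => hk (T.2 k)⟩
  exact finsum_of_isEmpty _

/-- There is no cancellation between bar tableaux: at `β = -1` each of them contributes `1`. -/
theorem coeff_barSeries_ne_zero {b : Prop} {D : Finset (ℕ × ℕ)} {m : ℕ →₀ ℕ}
    (T : BarTableau D) (hb : b → T.DiagonalUnprimed) (hT : ∀ k, T.weight k = m k) :
    MvPowerSeries.coeff m (barSeries b D) ≠ 0 := by
  rw [barSeries, coeff_genFun]
  intro h
  have := Fintype.ofFinite {T : BarTableauOf b D // ∀ k, T.1.weight k = m k}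
  rw [finsum_eq_sum_of_fintype] at h
  have h1 := congrArg (Polynomial.eval (-1)) h
  have : Nonempty {T : BarTableauOf b D // ∀ k, T.1.weight k = m k} := ⟨⟨⟨T, hb⟩, hT⟩⟩
  simp [Polynomial.eval_finsetSum] at h1

theorem coeff_exp_barSeries_ne_zero (b : Prop) (l : StrictPartition) :
    MvPowerSeries.coeff l.exp (barSeries b l.shiftedDiagram) ≠ 0 :=
  coeff_barSeries_ne_zero _ (fun _ => BarTableau.rowTableau_diagonalUnprimed l)
    (BarTableau.weight_rowTableau l)

/-- The diagonal boxes of `λ/μ` need `ℓ(λ) - ℓ(μ)` different variables. -/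
theorem coeff_barSeries_skew_eq_zero (b : Prop) {l m : StrictPartition} {N : ℕ}
    (h : m.length + N < l.length) {n : ℕ →₀ ℕ} (hn : SuppLT N n) :
    MvPowerSeries.coeff n (barSeries b (l.skewDiagram m)) = 0 := by
  by_contra hcon
  obtain ⟨T, hT⟩ := exists_of_coeff_barSeries_ne_zero hcon
  have hmem : ∀ i j, m.length ≤ i → i ≤ j → j < i + l.part i → (i, j) ∈ l.skewDiagram m := by
    intro i j h1 h2 h3
    have := m.pos_iff_lt_length i
    rw [StrictPartition.skewDiagram, Finset.mem_sdiff, StrictPartition.mem_shiftedDiagram,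
      StrictPartition.mem_shiftedDiagram]
    dsimp only
    omega
  have key : ∀ t, m.length + t < l.length → ∀ hd, t ≤
      varIndex (T.entry ⟨(m.length + t, m.length + t), hd⟩) := by
    intro t
    induction t with
    | zero => simp
    | succ t ih =>
      intro ht hd
      have hpos := (l.pos_iff_lt_length _).2 ht
      have hlt := l.part_succ_lt (m.length + t) (fun h0 => by
        have := l.part_succ_eq_zero _ h0
        rw [← add_assoc] at hpos
        omega)
      rw [← add_assoc] at hpos
      have h1 := hmem (m.length + t) (m.length + t) (by omega) le_rfl (by omega)
      have h2 := hmem (m.length + t) (m.length + t + 1) (by omega) (by omega) (by omega)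
      exact (ih (by omega) h1).trans_lt (T.varIndex_diagonal_lt h1 h2 hd)
  have hpos := (l.pos_iff_lt_length _).2 h
  have hd := hmem (m.length + N) (m.length + N) (by omega) le_rfl (by omega)
  have := T.weight_varIndex_pos ⟨_, hd⟩
  rw [hT, hn _ (key N h hd)] at this
  exact lt_irrefl _ this

/-- Linear independence of the series `barSeries b λ`, `ℓ(λ) ≤ N`, in `N` variables. -/
theorem eq_zero_of_sum_barSeries (b : Prop) (s : Finset StrictPartition)
    (d : StrictPartition → ℤ[X]) (N : ℕ)
    (h : ∀ n, SuppLT N n →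
      ∑ l ∈ s, d l * MvPowerSeries.coeff n (barSeries b l.shiftedDiagram) = 0) :
    ∀ l ∈ s, l.length ≤ N → d l = 0 := by
  have hmono : ∀ {a c : ℕ}, a ≤ c → ∀ {n}, SuppLT a n → SuppLT c n :=
    fun hac _ hn k hk => hn k (hac.trans hk)
  have htri : ∀ i j : StrictPartition,
      MvPowerSeries.coeff i.exp (barSeries b j.shiftedDiagram) ≠ 0 →
        partialSums i.exp ≤ partialSums j.exp := by
    intro i j hij
    obtain ⟨T, hT⟩ := exists_of_coeff_barSeries_ne_zero hij
    exact T.partialSums_le hT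
  have hN : ∀ i j : StrictPartition, i.length ≤ N → ¬ j.length ≤ N →
      MvPowerSeries.coeff i.exp (barSeries b j.shiftedDiagram) = 0 := by
    intro i j hi hj
    rw [← j.skewDiagram_empty]
    refine coeff_barSeries_skew_eq_zero b (N := N) ?_ (hmono hi i.suppLT_exp)
    have h0 := (∅ : StrictPartition).pos_iff_lt_length 0
    rw [StrictPartition.empty_part] at h0
    omega
  have hdiag := coeff_exp_barSeries_ne_zero b
  have hrel := fun (l : StrictPartition) (hl : l.length ≤ N) => h _ (hmono hl l.suppLT_exp)
  -- The coefficients are made opaque to keep unification from unfolding them.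
  obtain ⟨F, hF⟩ : ∃ F : StrictPartition → (ℕ →₀ ℕ) → ℤ[X],
      ∀ l n, MvPowerSeries.coeff n (barSeries b l.shiftedDiagram) = F l n := ⟨_, fun _ _ => rfl⟩
  simp only [hF] at htri hN hdiag hrel
  exact eq_zero_of_triangular StrictPartition.exp_injective hdiag htri s d
    (fun l => l.length ≤ N) hN hrel

theorem eq_zero_of_forall_sum_barSeries (b : Prop) (s : Finset StrictPartition)
    (d : StrictPartition → ℤ[X])
    (h : ∀ n, ∑ l ∈ s, d l * MvPowerSeries.coeff n (barSeries b l.shiftedDiagram) = 0) :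
    ∀ l ∈ s, d l = 0 :=
  fun l hl => eq_zero_of_sum_barSeries b s d l.length (fun n _ => h n) l hl le_rfl

/-! ### Cutting a bar tableau at a letter -/

namespace StrictPartition

theorem add_part_antitone (l : StrictPartition) {i j : ℕ} (hij : i ≤ j) (hj : l.part j ≠ 0) :
    j + l.part j ≤ i + l.part i := by
  induction j, hij using Nat.le_induction with
  | base => exact le_rfl
  | succ k hk ih =>
    have h0 : l.part k ≠ 0 := fun h => hj (l.part_succ_eq_zero k h)
    have h1 := l.part_succ_lt k h0
    have h2 := ih h0
    omega

theorem mem_shiftedDiagram_of_row {l : StrictPartition} {p q : ℕ × ℕ} (hp : p ∈ l.shiftedDiagram)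
    (h1 : p.1 = q.1) (h2 : q.2 ≤ p.2) (h3 : q.1 ≤ q.2) : q ∈ l.shiftedDiagram := by
  rw [mem_shiftedDiagram] at hp ⊢
  rw [h1] at hp
  omega

theorem mem_shiftedDiagram_of_col {l : StrictPartition} {p q : ℕ × ℕ} (hp : p ∈ l.shiftedDiagram)
    (h1 : p.2 = q.2) (h2 : q.1 ≤ p.1) : q ∈ l.shiftedDiagram := by
  rw [mem_shiftedDiagram] at hp ⊢
  have := l.add_part_antitone h2 (by omega)
  omega

/-- A set of boxes of a shifted diagram that is closed under moving left and up is a shifted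
diagram. -/
theorem exists_shiftedDiagram_eq {l : StrictPartition} {E : Finset (ℕ × ℕ)}
    (hE : E ⊆ l.shiftedDiagram)
    (hrow : ∀ p ∈ E, ∀ q ∈ l.shiftedDiagram, p.1 = q.1 → q.2 < p.2 → q ∈ E)
    (hcol : ∀ p ∈ E, ∀ q ∈ l.shiftedDiagram, p.2 = q.2 → q.1 < p.1 → q ∈ E) :
    ∃ k : StrictPartition, k.shiftedDiagram = E := by
  classical
  have hex : ∀ i, ∃ t, (i, i + t) ∉ E := fun i => ⟨l.part i, fun h => by
    have := (l.mem_shiftedDiagram _).1 (hE h)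
    dsimp only at this
    omega⟩
  have hmem : ∀ i t, (i, i + t) ∈ E ↔ t < Nat.find (hex i) := by
    intro i t
    constructor
    · intro h
      by_contra hcon
      refine Nat.find_spec (hex i) ?_
      rcases (not_lt.1 hcon).eq_or_lt with heq | hlt
      · rwa [heq]
      · exact hrow _ h _ (mem_shiftedDiagram_of_row (hE h) rfl (by dsimp only; omega)
          (by dsimp only; omega)) rfl (by dsimp only; omega)
    · intro h
      exact not_not.1 (Nat.find_min (hex i) h)
  have hlt : ∀ i, Nat.find (hex (i + 1)) ≠ 0 → Nat.find (hex (i + 1)) < Nat.find (hex i) := by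
    intro i h
    have h1 := (hmem (i + 1) (Nat.find (hex (i + 1)) - 1)).2 (by omega)
    rw [← hmem]
    have h2 : i + 1 + (Nat.find (hex (i + 1)) - 1) = i + Nat.find (hex (i + 1)) := by omega
    rw [h2] at h1
    exact hcol _ h1 _ (mem_shiftedDiagram_of_col (hE h1) rfl (Nat.le_succ i)) rfl (Nat.lt_succ_self i)
  refine ⟨⟨fun i => Nat.find (hex i), fun i hi => ?_, fun i hi => ?_⟩, ?_⟩
  · by_cases h : Nat.find (hex (i + 1)) = 0
    · rw [h]; exact Nat.pos_of_ne_zero hi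
    · exact hlt i h
  · by_contra h
    have := hlt i h
    omega
  · ext ⟨i, j⟩
    rw [mem_shiftedDiagram]
    dsimp only
    constructor
    · rintro ⟨h1, h2⟩
      obtain ⟨t, rfl⟩ := Nat.exists_eq_add_of_le h1
      exact (hmem i t).2 (by omega)
    · intro h
      have h1 := (l.mem_shiftedDiagram _).1 (hE h)
      dsimp only at h1
      obtain ⟨t, rfl⟩ := Nat.exists_eq_add_of_le h1.1
      exact ⟨h1.1, by have := (hmem i t).1 h; omega⟩

end StrictPartition

theorem isPrimed_add_two_mul (a N : ℕ) : IsPrimed (a + 2 * N) ↔ IsPrimed a := by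
  simp only [IsPrimed, Nat.even_iff]
  omega

theorem isPrimed_sub_two_mul {a N : ℕ} (h : 2 * N ≤ a) : IsPrimed (a - 2 * N) ↔ IsPrimed a := by
  simp only [IsPrimed, Nat.even_iff]
  omega

namespace BarTableau

variable {D E : Finset (ℕ × ℕ)} {N : ℕ}

/-- The part of a bar tableau in a union `E` of blocks, with all letters lowered by `N` steps. -/
def restrict (T : BarTableau D) (hE : E ⊆ D) (N : ℕ)
    (hN : ∀ p (hp : p ∈ E), 2 * N ≤ T.entry ⟨p, hE hp⟩)
    (hblk : ∀ B ∈ T.blocks.parts, ∀ p ∈ B, p ∈ E → B ⊆ E) : BarTableau E where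
  entry p := T.entry ⟨p, hE p.2⟩ - 2 * N
  row_weak p q h h' := Nat.sub_le_sub_right (T.row_weak ⟨p, hE p.2⟩ ⟨q, hE q.2⟩ h h') _
  col_weak p q h h' := Nat.sub_le_sub_right (T.col_weak ⟨p, hE p.2⟩ ⟨q, hE q.2⟩ h h') _
  col_strict p q hne h h' := by
    have h1 := hN p p.2
    have h2 := hN q q.2
    rw [isPrimed_sub_two_mul h1]
    refine T.col_strict ⟨p, hE p.2⟩ ⟨q, hE q.2⟩ (fun h => hne ?_) h (by omega)
    exact Subtype.ext (Subtype.mk.inj h)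
  row_strict p q hne h h' := by
    have h1 := hN p p.2
    have h2 := hN q q.2
    rw [isPrimed_sub_two_mul h1]
    refine T.row_strict ⟨p, hE p.2⟩ ⟨q, hE q.2⟩ (fun h => hne ?_) h (by omega)
    exact Subtype.ext (Subtype.mk.inj h)
  blocks := Finpartition.ofExistsUnique (T.blocks.parts.filter (· ⊆ E))
    (fun B hB => (Finset.mem_filter.1 hB).2)
    (fun p hp => by
      obtain ⟨B, ⟨hB, hpB⟩, hu⟩ := T.blocks.existsUnique_mem (hE hp)
      exact ⟨B, ⟨Finset.mem_filter.2 ⟨hB, hblk B hB p hpB hp⟩, hpB⟩,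
        fun C hC => hu C ⟨(Finset.mem_filter.1 hC.1).1, hC.2⟩⟩)
    (fun h => T.blocks.empty_notMem_parts (Finset.mem_filter.1 h).1)
  isBar B hB := T.isBar B (Finset.mem_filter.1 hB).1
  entry_eq B hB p q hp hq := by
    rw [T.entry_eq B (Finset.mem_filter.1 hB).1 ⟨p, hE p.2⟩ ⟨q, hE q.2⟩ hp hq]

/-- Two bar tableaux on complementary sets of boxes, where the letters of the second one are raised
by `N` steps beyond the letters of the first. -/
def glue (hE : E ⊆ D) (N : ℕ) (S : BarTableau E) (S' : BarTableau (D \ E))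
    (hS : ∀ p, S.entry p < 2 * N)
    (hrow : ∀ p ∈ E, ∀ q ∈ D, p.1 = q.1 → q.2 < p.2 → q ∈ E)
    (hcol : ∀ p ∈ E, ∀ q ∈ D, p.2 = q.2 → q.1 < p.1 → q ∈ E) : BarTableau D where
  entry p := if h : p.1 ∈ E then S.entry ⟨p, h⟩ else
    S'.entry ⟨p, Finset.mem_sdiff.2 ⟨p.2, h⟩⟩ + 2 * N
  row_weak p q h h' := by
    by_cases hp : p.1 ∈ E <;> by_cases hq : q.1 ∈ E
    · rw [dif_pos hp, dif_pos hq]; exact S.row_weak _ _ h h'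
    · rw [dif_pos hp, dif_neg hq]; exact (hS _).le.trans (Nat.le_add_left _ _)
    · exact absurd (hrow _ hq _ p.2 h.symm h') hp
    · rw [dif_neg hp, dif_neg hq]; exact Nat.add_le_add_right (S'.row_weak _ _ h h') _
  col_weak p q h h' := by
    by_cases hp : p.1 ∈ E <;> by_cases hq : q.1 ∈ E
    · rw [dif_pos hp, dif_pos hq]; exact S.col_weak _ _ h h'
    · rw [dif_pos hp, dif_neg hq]; exact (hS _).le.trans (Nat.le_add_left _ _)
    · exact absurd (hcol _ hq _ p.2 h.symm h') hp
    · rw [dif_neg hp, dif_neg hq]; exact Nat.add_le_add_right (S'.col_weak _ _ h h') _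
  col_strict p q hne h h' := by
    have hne' : p.1 ≠ q.1 := fun h => hne (Subtype.ext h)
    by_cases hp : p.1 ∈ E <;> by_cases hq : q.1 ∈ E
    · rw [dif_pos hp] at h' ⊢
      rw [dif_pos hq] at h'
      exact S.col_strict ⟨p, hp⟩ ⟨q, hq⟩ (fun h => hne' (Subtype.mk.inj h)) h h'
    · rw [dif_pos hp, dif_neg hq] at h'
      have := hS ⟨p, hp⟩
      omega
    · rw [dif_neg hp, dif_pos hq] at h'
      have := hS ⟨q, hq⟩
      omega
    · rw [dif_neg hp] at h' ⊢
      rw [dif_neg hq] at h'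
      rw [isPrimed_add_two_mul]
      exact S'.col_strict ⟨p, Finset.mem_sdiff.2 ⟨p.2, hp⟩⟩ ⟨q, Finset.mem_sdiff.2 ⟨q.2, hq⟩⟩
        (fun h => hne' (Subtype.mk.inj h)) h (by omega)
  row_strict p q hne h h' := by
    have hne' : p.1 ≠ q.1 := fun h => hne (Subtype.ext h)
    by_cases hp : p.1 ∈ E <;> by_cases hq : q.1 ∈ E
    · rw [dif_pos hp] at h' ⊢
      rw [dif_pos hq] at h'
      exact S.row_strict ⟨p, hp⟩ ⟨q, hq⟩ (fun h => hne' (Subtype.mk.inj h)) h h'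
    · rw [dif_pos hp, dif_neg hq] at h'
      have := hS ⟨p, hp⟩
      omega
    · rw [dif_neg hp, dif_pos hq] at h'
      have := hS ⟨q, hq⟩
      omega
    · rw [dif_neg hp] at h' ⊢
      rw [dif_neg hq] at h'
      rw [isPrimed_add_two_mul]
      exact S'.row_strict ⟨p, Finset.mem_sdiff.2 ⟨p.2, hp⟩⟩ ⟨q, Finset.mem_sdiff.2 ⟨q.2, hq⟩⟩
        (fun h => hne' (Subtype.mk.inj h)) h (by omega)
  blocks := Finpartition.ofExistsUnique (S.blocks.parts ∪ S'.blocks.parts)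
    (fun B hB => (Finset.mem_union.1 hB).elim (fun h => (S.blocks.subset h).trans hE)
      fun h => (S'.blocks.subset h).trans Finset.sdiff_subset)
    (fun p hp => by
      by_cases h : p ∈ E
      · obtain ⟨B, ⟨hB, hpB⟩, hu⟩ := S.blocks.existsUnique_mem h
        refine ⟨B, ⟨Finset.mem_union_left _ hB, hpB⟩, fun C hC => ?_⟩
        rcases Finset.mem_union.1 hC.1 with hC' | hC'
        · exact hu C ⟨hC', hC.2⟩
        · exact absurd h (Finset.mem_sdiff.1 (S'.blocks.subset hC' hC.2)).2
      · obtain ⟨B, ⟨hB, hpB⟩, hu⟩ := S'.blocks.existsUnique_mem (Finset.mem_sdiff.2 ⟨hp, h⟩)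
        refine ⟨B, ⟨Finset.mem_union_right _ hB, hpB⟩, fun C hC => ?_⟩
        rcases Finset.mem_union.1 hC.1 with hC' | hC'
        · exact absurd (S.blocks.subset hC' hC.2) h
        · exact hu C ⟨hC', hC.2⟩)
    (fun h => (Finset.mem_union.1 h).elim S.blocks.empty_notMem_parts S'.blocks.empty_notMem_parts)
  isBar B hB := (Finset.mem_union.1 hB).elim (S.isBar B) (S'.isBar B)
  entry_eq B hB p q hp hq := by
    rcases Finset.mem_union.1 hB with h | h
    · rw [dif_pos (S.blocks.subset h hp), dif_pos (S.blocks.subset h hq)]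
      exact S.entry_eq B h _ _ hp hq
    · rw [dif_neg (Finset.mem_sdiff.1 (S'.blocks.subset h hp)).2,
        dif_neg (Finset.mem_sdiff.1 (S'.blocks.subset h hq)).2]
      exact congrArg (· + 2 * N) (S'.entry_eq B h _ _ hp hq)

section

variable {hE : E ⊆ D} {S : BarTableau E} {S' : BarTableau (D \ E)}
  {hS : ∀ p, S.entry p < 2 * N}
  {hrow : ∀ p ∈ E, ∀ q ∈ D, p.1 = q.1 → q.2 < p.2 → q ∈ E}
  {hcol : ∀ p ∈ E, ∀ q ∈ D, p.2 = q.2 → q.1 < p.1 → q ∈ E}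

theorem glue_entry_mem {p : ℕ × ℕ} (hp : p ∈ E) :
    (glue hE N S S' hS hrow hcol).entry ⟨p, hE hp⟩ = S.entry ⟨p, hp⟩ := dif_pos hp

theorem glue_entry_sdiff {p : ℕ × ℕ} (hp : p ∈ D \ E) :
    (glue hE N S S' hS hrow hcol).entry ⟨p, (Finset.mem_sdiff.1 hp).1⟩ =
      S'.entry ⟨p, hp⟩ + 2 * N := dif_neg (Finset.mem_sdiff.1 hp).2

theorem glue_entry_lt_iff (p : D) :
    (glue hE N S S' hS hrow hcol).entry p < 2 * N ↔ p.1 ∈ E := by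
  by_cases hp : p.1 ∈ E
  · exact iff_of_true ((glue_entry_mem hp).trans_lt (hS _)) hp
  · refine iff_of_false ?_ hp
    rw [glue_entry_sdiff (Finset.mem_sdiff.2 ⟨p.2, hp⟩)]
    omega

theorem disjoint_blocks (S : BarTableau E) (S' : BarTableau (D \ E)) :
    Disjoint S.blocks.parts S'.blocks.parts := by
  rw [Finset.disjoint_left]
  intro B hB hB'
  obtain ⟨p, hp⟩ := S.blocks.nonempty_of_mem_parts hB
  exact (Finset.mem_sdiff.1 (S'.blocks.subset hB' hp)).2 (S.blocks.subset hB hp)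

theorem degree_glue : (glue hE N S S' hS hrow hcol).degree = S.degree + S'.degree :=
  Finset.card_union_of_disjoint (disjoint_blocks S S')

theorem weight_glue (k : ℕ) : (glue hE N S S' hS hrow hcol).weight k =
    S.weight k + if N ≤ k then S'.weight (k - N) else 0 := by
  have h1 : (S.blocks.parts.filter fun B => ∃ p : D, p.1 ∈ B ∧
      varIndex ((glue hE N S S' hS hrow hcol).entry p) = k).card = S.weight k := by
    refine congrArg Finset.card (Finset.filter_congr fun B hB => ?_)
    constructor
    · rintro ⟨p, hp, h⟩
      have hpE := S.blocks.subset hB hp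
      exact ⟨⟨p, hpE⟩, hp, by rwa [← glue_entry_mem hpE]⟩
    · rintro ⟨p, hp, h⟩
      exact ⟨⟨p, hE p.2⟩, hp, by rwa [glue_entry_mem p.2]⟩
  have h2 : (S'.blocks.parts.filter fun B => ∃ p : D, p.1 ∈ B ∧
      varIndex ((glue hE N S S' hS hrow hcol).entry p) = k).card =
        if N ≤ k then S'.weight (k - N) else 0 := by
    have hvar : ∀ a, varIndex (a + 2 * N) = varIndex a + N := fun a => by
      simp only [varIndex]; omega
    split_ifs with hk
    · refine congrArg Finset.card (Finset.filter_congr fun B hB => ?_)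
      constructor
      · rintro ⟨p, hp, h⟩
        have hpE := S'.blocks.subset hB hp
        rw [glue_entry_sdiff hpE, hvar] at h
        exact ⟨⟨p, hpE⟩, hp, by omega⟩
      · rintro ⟨p, hp, h⟩
        refine ⟨⟨p, (Finset.mem_sdiff.1 p.2).1⟩, hp, ?_⟩
        rw [glue_entry_sdiff p.2, hvar, h]
        omega
    · rw [Finset.card_eq_zero, Finset.filter_eq_empty_iff]
      rintro B hB ⟨p, hp, h⟩
      rw [glue_entry_sdiff (S'.blocks.subset hB hp), hvar] at h
      omega
  rw [← h1, ← h2, weight, ← Finset.card_union_of_disjoint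
    (Finset.disjoint_filter_filter (disjoint_blocks S S')), ← Finset.filter_union]
  rfl

theorem glue_diagonalUnprimed_iff : (glue hE N S S' hS hrow hcol).DiagonalUnprimed ↔
    S.DiagonalUnprimed ∧ S'.DiagonalUnprimed := by
  constructor
  · intro h
    refine ⟨fun p hp => ?_, fun p hp => ?_⟩
    · rw [← glue_entry_mem (hS := hS) (hrow := hrow) (hcol := hcol) (S' := S') p.2]
      exact h _ hp
    · have := h ⟨p, (Finset.mem_sdiff.1 p.2).1⟩ hp
      rwa [glue_entry_sdiff p.2, isPrimed_add_two_mul] at this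
  · rintro ⟨h1, h2⟩ p hp
    by_cases hpE : p.1 ∈ E
    · rw [glue_entry_mem hpE]
      exact h1 _ hp
    · rw [glue_entry_sdiff (Finset.mem_sdiff.2 ⟨p.2, hpE⟩), isPrimed_add_two_mul]
      exact h2 _ hp

end

theorem entry_lt_of_weight (T : BarTableau D) {m : ℕ →₀ ℕ} (hm : SuppLT N m)
    (hT : ∀ k, T.weight k = m k) (p : D) : T.entry p < 2 * N := by
  by_contra hcon
  have h1 := T.weight_varIndex_pos p
  rw [hT, hm _ (by simp only [varIndex]; omega)] at h1
  exact lt_irrefl _ h1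

theorem weight_eq_zero_of_entry_lt (T : BarTableau D) (hT : ∀ p, T.entry p < 2 * N) {k : ℕ}
    (hk : N ≤ k) : T.weight k = 0 := by
  rw [weight, Finset.card_eq_zero, Finset.filter_eq_empty_iff]
  rintro B - ⟨p, -, h⟩
  have := hT p
  simp only [varIndex] at h
  omega

theorem glue_injective {E' : Finset (ℕ × ℕ)} {hE : E ⊆ D} {hE' : E' ⊆ D} {S : BarTableau E}
    {S' : BarTableau (D \ E)} {hS hrow hcol} {U : BarTableau E'} {U' : BarTableau (D \ E')}
    {hU hrow' hcol'} (h : glue hE N S S' hS hrow hcol = glue hE' N U U' hU hrow' hcol') :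
    E = E' ∧ HEq S U ∧ HEq S' U' := by
  obtain rfl : E = E' := by
    ext p
    by_cases hp : p ∈ D
    · rw [← glue_entry_lt_iff (hE := hE) (S' := S') (hrow := hrow) (hcol := hcol) (hS := hS) ⟨p, hp⟩,
        ← glue_entry_lt_iff (hE := hE') (S' := U') (hrow := hrow') (hcol := hcol') (hS := hU) ⟨p, hp⟩,
        h]
    · exact iff_of_false (fun h => hp (hE h)) (fun h => hp (hE' h))
  have hparts : S.blocks.parts ∪ S'.blocks.parts = U.blocks.parts ∪ U'.blocks.parts :=
    congrArg (fun T => T.blocks.parts) h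
  have hfil : ∀ (S : BarTableau E) (S' : BarTableau (D \ E)),
      (S.blocks.parts ∪ S'.blocks.parts).filter (· ⊆ E) = S.blocks.parts := by
    intro S S'
    ext B
    rw [Finset.mem_filter, Finset.mem_union]
    constructor
    · rintro ⟨hB | hB, hBE⟩
      · exact hB
      · obtain ⟨p, hp⟩ := S'.blocks.nonempty_of_mem_parts hB
        exact absurd (hBE hp) (Finset.mem_sdiff.1 (S'.blocks.subset hB hp)).2
    · exact fun hB => ⟨Or.inl hB, S.blocks.subset hB⟩
  have h1 : S.blocks.parts = U.blocks.parts := by rw [← hfil S S', hparts, hfil]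
  have h2 : S'.blocks.parts = U'.blocks.parts := by
    have hd := disjoint_blocks S S'
    have hd' := disjoint_blocks U U'
    rw [← Finset.union_sdiff_cancel_left hd, hparts, h1, Finset.union_sdiff_cancel_left hd']
  refine ⟨rfl, heq_of_eq (ext_parts (funext fun p => ?_) h1),
    heq_of_eq (ext_parts (funext fun p => ?_) h2)⟩
  · rw [← glue_entry_mem (hE := hE) (hS := hS) (hrow := hrow) (hcol := hcol) (S' := S') p.2, h,
      glue_entry_mem]
  · have := glue_entry_sdiff (hE := hE) (hS := hS) (hrow := hrow) (hcol := hcol) (S' := S') p.2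
    rw [h, glue_entry_sdiff p.2] at this
    exact (Nat.add_right_cancel this).symm

/-- Every bar tableau on a shifted diagram is glued from the part filled by the first `N` pairs of
letters and the rest. -/
theorem exists_glue {l : StrictPartition} (T : BarTableau l.shiftedDiagram) (N : ℕ) :
    ∃ (k : StrictPartition) (hE : k.shiftedDiagram ⊆ l.shiftedDiagram)
      (S : BarTableau k.shiftedDiagram) (S' : BarTableau (l.shiftedDiagram \ k.shiftedDiagram))
      (hS : _) (hrow : _) (hcol : _), glue hE N S S' hS hrow hcol = T := by
  classical
  have hlt : ∀ p ∈ (Finset.univ.filter fun p : l.shiftedDiagram => T.entry p < 2 * N).map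
      (Function.Embedding.subtype _), ∃ h : p ∈ l.shiftedDiagram, T.entry ⟨p, h⟩ < 2 * N := by
    intro p hp
    obtain ⟨q, hq, rfl⟩ := Finset.mem_map.1 hp
    exact ⟨q.2, (Finset.mem_filter.1 hq).2⟩
  have hlt' : ∀ p (h : p ∈ l.shiftedDiagram), T.entry ⟨p, h⟩ < 2 * N →
      p ∈ (Finset.univ.filter fun p : l.shiftedDiagram => T.entry p < 2 * N).map
        (Function.Embedding.subtype _) := fun p h hp =>
    Finset.mem_map.2 ⟨⟨p, h⟩, Finset.mem_filter.2 ⟨Finset.mem_univ _, hp⟩, rfl⟩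
  generalize (Finset.univ.filter fun p : l.shiftedDiagram => T.entry p < 2 * N).map
    (Function.Embedding.subtype _) = E at hlt hlt'
  have hE : E ⊆ l.shiftedDiagram := fun p hp => (hlt p hp).1
  have hrow : ∀ p ∈ E, ∀ q ∈ l.shiftedDiagram, p.1 = q.1 → q.2 < p.2 → q ∈ E := by
    intro p hp q hq h h'
    obtain ⟨h1, h2⟩ := hlt p hp
    exact hlt' q hq ((T.row_weak ⟨q, hq⟩ ⟨p, h1⟩ h.symm h').trans_lt h2)
  have hcol : ∀ p ∈ E, ∀ q ∈ l.shiftedDiagram, p.2 = q.2 → q.1 < p.1 → q ∈ E := by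
    intro p hp q hq h h'
    obtain ⟨h1, h2⟩ := hlt p hp
    exact hlt' q hq ((T.col_weak ⟨q, hq⟩ ⟨p, h1⟩ h.symm h').trans_lt h2)
  obtain ⟨k, rfl⟩ := StrictPartition.exists_shiftedDiagram_eq hE hrow hcol
  have hblk : ∀ B ∈ T.blocks.parts, ∀ p ∈ B, p ∈ k.shiftedDiagram → B ⊆ k.shiftedDiagram := by
    intro B hB p hp hpk q hq
    obtain ⟨h1, h2⟩ := hlt p hpk
    exact hlt' q (T.blocks.subset hB hq)
      (T.entry_eq B hB ⟨q, T.blocks.subset hB hq⟩ ⟨p, h1⟩ hq hp ▸ h2)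
  have hblk' : ∀ B ∈ T.blocks.parts, ∀ p ∈ B, p ∈ l.shiftedDiagram \ k.shiftedDiagram →
      B ⊆ l.shiftedDiagram \ k.shiftedDiagram := by
    intro B hB p hp hpk q hq
    refine Finset.mem_sdiff.2 ⟨T.blocks.subset hB hq, fun hqk => ?_⟩
    exact (Finset.mem_sdiff.1 hpk).2 (hblk B hB q hq hqk hp)
  have hN' : ∀ p (hp : p ∈ l.shiftedDiagram \ k.shiftedDiagram),
      2 * N ≤ T.entry ⟨p, Finset.sdiff_subset hp⟩ := by
    intro p hp
    by_contra hcon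
    exact (Finset.mem_sdiff.1 hp).2 (hlt' _ _ (not_le.1 hcon))
  refine ⟨k, hE, T.restrict hE 0 (by simp) hblk, T.restrict Finset.sdiff_subset N hN' hblk',
    fun p => ?_, hrow, hcol, ext_parts (funext fun p => ?_) ?_⟩
  · exact (hlt p p.2).2
  · by_cases hp : p.1 ∈ k.shiftedDiagram
    · exact glue_entry_mem hp
    · refine (glue_entry_sdiff (Finset.mem_sdiff.2 ⟨p.2, hp⟩)).trans ?_
      exact Nat.sub_add_cancel (hN' _ (Finset.mem_sdiff.2 ⟨p.2, hp⟩))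
  · change T.blocks.parts.filter _ ∪ T.blocks.parts.filter _ = _
    rw [← Finset.filter_or, Finset.filter_eq_self]
    intro B hB
    obtain ⟨p, hp⟩ := T.blocks.nonempty_of_mem_parts hB
    by_cases hpk : p ∈ k.shiftedDiagram
    · exact Or.inl (hblk B hB p hp hpk)
    · exact Or.inr (hblk' B hB p hp (Finset.mem_sdiff.2 ⟨T.blocks.subset hB hp, hpk⟩))

end BarTableau

open Classical in
/-- The strict partitions contained in `l`. -/
noncomputable def StrictPartition.subs (l : StrictPartition) : Finset StrictPartition :=
  (StrictPartition.sizeLE l.size).filter (· ⊆ l)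

@[simp]
theorem StrictPartition.mem_subs {k l : StrictPartition} : k ∈ l.subs ↔ k ⊆ l := by
  simp only [subs, Finset.mem_filter, mem_sizeLE, and_iff_right_iff_imp]
  exact size_le_of_subset

/-- The bar tableaux with a given weight. -/
abbrev BarTableauWt (b : Prop) (D : Finset (ℕ × ℕ)) (m : ℕ →₀ ℕ) : Type :=
  {T : BarTableauOf b D // ∀ k, T.1.weight k = m k}

/-- The bar tableau on a shifted diagram glued from its two parts of given weights. -/
noncomputable def glueWt {b : Prop} {l : StrictPartition} {N : ℕ} {m : ℕ →₀ ℕ} (hm : SuppLT N m)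
    (m' : ℕ →₀ ℕ)
    (u : Σ k : l.subs, BarTableauWt b k.1.shiftedDiagram m ×
      BarTableauWt b (l.shiftedDiagram \ k.1.shiftedDiagram) m') :
    BarTableauWt b l.shiftedDiagram (m + shiftExp N m') :=
  ⟨⟨BarTableau.glue (StrictPartition.shiftedDiagram_subset_iff.2
      (StrictPartition.mem_subs.1 u.1.2)) N u.2.1.1.1 u.2.2.1.1
      (fun p => u.2.1.1.1.entry_lt_of_weight hm u.2.1.2 p)
      (fun _ hp _ hq h h' => StrictPartition.mem_shiftedDiagram_of_row hp h h'.le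
        ((l.mem_shiftedDiagram _).1 hq).1)
      (fun _ hp _ _ h h' => StrictPartition.mem_shiftedDiagram_of_col hp h h'.le),
    fun hb => BarTableau.glue_diagonalUnprimed_iff.2 ⟨u.2.1.1.2 hb, u.2.2.1.2 hb⟩⟩, by
    intro k
    dsimp only
    rw [BarTableau.weight_glue, Finsupp.add_apply, u.2.1.2]
    congr 1
    split_ifs with hk
    · rw [u.2.2.2, ← shiftExp_add N m', Nat.sub_add_cancel hk]
    · rw [shiftExp_of_lt _ (not_le.1 hk)]⟩

theorem glueWt_bijective {b : Prop} {l : StrictPartition} {N : ℕ} {m : ℕ →₀ ℕ} (hm : SuppLT N m)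
    (m' : ℕ →₀ ℕ) : Function.Bijective (glueWt (b := b) (l := l) hm m') := by
  constructor
  · rintro ⟨⟨k, hk⟩, ⟨⟨S, hS⟩, hSm⟩, ⟨⟨S', hS'⟩, hSm'⟩⟩ ⟨⟨k₂, hk₂⟩, ⟨⟨U, hU⟩, hUm⟩, ⟨⟨U', hU'⟩, hUm'⟩⟩ h
    obtain ⟨h1, h2, h3⟩ := BarTableau.glue_injective (Subtype.mk.inj (Subtype.mk.inj h))
    obtain rfl := StrictPartition.shiftedDiagram_injective h1
    obtain rfl := eq_of_heq h2
    obtain rfl := eq_of_heq h3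
    rfl
  · rintro ⟨⟨T, hT⟩, hTm⟩
    obtain ⟨k, hE, S, S', hS, hrow, hcol, rfl⟩ := T.exists_glue N
    have hd := fun hb => BarTableau.glue_diagonalUnprimed_iff.1 (hT hb)
    have hw : ∀ i, S.weight i + (if N ≤ i then S'.weight (i - N) else 0) =
        m i + shiftExp N m' i := fun i => by
      have := hTm i
      dsimp only at this
      rwa [BarTableau.weight_glue] at this
    have hSm : ∀ i, S.weight i = m i := by
      intro i
      by_cases hi : N ≤ i
      · rw [S.weight_eq_zero_of_entry_lt hS hi, hm i hi]
      · have := hw i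
        rwa [if_neg hi, shiftExp_of_lt _ (not_le.1 hi), add_zero, add_zero] at this
    have hSm' : ∀ i, S'.weight i = m' i := by
      intro i
      have := hw (i + N)
      rwa [hSm, if_pos (Nat.le_add_left _ _), Nat.add_sub_cancel, shiftExp_add,
        Nat.add_left_cancel_iff] at this
    exact ⟨⟨⟨k, StrictPartition.mem_subs.2 (StrictPartition.shiftedDiagram_subset_iff.1 hE)⟩,
      ⟨⟨S, fun hb => (hd hb).1⟩, hSm⟩, ⟨⟨S', fun hb => (hd hb).2⟩, hSm'⟩⟩, rfl⟩

/-- The branching rule of bar tableaux: separating the first `N` variables from the others cuts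
the shape `λ` along a strict partition `κ ⊆ λ`. -/
theorem coeff_barSeries_add_shiftExp (b : Prop) (l : StrictPartition) {N : ℕ} {m : ℕ →₀ ℕ}
    (hm : SuppLT N m) (m' : ℕ →₀ ℕ) :
    MvPowerSeries.coeff (m + shiftExp N m') (barSeries b l.shiftedDiagram) =
      ∑ k ∈ l.subs, MvPowerSeries.coeff m (barSeries b k.shiftedDiagram) *
        MvPowerSeries.coeff m' (barSeries b (l.skewDiagram k)) := by
  have hfin : ∀ D n, Fintype (BarTableauWt b D n) := fun D n => Fintype.ofFinite _
  have hc : ∀ D n, MvPowerSeries.coeff n (barSeries b D) =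
      ∑ T : BarTableauWt b D n, (-X : ℤ[X]) ^ (D.card - T.1.1.degree) := fun D n => by
    rw [barSeries, coeff_genFun, finsum_eq_sum_of_fintype]
  simp only [hc, StrictPartition.skewDiagram]
  rw [← Finset.sum_coe_sort l.subs, ← (glueWt_bijective hm m').sum_comp, Fintype.sum_sigma]
  refine Finset.sum_congr rfl fun k _ => ?_
  rw [Finset.sum_mul_sum, Fintype.sum_prod_type]
  refine Finset.sum_congr rfl fun T _ => Finset.sum_congr rfl fun T' _ => ?_
  rw [← pow_add]
  congr 1
  have h1 : (glueWt hm m' ⟨k, T, T'⟩).1.1.degree = T.1.1.degree + T'.1.1.degree := by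
    dsimp only [glueWt]
    rw [BarTableau.degree_glue]
  have h2 : T.1.1.degree ≤ k.1.shiftedDiagram.card := T.1.1.blocks.card_parts_le_card
  have h3 : T'.1.1.degree ≤ (l.shiftedDiagram \ k.1.shiftedDiagram).card := T'.1.1.blocks.card_parts_le_card
  have h4 : (l.shiftedDiagram \ k.1.shiftedDiagram).card + k.1.shiftedDiagram.card = l.shiftedDiagram.card :=
    Finset.card_sdiff_add_card_eq_card
      (StrictPartition.shiftedDiagram_subset_iff.2 (StrictPartition.mem_subs.1 k.2))
  rw [h1]
  omega

/-! ### Products of univariate power series in different variables -/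

section InfProd

variable {A : Type*} [CommRing A]

theorem coeff_single_toMvPowerSeries (q : PowerSeries A) (i n : ℕ) :
    MvPowerSeries.coeff (Finsupp.single i n) (q.toMvPowerSeries i) = PowerSeries.coeff n q := by
  have := MvPowerSeries.coeff_embDomain_rename (R := A) (⟨fun _ : Unit => i, fun _ _ _ => rfl⟩)
    q (Finsupp.single () n)
  rw [Finsupp.embDomain_single] at this
  exact this

theorem coeff_toMvPowerSeries_of_ne (q : PowerSeries A) {i : ℕ} {m : ℕ →₀ ℕ}
    (h : m ≠ Finsupp.single i (m i)) : MvPowerSeries.coeff m (q.toMvPowerSeries i) = 0 := by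
  refine MvPowerSeries.coeff_rename_eq_zero _ _ ?_
  rintro ⟨x, rfl⟩
  refine h ?_
  rw [Finsupp.unique_single x, Finsupp.mapDomain_single]
  simp

/-- A factor in the variable `i` is separated from a series without this variable. -/
theorem coeff_toMvPowerSeries_mul (q : PowerSeries A) {i : ℕ} {P : MvPowerSeries ℕ A}
    (hP : ∀ m : ℕ →₀ ℕ, m i ≠ 0 → MvPowerSeries.coeff m P = 0) (m : ℕ →₀ ℕ) :
    MvPowerSeries.coeff m (q.toMvPowerSeries i * P) =
      PowerSeries.coeff (m i) q * MvPowerSeries.coeff (m.erase i) P := by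
  classical
  rw [MvPowerSeries.coeff_mul, Finset.sum_eq_single (Finsupp.single i (m i), m.erase i)]
  · rw [coeff_single_toMvPowerSeries]
  · rintro ⟨a, b⟩ hab hne
    rw [Finset.HasAntidiagonal.mem_antidiagonal] at hab
    dsimp only at hab ⊢
    by_cases ha : a = Finsupp.single i (a i)
    · by_cases hb : b i = 0
      · refine absurd ?_ hne
        have hai : a i = m i := by rw [← hab, Finsupp.add_apply, hb, add_zero]
        rw [hai] at ha
        rw [ha] at hab ⊢
        rw [← hab]
        ext1
        · simp [hb]
        · ext k
          rcases eq_or_ne k i with rfl | hk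
          · simp [hb]
          · simp [hk]
      · rw [hP b hb, mul_zero]
    · rw [coeff_toMvPowerSeries_of_ne q ha, zero_mul]
  · intro h
    exact absurd (by rw [Finset.HasAntidiagonal.mem_antidiagonal, Finsupp.single_add_erase]) h

theorem coeff_prod_toMvPowerSeries (q : ℕ → PowerSeries A) (s : Finset ℕ) (m : ℕ →₀ ℕ) :
    MvPowerSeries.coeff m (∏ j ∈ s, (q j).toMvPowerSeries j) =
      if m.support ⊆ s then ∏ j ∈ s, PowerSeries.coeff (m j) (q j) else 0 := by
  classical
  induction s using Finset.induction_on generalizing m with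
  | empty =>
    rw [Finset.prod_empty, MvPowerSeries.coeff_one, Finset.prod_empty]
    simp [Finset.subset_empty]
  | insert i s hi ih =>
    rw [Finset.prod_insert hi, coeff_toMvPowerSeries_mul, ih, Finset.prod_insert hi, mul_ite,
      mul_zero]
    · have h1 : (m.erase i).support ⊆ s ↔ m.support ⊆ insert i s := by
        rw [Finsupp.support_erase, Finset.subset_insert_iff]
      simp only [h1]
      refine if_congr Iff.rfl (congrArg _ (Finset.prod_congr rfl fun j hj => ?_)) rfl
      rw [Finsupp.erase_ne (ne_of_mem_of_not_mem hj hi)]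
    · intro m hm
      rw [ih, if_neg fun h => hi (h (Finsupp.mem_support_iff.2 hm))]

/-- The infinite product `∏ u(y_j)` over all variables `y_j`, for a power series `u` with constant
coefficient `1`. -/
noncomputable def infProd (u : PowerSeries A) : MvPowerSeries ℕ A :=
  fun m => m.prod fun _ b => PowerSeries.coeff b u

theorem coeff_infProd (u : PowerSeries A) (m : ℕ →₀ ℕ) :
    MvPowerSeries.coeff m (infProd u) = m.prod fun _ b => PowerSeries.coeff b u := rfl

theorem coeff_infProd_eq {u : PowerSeries A} (hu : PowerSeries.constantCoeff u = 1) {m : ℕ →₀ ℕ}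
    {s : Finset ℕ} (hs : m.support ⊆ s) : MvPowerSeries.coeff m (infProd u) =
      MvPowerSeries.coeff m (∏ j ∈ s, u.toMvPowerSeries j) := by
  rw [coeff_prod_toMvPowerSeries (fun _ => u), if_pos hs, coeff_infProd,
    Finsupp.prod_of_support_subset _ hs]
  simpa using fun _ _ => hu

theorem infProd_mul {u v : PowerSeries A} (hu : PowerSeries.constantCoeff u = 1)
    (hv : PowerSeries.constantCoeff v = 1) : infProd (u * v) = infProd u * infProd v := by
  classical
  ext m
  rw [coeff_infProd_eq (by simp [hu, hv]) subset_rfl]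
  simp only [map_mul, Finset.prod_mul_distrib]
  rw [MvPowerSeries.coeff_mul, MvPowerSeries.coeff_mul]
  refine Finset.sum_congr rfl fun p hp => ?_
  rw [Finset.HasAntidiagonal.mem_antidiagonal] at hp
  have h1 : p.1.support ⊆ m.support := Finsupp.support_mono (hp ▸ le_self_add)
  have h2 : p.2.support ⊆ m.support := Finsupp.support_mono (hp ▸ le_add_self)
  rw [coeff_infProd_eq hu h1, coeff_infProd_eq hv h2]

theorem infProd_one : infProd (1 : PowerSeries A) = 1 := by
  classical
  ext m
  rw [coeff_infProd_eq (by simp) subset_rfl]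
  simp

theorem infProd_prod {ι : Type*} (s : Finset ι) {u : ι → PowerSeries A}
    (hu : ∀ i, PowerSeries.constantCoeff (u i) = 1) :
    infProd (∏ i ∈ s, u i) = ∏ i ∈ s, infProd (u i) := by
  classical
  induction s using Finset.induction_on with
  | empty => simp [infProd_one]
  | insert i s hi ih =>
    rw [Finset.prod_insert hi, Finset.prod_insert hi, infProd_mul (hu i), ih]
    simp [hu]

/-- The coefficient of `t ^ r` in a series in the variables `y_j` over the power series in `t`. -/
noncomputable def tCoeff (r : ℕ) (Q : MvPowerSeries ℕ (PowerSeries A)) : MvPowerSeries ℕ A :=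
  fun d => PowerSeries.coeff r (MvPowerSeries.coeff d Q)

theorem coeff_tCoeff (r : ℕ) (Q : MvPowerSeries ℕ (PowerSeries A)) (d : ℕ →₀ ℕ) :
    MvPowerSeries.coeff d (tCoeff r Q) = PowerSeries.coeff r (MvPowerSeries.coeff d Q) := rfl

/-- The substitution of the variable `x_i` for `t`. -/
noncomputable def substVar (i : ℕ) : PowerSeries A →+* MvPowerSeries ℕ A :=
  (PowerSeries.toMvPowerSeries i : _ →ₐ[A] MvPowerSeries ℕ A).toRingHom

/-- Series in `y` whose coefficients are series in one variable `t` yield, by substituting the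
different variables `x_i` for `t`, a product whose coefficients are read off factor by factor. -/
theorem coeff_coeff_prod_map (Q : ℕ → MvPowerSeries ℕ (PowerSeries A)) (s : Finset ℕ)
    (n m : ℕ →₀ ℕ) :
    MvPowerSeries.coeff n (MvPowerSeries.coeff m
      (∏ i ∈ s, MvPowerSeries.map (substVar i) (Q i))) =
      if n.support ⊆ s then MvPowerSeries.coeff m
        (∏ i ∈ s, tCoeff (n i) (Q i)) else 0 := by
  classical
  induction s using Finset.induction_on generalizing n m with
  | empty =>
    simp only [Finset.prod_empty, MvPowerSeries.coeff_one, Finset.subset_empty,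
      Finsupp.support_eq_empty]
    by_cases hm : m = 0 <;> simp [hm, MvPowerSeries.coeff_one]
  | insert i s hi ih =>
    have h1 : (n.erase i).support ⊆ s ↔ n.support ⊆ insert i s := by
      rw [Finsupp.support_erase, Finset.subset_insert_iff]
    have h2 : ∀ p : (ℕ →₀ ℕ) × (ℕ →₀ ℕ), MvPowerSeries.coeff n
        (MvPowerSeries.coeff p.1 (MvPowerSeries.map (substVar i) (Q i)) *
        MvPowerSeries.coeff p.2 (∏ i ∈ s, MvPowerSeries.map (substVar i) (Q i))) =
        if n.support ⊆ insert i s then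
          PowerSeries.coeff (n i) (MvPowerSeries.coeff p.1 (Q i)) * MvPowerSeries.coeff p.2
          (∏ i ∈ s, tCoeff (n i) (Q i)) else 0 := by
      intro p
      rw [MvPowerSeries.coeff_map]
      refine (coeff_toMvPowerSeries_mul _ ?_ n).trans ?_
      · intro n' hn'
        rw [ih, if_neg fun h => hi (h (Finsupp.mem_support_iff.2 hn'))]
      · rw [ih, mul_ite, mul_zero]
        simp only [h1]
        refine if_congr Iff.rfl (congrArg _ (congrArg _ (Finset.prod_congr rfl fun j hj => ?_))) rfl
        rw [Finsupp.erase_ne (ne_of_mem_of_not_mem hj hi)]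
    rw [Finset.prod_insert hi, Finset.prod_insert hi, MvPowerSeries.coeff_mul,
      MvPowerSeries.coeff_mul, map_sum, Finset.sum_congr rfl fun p _ => h2 p]
    split_ifs
    · rfl
    · exact Finset.sum_const_zero

end InfProd

/-! ### The Cauchy kernel -/

section Kernel

/-- The geometric series `1 / (1 - a * y)` in the variable `y`. -/
noncomputable def geomSeries {A : Type*} [CommRing A] (a : A) : PowerSeries A :=
  PowerSeries.mk fun b => a ^ b

theorem constantCoeff_geomSeries {A : Type*} [CommRing A] (a : A) :
    PowerSeries.constantCoeff (geomSeries a) = 1 := by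
  rw [← PowerSeries.coeff_zero_eq_constantCoeff_apply, geomSeries, PowerSeries.coeff_mk, pow_zero]

theorem one_sub_mul_geomSeries {A : Type*} [CommRing A] (a : A) :
    (1 - PowerSeries.C a * PowerSeries.X) * geomSeries a = 1 := by
  ext b
  rw [sub_mul, one_mul, mul_assoc, map_sub, PowerSeries.coeff_C_mul]
  cases b with
  | zero => simp [geomSeries]
  | succ b => simp [geomSeries, PowerSeries.coeff_succ_X_mul, pow_succ', PowerSeries.coeff_one]

/-- The series `t / (1 + β * t)`, the negative of the `t̄` of the Cauchy kernel. -/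
noncomputable def negBar : PowerSeries ℤ[X] :=
  PowerSeries.X * PowerSeries.invOfUnit (1 + PowerSeries.C X * PowerSeries.X) 1

theorem negBar_mul : negBar * (1 + PowerSeries.C X * PowerSeries.X) = PowerSeries.X := by
  have h : (1 + PowerSeries.C (X : ℤ[X]) * PowerSeries.X) *
      PowerSeries.invOfUnit (1 + PowerSeries.C X * PowerSeries.X) 1 = 1 :=
    PowerSeries.mul_invOfUnit _ _ (by simp)
  rw [negBar, mul_assoc, mul_comm _ (1 + _), h, mul_one]

theorem constantCoeff_negBar : PowerSeries.constantCoeff negBar = 0 := by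
  simp [negBar]

/-- The factor `(1 + a * y) / (1 - b * y)`. -/
noncomputable def linFactor {A : Type*} [CommRing A] (a b : A) : PowerSeries A :=
  (1 + PowerSeries.C a * PowerSeries.X) * geomSeries b

theorem constantCoeff_linFactor {A : Type*} [CommRing A] (a b : A) :
    PowerSeries.constantCoeff (linFactor a b) = 1 := by
  simp [linFactor, constantCoeff_geomSeries]

theorem map_linFactor_eq_one {φ : PowerSeries (PowerSeries ℤ[X])} {a b : PowerSeries ℤ[X]}
    (hφ : φ = linFactor a b) (ha : PowerSeries.constantCoeff a = 0)
    (hb : PowerSeries.constantCoeff b = 0) :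
    PowerSeries.map PowerSeries.constantCoeff φ = 1 := by
  have h := congrArg (PowerSeries.map (PowerSeries.constantCoeff (R := ℤ[X])))
    (one_sub_mul_geomSeries b)
  simp only [map_mul, map_sub, map_one, PowerSeries.map_C, PowerSeries.map_X, hb, map_zero,
    zero_mul, sub_zero, one_mul] at h
  simp [hφ, linFactor, ha, h]

theorem infProd_map {A B : Type*} [CommRing A] [CommRing B] (f : A →+* B) (u : PowerSeries A) :
    infProd (PowerSeries.map f u) = MvPowerSeries.map f (infProd u) := by
  ext m
  rw [MvPowerSeries.coeff_map, coeff_infProd, coeff_infProd, map_finsuppProd]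
  simp

/-- The coefficient of `x ^ n` in the product of all `φ(x_i, y_j)`, as a series in `y`. -/
noncomputable def kernelCoeff (φ : PowerSeries (PowerSeries ℤ[X])) (n : ℕ →₀ ℕ) : Series :=
  n.prod fun _ r => tCoeff r (infProd φ)

theorem coeff_kernelCoeff {φ : PowerSeries (PowerSeries ℤ[X])}
    (h1 : PowerSeries.constantCoeff φ = 1)
    (h0 : PowerSeries.map PowerSeries.constantCoeff φ = 1) {n : ℕ →₀ ℕ} {s : Finset ℕ}
    (hs : n.support ⊆ s) (m : ℕ →₀ ℕ) :
    MvPowerSeries.coeff m (kernelCoeff φ n) = MvPowerSeries.coeff n (MvPowerSeries.coeff m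
      (infProd (∏ i ∈ s, PowerSeries.map (substVar i) φ))) := by
  have h2 : tCoeff 0 (infProd φ) = 1 := by
    have : tCoeff 0 (infProd φ) = MvPowerSeries.map PowerSeries.constantCoeff (infProd φ) := by
      ext m : 1
      rw [coeff_tCoeff, MvPowerSeries.coeff_map, PowerSeries.coeff_zero_eq_constantCoeff_apply]
    rw [this, ← infProd_map, h0, infProd_one]
  have h3 : ∀ i, PowerSeries.constantCoeff (PowerSeries.map (substVar i) φ) = 1 := fun i => by
    rw [← PowerSeries.coeff_zero_eq_constantCoeff_apply, PowerSeries.coeff_map,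
      PowerSeries.coeff_zero_eq_constantCoeff_apply, h1, map_one]
  have h4 := coeff_coeff_prod_map (fun _ => infProd φ) s n m
  rw [if_pos hs] at h4
  rw [infProd_prod s h3, kernelCoeff, Finsupp.prod_of_support_subset _ hs _ fun _ _ => h2, ← h4]
  simp only [infProd_map]

/-- Separating two sets of variables `y` multiplies the kernels. -/
theorem coeff_kernelCoeff_add_shiftExp {φ : PowerSeries (PowerSeries ℤ[X])}
    (h1 : PowerSeries.constantCoeff φ = 1)
    (h0 : PowerSeries.map PowerSeries.constantCoeff φ = 1) (n : ℕ →₀ ℕ) {N : ℕ} {m : ℕ →₀ ℕ}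
    (hm : SuppLT N m) (m' : ℕ →₀ ℕ) :
    MvPowerSeries.coeff (m + shiftExp N m') (kernelCoeff φ n) =
      ∑ p ∈ Finset.HasAntidiagonal.antidiagonal n, MvPowerSeries.coeff m (kernelCoeff φ p.1) *
        MvPowerSeries.coeff m' (kernelCoeff φ p.2) := by
  classical
  have hdisj : Disjoint m.support (shiftExp N m').support := by
    rw [Finset.disjoint_left]
    intro k hk hk'
    rw [Finsupp.mem_support_iff] at hk hk'
    by_cases h : N ≤ k
    · exact hk (hm k h)
    · exact hk' (shiftExp_of_lt m' (not_le.1 h))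
  rw [coeff_kernelCoeff h1 h0 subset_rfl, coeff_infProd, Finsupp.prod_add_index_of_disjoint hdisj,
    shiftExp, Finsupp.prod_mapDomain_index_inj (add_left_injective N), MvPowerSeries.coeff_mul]
  refine Finset.sum_congr rfl fun p hp => ?_
  rw [Finset.HasAntidiagonal.mem_antidiagonal] at hp
  have hp1 : p.1.support ⊆ n.support := Finsupp.support_mono (hp ▸ le_self_add)
  have hp2 : p.2.support ⊆ n.support := Finsupp.support_mono (hp ▸ le_add_self)
  rw [coeff_kernelCoeff h1 h0 hp1, coeff_kernelCoeff h1 h0 hp2, coeff_infProd, coeff_infProd]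

/-! Series in two sets of variables as series in `y` with coefficients in the series in `x`. -/

theorem sumElim_add (a b c d : ℕ →₀ ℕ) :
    Finsupp.sumElim a b + Finsupp.sumElim c d = Finsupp.sumElim (a + c) (b + d) := by
  ext k
  cases k <;> simp

/-- A series in the variables `x` and `y` as a series in `y` whose coefficients are series
in `x`. -/
noncomputable def currySeries (F : Series₂) : MvPowerSeries ℕ Series :=
  fun m => (fun n => MvPowerSeries.coeff (Finsupp.sumElim n m) F : Series)

theorem coeff_currySeries (F : Series₂) (m n : ℕ →₀ ℕ) :
    MvPowerSeries.coeff n (MvPowerSeries.coeff m (currySeries F)) =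
      MvPowerSeries.coeff (Finsupp.sumElim n m) F := rfl

/-- The ring homomorphism `currySeries`. -/
noncomputable def curryHom : Series₂ →+* MvPowerSeries ℕ Series where
  toFun := currySeries
  map_zero' := rfl
  map_add' _ _ := rfl
  map_one' := by
    classical
    refine MvPowerSeries.ext fun m => MvPowerSeries.ext fun n => ?_
    rw [coeff_currySeries, MvPowerSeries.coeff_one, MvPowerSeries.coeff_one]
    have : Finsupp.sumElim n m = 0 ↔ m = 0 ∧ n = 0 := by
      constructor
      · intro h
        exact ⟨Finsupp.ext fun k => DFunLike.congr_fun h (Sum.inr k),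
          Finsupp.ext fun k => DFunLike.congr_fun h (Sum.inl k)⟩
      · rintro ⟨rfl, rfl⟩
        ext k
        cases k <;> rfl
    rw [if_congr this rfl rfl]
    by_cases hm : m = 0 <;> simp [hm, MvPowerSeries.coeff_one]
  map_mul' F G := by
    classical
    refine MvPowerSeries.ext fun m => MvPowerSeries.ext fun n => ?_
    rw [coeff_currySeries, MvPowerSeries.coeff_mul, MvPowerSeries.coeff_mul, map_sum]
    simp only [MvPowerSeries.coeff_mul, coeff_currySeries]
    rw [← Finset.sum_product']
    refine Finset.sum_bij'
      (fun p _ => ((p.1.comapDomain Sum.inr Sum.inr_injective.injOn,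
          p.2.comapDomain Sum.inr Sum.inr_injective.injOn),
        (p.1.comapDomain Sum.inl Sum.inl_injective.injOn,
          p.2.comapDomain Sum.inl Sum.inl_injective.injOn)))
      (fun q _ => (Finsupp.sumElim q.2.1 q.1.1, Finsupp.sumElim q.2.2 q.1.2)) ?_ ?_ ?_ ?_ ?_
    · intro p hp
      rw [Finset.HasAntidiagonal.mem_antidiagonal] at hp
      simp only [Finset.mem_product, Finset.HasAntidiagonal.mem_antidiagonal]
      exact ⟨Finsupp.ext fun k => DFunLike.congr_fun hp (Sum.inr k),
        Finsupp.ext fun k => DFunLike.congr_fun hp (Sum.inl k)⟩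
    · intro q hq
      simp only [Finset.mem_product, Finset.HasAntidiagonal.mem_antidiagonal] at hq ⊢
      rw [sumElim_add, hq.1, hq.2]
    · intro p _
      refine Prod.ext (Finsupp.ext fun k => ?_) (Finsupp.ext fun k => ?_) <;> cases k <;> rfl
    · intro q _
      exact Prod.ext (Prod.ext (Finsupp.ext fun _ => rfl) (Finsupp.ext fun _ => rfl))
        (Prod.ext (Finsupp.ext fun _ => rfl) (Finsupp.ext fun _ => rfl))
    · intro p _
      have h : ∀ a : ℕ ⊕ ℕ →₀ ℕ, Finsupp.sumElim (a.comapDomain Sum.inl Sum.inl_injective.injOn)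
          (a.comapDomain Sum.inr Sum.inr_injective.injOn) = a := fun a => by
        ext k
        cases k <;> rfl
      conv_lhs => rw [← h p.1, ← h p.2]

theorem coeff_curryHom (F : Series₂) (m n : ℕ →₀ ℕ) :
    MvPowerSeries.coeff n (MvPowerSeries.coeff m (curryHom F)) =
      MvPowerSeries.coeff (Finsupp.sumElim n m) F := rfl

theorem curryHom_C (a : ℤ[X]) : curryHom (MvPowerSeries.C a) = MvPowerSeries.C (MvPowerSeries.C a) := by
  classical
  have h : (MvPowerSeries.C a : Series₂) = MvPowerSeries.C a * 1 := by rw [mul_one]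
  have h' : (MvPowerSeries.C (MvPowerSeries.C a) : MvPowerSeries ℕ Series) =
    MvPowerSeries.C (MvPowerSeries.C a) * 1 := by rw [mul_one]
  refine MvPowerSeries.ext fun m => MvPowerSeries.ext fun n => ?_
  rw [h, h', coeff_curryHom, MvPowerSeries.coeff_C_mul, MvPowerSeries.coeff_C_mul,
    MvPowerSeries.coeff_C_mul, ← coeff_curryHom, map_one]

theorem curryHom_X_inl (i : ℕ) :
    curryHom (MvPowerSeries.X (Sum.inl i)) = MvPowerSeries.C (MvPowerSeries.X i) := by
  classical
  refine MvPowerSeries.ext fun m => MvPowerSeries.ext fun n => ?_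
  rw [coeff_curryHom, MvPowerSeries.coeff_X, MvPowerSeries.coeff_C]
  have : Finsupp.sumElim n m = Finsupp.single (Sum.inl i) 1 ↔ m = 0 ∧ n = Finsupp.single i 1 := by
    constructor
    · intro h
      exact ⟨Finsupp.ext fun k => by simpa using DFunLike.congr_fun h (Sum.inr k),
        Finsupp.ext fun k => by
          simpa [Finsupp.single_apply] using DFunLike.congr_fun h (Sum.inl k)⟩
    · rintro ⟨rfl, rfl⟩
      ext k
      cases k <;> simp [Finsupp.single_apply]
  rw [if_congr this rfl rfl]
  by_cases hm : m = 0 <;> simp [hm, MvPowerSeries.coeff_X]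

theorem curryHom_X_inr (j : ℕ) :
    curryHom (MvPowerSeries.X (Sum.inr j)) = MvPowerSeries.X j := by
  classical
  refine MvPowerSeries.ext fun m => MvPowerSeries.ext fun n => ?_
  rw [coeff_curryHom, MvPowerSeries.coeff_X, MvPowerSeries.coeff_X]
  have : Finsupp.sumElim n m = Finsupp.single (Sum.inr j) 1 ↔ m = Finsupp.single j 1 ∧ n = 0 := by
    constructor
    · intro h
      exact ⟨Finsupp.ext fun k => by
          simpa [Finsupp.single_apply] using DFunLike.congr_fun h (Sum.inr k),
        Finsupp.ext fun k => by simpa using DFunLike.congr_fun h (Sum.inl k)⟩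
    · rintro ⟨rfl, rfl⟩
      ext k
      cases k <;> simp [Finsupp.single_apply]
  rw [if_congr this rfl rfl]
  by_cases hm : m = Finsupp.single j 1 <;> simp [hm, MvPowerSeries.coeff_one]

/-- The factor of `cauchyKernel` with index `(i, j)`. -/
noncomputable def kernelFactor (p : ℕ × ℕ) : Series₂ :=
  (1 - xBar p.1 * MvPowerSeries.X (Sum.inr p.2)) *
    MvPowerSeries.invOfUnit (1 - MvPowerSeries.X (Sum.inl p.1) * MvPowerSeries.X (Sum.inr p.2)) 1

theorem kernelFactor_mul (p : ℕ × ℕ) : kernelFactor p *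
    (1 - MvPowerSeries.X (Sum.inl p.1) * MvPowerSeries.X (Sum.inr p.2)) =
      1 - xBar p.1 * MvPowerSeries.X (Sum.inr p.2) := by
  rw [kernelFactor, mul_assoc, mul_comm (MvPowerSeries.invOfUnit _ _),
    MvPowerSeries.mul_invOfUnit _ _ (by simp), mul_one]

theorem xBar_mul (i : ℕ) : xBar i * (1 + (X : ℤ[X]) • MvPowerSeries.X (Sum.inl i)) =
    - MvPowerSeries.X (Sum.inl i) := by
  rw [xBar, mul_assoc, mul_comm (MvPowerSeries.invOfUnit _ _),
    MvPowerSeries.mul_invOfUnit _ _ (by simp), mul_one]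

/-- The kernel `(1 + t y / (1 + β t)) / (1 - t y)` in single variables `t` and `y`. -/
noncomputable def cauchyFactor : PowerSeries (PowerSeries ℤ[X]) := linFactor negBar PowerSeries.X

theorem curryHom_kernelFactor (i j : ℕ) : curryHom (kernelFactor (i, j)) =
    PowerSeries.toMvPowerSeries j (PowerSeries.map (substVar i) cauchyFactor) := by
  set Ψ : PowerSeries (PowerSeries ℤ[X]) →+* MvPowerSeries ℕ Series :=
    (substVar (A := Series) j).comp
      (PowerSeries.map (substVar i)) with hΨ
  change _ = Ψ cauchyFactor
  have hX : Ψ PowerSeries.X = MvPowerSeries.X j := by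
    change PowerSeries.toMvPowerSeries j (PowerSeries.map (substVar i) PowerSeries.X) = _
    rw [PowerSeries.map_X, PowerSeries.toMvPowerSeries_X]
  have hC : ∀ q, Ψ (PowerSeries.C q) = MvPowerSeries.C (substVar i q) := fun q => by
    change PowerSeries.toMvPowerSeries j (PowerSeries.map (substVar i) (PowerSeries.C q)) = _
    rw [PowerSeries.map_C, PowerSeries.toMvPowerSeries_C]
  have ht : substVar i (PowerSeries.X : PowerSeries ℤ[X]) = MvPowerSeries.X i :=
    PowerSeries.toMvPowerSeries_X i
  have hcc : ∀ a : ℤ[X], substVar i (PowerSeries.C a) = MvPowerSeries.C a :=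
    PowerSeries.toMvPowerSeries_C i
  -- both sides satisfy the same linear equations with invertible coefficients
  have e1 := congrArg curryHom (kernelFactor_mul (i, j))
  have e2 := congrArg curryHom (xBar_mul i)
  have e3 := congrArg Ψ (one_sub_mul_geomSeries (PowerSeries.X : PowerSeries ℤ[X]))
  have e4 := congrArg (fun q => MvPowerSeries.C (σ := ℕ) (substVar i q)) negBar_mul
  have e5 := congrArg (fun q => MvPowerSeries.C (σ := ℕ) (substVar i q))
    (show (1 + PowerSeries.C (X : ℤ[X]) * PowerSeries.X) *
      PowerSeries.invOfUnit (1 + PowerSeries.C X * PowerSeries.X) 1 = 1 from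
      PowerSeries.mul_invOfUnit _ _ (by simp))
  simp only [map_mul, map_sub, map_add, map_one, map_neg, MvPowerSeries.smul_eq_C_mul, curryHom_C,
    curryHom_X_inl, curryHom_X_inr, hX, hC, ht, hcc] at e1 e2 e3 e4 e5
  have e6 : curryHom (xBar i) = - MvPowerSeries.C (substVar i negBar) := by
    linear_combination (e2 + e4) * MvPowerSeries.C (substVar i
      (PowerSeries.invOfUnit (1 + PowerSeries.C X * PowerSeries.X) 1)) -
      (curryHom (xBar i) + MvPowerSeries.C (substVar i negBar)) * e5
  rw [e6] at e1
  rw [cauchyFactor, linFactor, map_mul, map_add, map_mul, map_one, hX, hC]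
  linear_combination Ψ (geomSeries PowerSeries.X) * e1 - curryHom (kernelFactor (i, j)) * e3

theorem coeff_kernelFactor_mul (p : ℕ × ℕ) (F : Series₂) {d : ℕ ⊕ ℕ →₀ ℕ}
    (hd : d (Sum.inl p.1) = 0 ∨ d (Sum.inr p.2) = 0) :
    MvPowerSeries.coeff d (kernelFactor p * F) = MvPowerSeries.coeff d F := by
  set x : Series₂ := MvPowerSeries.X (Sum.inl p.1)
  set y : Series₂ := MvPowerSeries.X (Sum.inr p.2)
  -- the factor is congruent to `1` modulo `x * y`
  obtain ⟨H, hH⟩ : ∃ H, kernelFactor p = 1 + x * y * H := by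
    set v := MvPowerSeries.invOfUnit (1 + (X : ℤ[X]) • x) 1
    set w := MvPowerSeries.invOfUnit (1 - x * y) 1 with hw
    have h1 : (1 - x * y) * w = 1 := MvPowerSeries.mul_invOfUnit _ _ (by simp [x, y])
    refine ⟨(1 + v) * w, ?_⟩
    have h2 : xBar p.1 = -x * v := rfl
    have h3 : kernelFactor p = (1 - xBar p.1 * y) * w := rfl
    rw [h3, h2]
    linear_combination h1
  have h0 : MvPowerSeries.coeff d (x * y * H * F) = 0 := by
    rcases hd with hd | hd
    · exact MvPowerSeries.X_dvd_iff.1 ⟨y * H * F, by ring⟩ d hd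
    · exact MvPowerSeries.X_dvd_iff.1 ⟨x * H * F, by ring⟩ d hd
  rw [hH, add_mul, one_mul, map_add, h0, add_zero]

theorem coeff_cauchyKernel (n m : ℕ →₀ ℕ) :
    MvPowerSeries.coeff (Finsupp.sumElim n m) cauchyKernel =
      MvPowerSeries.coeff m (kernelCoeff cauchyFactor n) := by
  classical
  have hconst : PowerSeries.constantCoeff cauchyFactor = 1 := constantCoeff_linFactor _ _
  have hmap : PowerSeries.map PowerSeries.constantCoeff cauchyFactor = 1 :=
    map_linFactor_eq_one rfl constantCoeff_negBar (by simp)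
  have hprod : cauchyKernel = formalProd kernelFactor := rfl
  rw [hprod, coeff_formalProd (fun d => (d.comapDomain Sum.inl Sum.inl_injective.injOn).support ×ˢ
    (d.comapDomain Sum.inr Sum.inr_injective.injOn).support) ?_]
  · have h4 : (Finsupp.sumElim n m).comapDomain Sum.inl Sum.inl_injective.injOn = n :=
      Finsupp.ext fun _ => rfl
    have h5 : (Finsupp.sumElim n m).comapDomain Sum.inr Sum.inr_injective.injOn = m :=
      Finsupp.ext fun _ => rfl
    rw [h4, h5]
    have h3 : ∀ i, PowerSeries.constantCoeff (PowerSeries.map (substVar i) cauchyFactor) = 1 :=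
      fun i => by
        rw [← PowerSeries.coeff_zero_eq_constantCoeff_apply, PowerSeries.coeff_map,
          PowerSeries.coeff_zero_eq_constantCoeff_apply, hconst, map_one]
    rw [coeff_kernelCoeff hconst hmap subset_rfl, coeff_infProd_eq (by simp [map_prod, h3]) subset_rfl,
      ← coeff_curryHom, map_prod, Finset.prod_product, Finset.prod_comm]
    simp only [curryHom_kernelFactor, map_prod]
  · intro d t ht
    induction t using Finset.strongInduction with
    | H t ih =>
      rcases ht.eq_or_ssubset with rfl | hlt
      · rfl
      · obtain ⟨p, hpt, hps⟩ := Finset.exists_of_ssubset hlt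
        rw [← Finset.mul_prod_erase t _ hpt, coeff_kernelFactor_mul,
          ih _ (Finset.erase_ssubset hpt) (Finset.subset_erase.2 ⟨ht, hps⟩)]
        simp only [Finset.mem_product, Finsupp.mem_support_iff, Finsupp.comapDomain_apply] at hps
        tauto

end Kernel

/-! ### Horizontal and vertical strips of Young diagrams -/

namespace YoungDiagram

theorem le_iff_rowLen {Y Z : YoungDiagram} : Y ≤ Z ↔ ∀ i, Y.rowLen i ≤ Z.rowLen i := by
  constructor
  · intro h i
    by_contra! hlt
    exact lt_irrefl _ (mem_iff_lt_rowLen.1 (h (mem_iff_lt_rowLen.2 hlt)))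
  · rintro h ⟨i, j⟩ hij
    exact mem_iff_lt_rowLen.2 ((mem_iff_lt_rowLen.1 hij).trans_le (h i))

theorem rowLen_injective : Function.Injective rowLen := fun _ _ h =>
  le_antisymm (le_iff_rowLen.2 fun i => (congrFun h i).le)
    (le_iff_rowLen.2 fun i => (congrFun h i).ge)

theorem card_le_card {Y Z : YoungDiagram} (h : Y ≤ Z) : Y.card ≤ Z.card :=
  Finset.card_le_card h

theorem card_transpose (Y : YoungDiagram) : Y.transpose.card = Y.card := by
  refine Finset.card_bij' (fun p _ => p.swap) (fun p _ => p.swap) ?_ ?_ ?_ ?_ <;> simp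

theorem lt_card_of_mem {Y : YoungDiagram} {i j : ℕ} (h : (i, j) ∈ Y) : i < Y.card := by
  have hsub : (Finset.range (i + 1)).image (fun k => (k, j)) ⊆ Y.cells := by
    intro p hp
    simp only [Finset.mem_image, Finset.mem_range] at hp
    obtain ⟨k, hk, rfl⟩ := hp
    exact Y.up_left_mem (by omega) le_rfl h
  have := Finset.card_le_card hsub
  rw [Finset.card_image_of_injective _ fun a b hab => (Prod.ext_iff.1 hab).1,
    Finset.card_range] at this
  exact this

theorem rowLen_eq_zero {Y : YoungDiagram} {i : ℕ} (h : Y.card ≤ i) : Y.rowLen i = 0 := by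
  by_contra hne
  have := lt_card_of_mem (mem_iff_lt_rowLen.2 (Nat.pos_of_ne_zero hne))
  omega

theorem card_eq_sum_rowLen {Y : YoungDiagram} {N : ℕ} (h : Y.rowLen N = 0) :
    Y.card = ∑ i ∈ Finset.range N, Y.rowLen i := by
  rw [YoungDiagram.card, Finset.card_eq_sum_card_fiberwise (f := Prod.fst) (t := Finset.range N)]
  · refine Finset.sum_congr rfl fun i _ => ?_
    rw [rowLen_eq_card]
    rfl
  · intro p hp
    by_contra hcon
    simp only [Finset.coe_range, Set.mem_Iio, not_lt] at hcon
    have h1 : p.2 < Y.rowLen p.1 := mem_iff_lt_rowLen.1 hp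
    have h2 := Y.rowLen_anti _ _ hcon
    omega

theorem finite_card_le (d : ℕ) : {Y : YoungDiagram | Y.card ≤ d}.Finite := by
  refine Set.Finite.of_finite_image (f := cells)
    ((Finset.range d ×ˢ Finset.range d).powerset.finite_toSet.subset ?_)
    fun Y _ Z _ h => YoungDiagram.ext h
  rintro _ ⟨Y, hY, rfl⟩
  simp only [Finset.coe_powerset, Set.mem_preimage, Set.mem_powerset_iff, Finset.coe_subset]
  intro p hp
  have h1 := lt_card_of_mem (i := p.1) (j := p.2) (Y := Y) hp
  have h2 := lt_card_of_mem (i := p.2) (j := p.1) (Y := Y.transpose) (by simpa using hp)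
  rw [card_transpose] at h2
  have hY' : Y.card ≤ d := hY
  simp only [Finset.mem_product, Finset.mem_range]
  omega

/-- The Young diagrams with at most `d` boxes. -/
noncomputable def sizeLE (d : ℕ) : Finset YoungDiagram := (finite_card_le d).toFinset

theorem mem_sizeLE {d : ℕ} {Y : YoungDiagram} : Y ∈ sizeLE d ↔ Y.card ≤ d := by
  simp [sizeLE]

/-- The Young diagram with row lengths `f 0, f 1, ..., f (N - 1)`, if these are weakly decreasing;
in general its rows have the lengths `min (f 0) ... (f i)`. -/
def ofRowFun (f : ℕ → ℕ) (N : ℕ) : YoungDiagram where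
  cells := (Finset.range N ×ˢ Finset.range (f 0)).filter fun p => ∀ k ≤ p.1, p.2 < f k
  isLowerSet := by
    rintro ⟨i, j⟩ ⟨i', j'⟩ ⟨hi, hj⟩ h
    simp only [Finset.coe_filter, Finset.mem_product, Finset.mem_range, Set.mem_ofPred_eq] at *
    exact ⟨by omega, fun k hk => hj.trans_lt (h.2 k (hk.trans hi))⟩

theorem rowLen_ofRowFun {f : ℕ → ℕ} {N : ℕ} (hf : ∀ i, f (i + 1) ≤ f i) (hN : f N = 0) (i : ℕ) :
    (ofRowFun f N).rowLen i = f i := by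
  have hf' : Antitone f := antitone_nat_of_succ_le hf
  refine eq_of_forall_lt_iff fun j => ?_
  rw [← mem_iff_lt_rowLen, ← mem_cells]
  simp only [ofRowFun, Finset.mem_filter, Finset.mem_product, Finset.mem_range]
  constructor
  · exact fun h => h.2 i le_rfl
  · refine fun h => ⟨⟨?_, h.trans_le (hf' (Nat.zero_le i))⟩, fun k hk => h.trans_le (hf' hk)⟩
    by_contra! hcon
    have := hf' hcon
    omega

/-- `Y/ρ` is a horizontal strip with `a` boxes. -/
def IsHStrip (a : ℕ) (ρ Y : YoungDiagram) : Prop :=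
  (∀ i, ρ.rowLen i ≤ Y.rowLen i ∧ Y.rowLen (i + 1) ≤ ρ.rowLen i) ∧ ρ.card + a = Y.card

/-- `Y/ρ` is a vertical strip with `a` boxes. -/
def IsVStrip (a : ℕ) (ρ Y : YoungDiagram) : Prop := IsHStrip a ρ.transpose Y.transpose

theorem IsHStrip.le {a : ℕ} {ρ Y : YoungDiagram} (h : IsHStrip a ρ Y) : ρ ≤ Y :=
  le_iff_rowLen.2 fun i => (h.1 i).1

theorem isVStrip_iff {a : ℕ} {ρ Y : YoungDiagram} : IsVStrip a ρ Y ↔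
    (∀ i, ρ.rowLen i ≤ Y.rowLen i ∧ Y.rowLen i ≤ ρ.rowLen i + 1) ∧ ρ.card + a = Y.card := by
  rw [IsVStrip, IsHStrip, card_transpose, card_transpose]
  refine and_congr_left fun _ => ?_
  rw [forall_and, forall_and, ← le_iff_rowLen, ← le_iff_rowLen, transpose_le_iff]
  refine and_congr_right fun _ => ?_
  simp only [rowLen_transpose]
  constructor
  · intro h i
    by_contra! hcon
    have h1 := mem_iff_lt_colLen.1 (mem_iff_lt_rowLen.2 hcon)
    have h2 := mem_iff_lt_rowLen.1 (mem_iff_lt_colLen.2 (h1.trans_le (h _)))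
    exact lt_irrefl _ h2
  · intro h j
    by_contra! hcon
    have h1 := mem_iff_lt_rowLen.1 (mem_iff_lt_colLen.2 hcon)
    have h2 : j < ρ.rowLen (ρ.colLen j) := by
      have := h (ρ.colLen j)
      omega
    exact lt_irrefl _ (mem_iff_lt_colLen.1 (mem_iff_lt_rowLen.2 h2))

open Classical in
/-- The diagrams obtained from `Y` by removing a horizontal strip with `a` boxes. -/
noncomputable def hDowns (a : ℕ) (Y : YoungDiagram) : Finset YoungDiagram :=
  (sizeLE Y.card).filter fun ρ => IsHStrip a ρ Y

open Classical in
/-- The diagrams obtained from `Y` by adding a horizontal strip with `r` boxes. -/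
noncomputable def hUps (r : ℕ) (Y : YoungDiagram) : Finset YoungDiagram :=
  (sizeLE (Y.card + r)).filter fun τ => IsHStrip r Y τ

open Classical in
/-- The diagrams obtained from `Y` by removing a vertical strip with `a` boxes. -/
noncomputable def vDowns (a : ℕ) (Y : YoungDiagram) : Finset YoungDiagram :=
  (sizeLE Y.card).filter fun ρ => IsVStrip a ρ Y

theorem mem_hDowns {a : ℕ} {ρ Y : YoungDiagram} : ρ ∈ hDowns a Y ↔ IsHStrip a ρ Y := by
  classical
  rw [hDowns, Finset.mem_filter, mem_sizeLE, and_iff_right_iff_imp]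
  exact fun h => h.2 ▸ Nat.le_add_right _ _

theorem mem_hUps {r : ℕ} {τ Y : YoungDiagram} : τ ∈ hUps r Y ↔ IsHStrip r Y τ := by
  classical
  rw [hUps, Finset.mem_filter, mem_sizeLE, and_iff_right_iff_imp]
  exact fun h => h.2.ge

theorem mem_vDowns {a : ℕ} {ρ Y : YoungDiagram} : ρ ∈ vDowns a Y ↔ IsVStrip a ρ Y := by
  classical
  rw [vDowns, Finset.mem_filter, mem_sizeLE, and_iff_right_iff_imp]
  intro h
  rw [isVStrip_iff] at h
  exact h.2 ▸ Nat.le_add_right _ _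

theorem sum_vDowns_transpose {M : Type*} [AddCommMonoid M] (a : ℕ) (Y : YoungDiagram)
    (f : YoungDiagram → M) :
    ∑ ρ ∈ vDowns a Y, f ρ.transpose = ∑ ρ ∈ hDowns a Y.transpose, f ρ := by
  refine Finset.sum_bij' (fun ρ _ => ρ.transpose) (fun ρ _ => ρ.transpose) ?_ ?_ ?_ ?_ ?_
  · exact fun ρ hρ => mem_hDowns.2 (mem_vDowns.1 hρ)
  · intro ρ hρ
    rw [mem_vDowns, IsVStrip, transpose_transpose]
    exact mem_hDowns.1 hρ
  · exact fun ρ _ => transpose_transpose ρ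
  · exact fun ρ _ => transpose_transpose ρ
  · exact fun ρ _ => rfl

theorem card_add_rowLen {Y Z : YoungDiagram} {k : ℕ}
    (h : ∀ i, i ≠ k → Y.rowLen i = Z.rowLen i) : Y.card + Z.rowLen k = Z.card + Y.rowLen k := by
  set N := Y.card + Z.card + k + 1
  have hk : k ∈ Finset.range N := Finset.mem_range.2 (by omega)
  rw [card_eq_sum_rowLen (Y := Y) (N := N) (rowLen_eq_zero (by omega)),
    card_eq_sum_rowLen (Y := Z) (N := N) (rowLen_eq_zero (by omega)),
    ← Finset.add_sum_erase _ _ hk, ← Finset.add_sum_erase _ Z.rowLen hk,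
    Finset.sum_congr rfl fun i hi => h i (Finset.ne_of_mem_erase hi)]
  ring

/-- The row by row reflection exchanging the common lower and upper bounds of `Y` and `κ` in the
interlacing order changes the number of boxes in a controlled way. -/
theorem card_add_card_of_rowLen_add {Y κ ρ τ : YoungDiagram} {c : ℕ}
    (h0 : τ.rowLen 0 = max (Y.rowLen 0) (κ.rowLen 0) + c)
    (h : ∀ i, τ.rowLen (i + 1) + ρ.rowLen i =
      max (Y.rowLen (i + 1)) (κ.rowLen (i + 1)) + min (Y.rowLen i) (κ.rowLen i)) :
    τ.card + ρ.card = c + Y.card + κ.card := by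
  set N := Y.card + κ.card + τ.card + ρ.card
  rw [card_eq_sum_rowLen (Y := τ) (N := N + 1) (rowLen_eq_zero (by omega)),
    card_eq_sum_rowLen (Y := ρ) (N := N) (rowLen_eq_zero (by omega)),
    card_eq_sum_rowLen (Y := Y) (N := N + 1) (rowLen_eq_zero (by omega)),
    card_eq_sum_rowLen (Y := κ) (N := N + 1) (rowLen_eq_zero (by omega)), add_assoc c,
    ← Finset.sum_add_distrib, Finset.sum_range_succ' (fun i => τ.rowLen i), h0, add_right_comm,
    ← Finset.sum_add_distrib]
  simp only [h]
  rw [Finset.sum_add_distrib,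
    Finset.sum_congr rfl fun i _ => (max_add_min (Y.rowLen i) (κ.rowLen i)).symm,
    Finset.sum_add_distrib, Finset.sum_range_succ' (fun i => max (Y.rowLen i) (κ.rowLen i)),
    Finset.sum_range_succ (fun i => min (Y.rowLen i) (κ.rowLen i)),
    rowLen_eq_zero (Y := Y) (i := N) (by omega), rowLen_eq_zero (Y := κ) (i := N) (by omega)]
  simp only [min_self]
  ring

/-- Adding a horizontal strip to `Y` and then removing one amounts to first removing and then adding
one, where an additional part `q.1` comes from the first row. -/
theorem sum_hUps_hDowns {M : Type*} [AddCommMonoid M] (r a : ℕ) (Y : YoungDiagram)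
    (f : YoungDiagram → M) :
    ∑ τ ∈ hUps r Y, ∑ κ ∈ hDowns a τ, f κ =
      ∑ q ∈ (Finset.HasAntidiagonal.antidiagonal a).filter (fun q => q.1 ≤ r),
        ∑ ρ ∈ hDowns q.2 Y, ∑ κ ∈ hUps (r - q.1) ρ, f κ := by
  simp only [Finset.sum_sigma']
  set down : YoungDiagram → YoungDiagram → YoungDiagram := fun κ τ =>
    ofRowFun (fun i => max (Y.rowLen (i + 1)) (κ.rowLen (i + 1)) +
      min (Y.rowLen i) (κ.rowLen i) - τ.rowLen (i + 1)) (Y.card + κ.card) with hdown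
  set up : ℕ → YoungDiagram → YoungDiagram → YoungDiagram := fun c κ ρ =>
    ofRowFun (fun i => max (Y.rowLen i) (κ.rowLen i) + if i = 0 then c else
      min (Y.rowLen (i - 1)) (κ.rowLen (i - 1)) - ρ.rowLen (i - 1)) (Y.card + κ.card + 1) with hup
  have hdownRow : ∀ {κ τ : YoungDiagram},
      (∀ i, Y.rowLen i ≤ τ.rowLen i ∧ τ.rowLen (i + 1) ≤ Y.rowLen i) →
      (∀ i, κ.rowLen i ≤ τ.rowLen i ∧ τ.rowLen (i + 1) ≤ κ.rowLen i) → ∀ i,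
      (down κ τ).rowLen i = max (Y.rowLen (i + 1)) (κ.rowLen (i + 1)) +
        min (Y.rowLen i) (κ.rowLen i) - τ.rowLen (i + 1) := by
    intro κ τ h1 h2 i
    refine rowLen_ofRowFun (fun i => ?_) ?_ i
    · have := h1 i; have := h1 (i + 1); have := h1 (i + 1 + 1)
      have := h2 i; have := h2 (i + 1); have := h2 (i + 1 + 1)
      omega
    · rw [rowLen_eq_zero (Y := Y) (by omega), rowLen_eq_zero (Y := κ) (i := _ + 1) (by omega),
        rowLen_eq_zero (Y := κ) (by omega), rowLen_eq_zero (Y := Y) (by omega)]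
      simp
  have hupRow : ∀ {κ ρ : YoungDiagram} (c : ℕ),
      (∀ i, ρ.rowLen i ≤ Y.rowLen i ∧ Y.rowLen (i + 1) ≤ ρ.rowLen i) →
      (∀ i, ρ.rowLen i ≤ κ.rowLen i ∧ κ.rowLen (i + 1) ≤ ρ.rowLen i) →
      (up c κ ρ).rowLen 0 = max (Y.rowLen 0) (κ.rowLen 0) + c ∧ ∀ i,
      (up c κ ρ).rowLen (i + 1) = max (Y.rowLen (i + 1)) (κ.rowLen (i + 1)) +
        min (Y.rowLen i) (κ.rowLen i) - ρ.rowLen i := by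
    intro κ ρ c h1 h2
    have key : ∀ i, (up c κ ρ).rowLen i = max (Y.rowLen i) (κ.rowLen i) + if i = 0 then c else
        min (Y.rowLen (i - 1)) (κ.rowLen (i - 1)) - ρ.rowLen (i - 1) := by
      intro i
      refine rowLen_ofRowFun (fun i => ?_) ?_ i
      · rw [if_neg (Nat.succ_ne_zero i), Nat.add_sub_cancel]
        have := h1 i; have := h2 i
        split_ifs <;> omega
      · have hρ : ρ.rowLen (Y.card + κ.card) = 0 := by
          have := (h1 (Y.card + κ.card)).1
          rw [rowLen_eq_zero (Y := Y) (by omega)] at this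
          omega
        rw [if_neg (Nat.succ_ne_zero _), Nat.add_sub_cancel, hρ, rowLen_eq_zero (Y := Y) (by omega),
          rowLen_eq_zero (Y := κ) (i := _ + 1) (by omega),
          rowLen_eq_zero (Y := κ) (by omega), rowLen_eq_zero (Y := Y) (by omega)]
        simp
    refine ⟨by rw [key, if_pos rfl], fun i => ?_⟩
    rw [key, if_neg (Nat.succ_ne_zero i), Nat.add_sub_cancel]
    have := h1 i; have := h2 i
    omega
  refine Finset.sum_bij'
    (fun x _ => ⟨(x.1.rowLen 0 - max (Y.rowLen 0) (x.2.rowLen 0),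
      a - (x.1.rowLen 0 - max (Y.rowLen 0) (x.2.rowLen 0))), ⟨down x.2 x.1, x.2⟩⟩)
    (fun x _ => ⟨up x.1.1 x.2.2 x.2.1, x.2.2⟩) ?_ ?_ ?_ ?_ ?_
  · rintro ⟨τ, κ⟩ hx
    simp only [Finset.mem_sigma, mem_hUps, mem_hDowns] at hx
    obtain ⟨⟨h1, h1'⟩, h2, h2'⟩ := hx
    have hrow := hdownRow h1 h2
    have hcard := card_add_card_of_rowLen_add (Y := Y) (κ := κ) (ρ := down κ τ) (τ := τ)
      (c := τ.rowLen 0 - max (Y.rowLen 0) (κ.rowLen 0))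
      (by have := h1 0; have := h2 0; omega)
      (fun i => by
        rw [hrow]
        have := h1 i; have := h1 (i + 1); have := h2 i; have := h2 (i + 1)
        omega)
    have hY : down κ τ ≤ Y := le_iff_rowLen.2 fun i => by
      rw [hrow]
      have := h1 (i + 1); have := h2 (i + 1)
      omega
    have hκ : down κ τ ≤ κ := le_iff_rowLen.2 fun i => by
      rw [hrow]
      have := h1 (i + 1); have := h2 (i + 1)
      omega
    have hY' := card_le_card hY
    have hκ' := card_le_card hκ
    simp only [Finset.mem_sigma, Finset.mem_filter, Finset.HasAntidiagonal.mem_antidiagonal,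
      mem_hUps, mem_hDowns]
    refine ⟨⟨by omega, by omega⟩, ⟨fun i => ?_, by omega⟩, ⟨fun i => ?_, by omega⟩⟩
    · rw [hrow]
      have := h1 i; have := h1 (i + 1); have := h2 i; have := h2 (i + 1)
      omega
    · rw [hrow]
      have := h1 i; have := h1 (i + 1); have := h2 i; have := h2 (i + 1)
      omega
  · rintro ⟨⟨c, a'⟩, ρ, κ⟩ hx
    simp only [Finset.mem_sigma, Finset.mem_filter, Finset.HasAntidiagonal.mem_antidiagonal,
      mem_hUps, mem_hDowns] at hx
    obtain ⟨⟨h0, h0'⟩, ⟨h1, h1'⟩, h2, h2'⟩ := hx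
    have hrow := hupRow c h1 h2
    have hcard := card_add_card_of_rowLen_add (Y := Y) (κ := κ) (ρ := ρ) (τ := up c κ ρ)
      (c := c) hrow.1 (fun i => by
        rw [hrow.2]
        have := h1 i; have := h2 i
        omega)
    simp only [Finset.mem_sigma, mem_hUps, mem_hDowns]
    refine ⟨⟨fun i => ⟨?_, ?_⟩, by omega⟩, ⟨fun i => ⟨?_, ?_⟩, by omega⟩⟩
    · cases i with
      | zero => rw [hrow.1]; omega
      | succ i => rw [hrow.2]; have := h1 i; have := h2 i; omega
    · rw [hrow.2]; have := h1 i; have := h2 i; omega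
    · cases i with
      | zero => rw [hrow.1]; omega
      | succ i => rw [hrow.2]; have := h1 i; have := h2 i; omega
    · rw [hrow.2]; have := h1 i; have := h2 i; omega
  · rintro ⟨τ, κ⟩ hx
    simp only [Finset.mem_sigma, mem_hUps, mem_hDowns] at hx
    obtain ⟨⟨h1, h1'⟩, h2, h2'⟩ := hx
    have hrow := hdownRow h1 h2
    have hup' := hupRow (κ := κ) (ρ := down κ τ) (τ.rowLen 0 - max (Y.rowLen 0) (κ.rowLen 0))
      (fun i => by
        rw [hrow]
        have := h1 i; have := h1 (i + 1); have := h2 i; have := h2 (i + 1)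
        omega)
      (fun i => by
        rw [hrow]
        have := h1 i; have := h1 (i + 1); have := h2 i; have := h2 (i + 1)
        omega)
    dsimp only
    congr 1
    refine rowLen_injective (funext fun i => ?_)
    cases i with
    | zero =>
      rw [hup'.1]
      have := h1 0; have := h2 0
      omega
    | succ i =>
      rw [hup'.2, hrow]
      have := h1 i; have := h1 (i + 1); have := h2 i; have := h2 (i + 1)
      omega
  · rintro ⟨⟨c, a'⟩, ρ, κ⟩ hx
    simp only [Finset.mem_sigma, Finset.mem_filter, Finset.HasAntidiagonal.mem_antidiagonal,
      mem_hUps, mem_hDowns] at hx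
    obtain ⟨⟨h0, h0'⟩, ⟨h1, h1'⟩, h2, h2'⟩ := hx
    have hrow := hupRow c h1 h2
    have hc : (up c κ ρ).rowLen 0 - max (Y.rowLen 0) (κ.rowLen 0) = c := by rw [hrow.1]; omega
    have hrow' := hdownRow (κ := κ) (τ := up c κ ρ) (fun i => by
        rw [hrow.2]
        cases i with
        | zero => rw [hrow.1]; have := h1 0; have := h2 0; omega
        | succ i =>
          rw [hrow.2]
          have := h1 i; have := h1 (i + 1); have := h2 i; have := h2 (i + 1)
          omega)
      (fun i => by
        rw [hrow.2]
        cases i with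
        | zero => rw [hrow.1]; have := h1 0; have := h2 0; omega
        | succ i =>
          rw [hrow.2]
          have := h1 i; have := h1 (i + 1); have := h2 i; have := h2 (i + 1)
          omega)
    have hρ : down κ (up c κ ρ) = ρ := by
      refine rowLen_injective (funext fun i => ?_)
      rw [hrow', hrow.2]
      have := h1 i; have := h2 i
      omega
    have ha : a - c = a' := by omega
    dsimp only
    rw [hc, hρ, ha]
  · exact fun _ _ => rfl

/-- Removing horizontal and vertical strips are inverse to each other up to signs. -/
theorem sum_hDowns_vDowns {A : Type*} [CommRing A] (r : ℕ) (Y : YoungDiagram)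
    (c : YoungDiagram → A) :
    ∑ p ∈ Finset.HasAntidiagonal.antidiagonal r, (-1) ^ p.1 *
      ∑ κ ∈ hDowns p.2 Y, ∑ μ ∈ vDowns p.1 κ, c μ = if r = 0 then c Y else 0 := by
  split_ifs with hr
  · subst hr
    have h1 : hDowns 0 Y = {Y} := by
      ext ρ
      rw [mem_hDowns, Finset.mem_singleton]
      refine ⟨fun h => YoungDiagram.ext (Finset.eq_of_subset_of_card_le h.le h.2.ge), ?_⟩
      rintro rfl
      exact ⟨fun i => ⟨le_rfl, ρ.rowLen_anti i (i + 1) (Nat.le_succ i)⟩, rfl⟩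
    have h2 : vDowns 0 Y = {Y} := by
      ext ρ
      rw [mem_vDowns, isVStrip_iff, Finset.mem_singleton]
      refine ⟨fun h => YoungDiagram.ext (Finset.eq_of_subset_of_card_le
        (le_iff_rowLen.2 fun i => (h.1 i).1) h.2.ge), ?_⟩
      rintro rfl
      exact ⟨fun i => ⟨le_rfl, Nat.le_succ _⟩, rfl⟩
    simp [h1, h2]
  · simp only [Finset.mul_sum, Finset.sum_sigma']
    -- toggle the last box of `κ` in the last row in which `μ` and `Y` differ
    set row : YoungDiagram → ℕ := fun μ =>
      Nat.findGreatest (fun i => μ.rowLen i < Y.rowLen i) Y.card with hrowdef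
    set tog : YoungDiagram → YoungDiagram → YoungDiagram := fun κ μ =>
      ofRowFun (Function.update κ.rowLen (row μ)
        (2 * μ.rowLen (row μ) + 1 - κ.rowLen (row μ))) (κ.card + Y.card + 1) with htogdef
    have hrow : ∀ {κ μ : YoungDiagram} {p : ℕ × ℕ}, p.1 + p.2 = r → IsHStrip p.2 κ Y →
        IsVStrip p.1 μ κ → μ.rowLen (row μ) < Y.rowLen (row μ) ∧
          ∀ i, row μ < i → μ.rowLen i = Y.rowLen i := by
      intro κ μ p hp h1 h2
      rw [isVStrip_iff] at h2
      have hle : μ ≤ Y := le_iff_rowLen.2 fun i => (h2.1 i).1.trans (h1.1 i).1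
      have hgt : ∀ i, Y.card < i → ¬ μ.rowLen i < Y.rowLen i := fun i hi => by
        rw [rowLen_eq_zero hi.le]; omega
      have hex : ∃ i, μ.rowLen i < Y.rowLen i := by
        by_contra! hcon
        have := card_le_card (le_iff_rowLen.2 hcon)
        have := h1.2
        omega
      obtain ⟨i, hi⟩ := hex
      have hiY : i ≤ Y.card := by
        by_contra! hcon
        exact hgt i hcon hi
      refine ⟨Nat.findGreatest_spec (P := fun i => μ.rowLen i < Y.rowLen i) hiY hi,
        fun i hi => ?_⟩
      have := le_iff_rowLen.1 hle i
      by_contra hne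
      have hlt : μ.rowLen i < Y.rowLen i := by omega
      refine Nat.findGreatest_is_greatest hi ?_ hlt
      by_contra! hcon
      exact hgt i hcon hlt
    have htog : ∀ {κ μ : YoungDiagram} {p : ℕ × ℕ}, p.1 + p.2 = r → IsHStrip p.2 κ Y →
        IsVStrip p.1 μ κ → ∀ i, (tog κ μ).rowLen i = Function.update κ.rowLen (row μ)
        (2 * μ.rowLen (row μ) + 1 - κ.rowLen (row μ)) i := by
      intro κ μ p hp h1 h2 i
      obtain ⟨h3, h4⟩ := hrow hp h1 h2
      rw [isVStrip_iff] at h2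
      refine rowLen_ofRowFun (fun i => ?_) ?_ i
      · generalize row μ = k at h3 h4 ⊢
        have a1 := h1.1 i
        have a2 := h2.1 i
        have a3 := h1.1 (i + 1)
        have a4 := h2.1 (i + 1)
        have a5 := κ.rowLen_anti i (i + 1) (Nat.le_succ i)
        simp only [Function.update_apply]
        split_ifs with hi hi' hi'
        · omega
        · subst hi
          omega
        · subst hi'
          have := h4 (i + 1) (by omega)
          have := μ.rowLen_anti i (i + 1) (Nat.le_succ i)
          omega
        · exact a5
      · rw [Function.update_of_ne, rowLen_eq_zero (by omega)]
        intro h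
        have : row μ ≤ Y.card := Nat.findGreatest_le Y.card
        omega
    have hspec : ∀ {κ μ : YoungDiagram} {p : ℕ × ℕ}, p.1 + p.2 = r → IsHStrip p.2 κ Y →
        IsVStrip p.1 μ κ →
        ((tog κ μ).card = κ.card + 1 ∨ (tog κ μ).card + 1 = κ.card) ∧
        IsHStrip (Y.card - (tog κ μ).card) (tog κ μ) Y ∧
        IsVStrip ((tog κ μ).card - μ.card) μ (tog κ μ) ∧ tog (tog κ μ) μ = κ ∧
        (tog κ μ).card - μ.card + (Y.card - (tog κ μ).card) = r := by
      intro κ μ p hp h1 h2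
      obtain ⟨h3, h4⟩ := hrow hp h1 h2
      have h5 := htog hp h1 h2
      have h2' := isVStrip_iff.1 h2
      have b1 := h1.1 (row μ)
      have b2 := h2'.1 (row μ)
      have h5k : (tog κ μ).rowLen (row μ) = 2 * μ.rowLen (row μ) + 1 - κ.rowLen (row μ) := by
        rw [h5, Function.update_self]
      have h5n : ∀ i, i ≠ row μ → (tog κ μ).rowLen i = κ.rowLen i := fun i hi => by
        rw [h5, Function.update_of_ne hi]
      have hcard := card_add_rowLen h5n
      have c1 : ∀ i, (tog κ μ).rowLen i ≤ Y.rowLen i ∧ Y.rowLen (i + 1) ≤ (tog κ μ).rowLen i := by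
        intro i
        rcases eq_or_ne i (row μ) with rfl | hi
        · have := h4 (row μ + 1) (by omega)
          have := μ.rowLen_anti (row μ) (row μ + 1) (Nat.le_succ _)
          omega
        · rw [h5n i hi]
          exact h1.1 i
      have c2 : ∀ i, μ.rowLen i ≤ (tog κ μ).rowLen i ∧ (tog κ μ).rowLen i ≤ μ.rowLen i + 1 := by
        intro i
        rcases eq_or_ne i (row μ) with rfl | hi
        · omega
        · rw [h5n i hi]
          exact h2'.1 i
      have d1 := card_le_card (le_iff_rowLen.2 fun i => (c1 i).1)
      have d2 := card_le_card (le_iff_rowLen.2 fun i => (c2 i).1)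
      have e0 := h1.2
      have e1 := h2'.2
      have e2 : (tog κ μ).card - μ.card + (Y.card - (tog κ μ).card) = r := by omega
      have e3 : IsHStrip (Y.card - (tog κ μ).card) (tog κ μ) Y := ⟨c1, by omega⟩
      have e4 : IsVStrip ((tog κ μ).card - μ.card) μ (tog κ μ) := isVStrip_iff.2 ⟨c2, by omega⟩
      refine ⟨by omega, e3, e4, ?_, e2⟩
      refine rowLen_injective (funext fun i => ?_)
      rw [htog (p := (_, _)) e2 e3 e4]
      rcases eq_or_ne i (row μ) with rfl | hi
      · rw [Function.update_self, h5k]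
        omega
      · rw [Function.update_of_ne hi, h5n i hi]
    refine Finset.sum_involution (fun x _ => ⟨((tog x.2.1 x.2.2).card - x.2.2.card,
      Y.card - (tog x.2.1 x.2.2).card), ⟨tog x.2.1 x.2.2, x.2.2⟩⟩) ?_ ?_ ?_ ?_
    · rintro ⟨p, κ, μ⟩ hx
      simp only [Finset.mem_sigma, Finset.HasAntidiagonal.mem_antidiagonal, mem_hDowns,
        mem_vDowns] at hx
      obtain ⟨hp, h1, h2⟩ := hx
      have h3 := (hspec hp h1 h2).1
      have h4 := card_le_card (le_iff_rowLen.2 fun i => ((isVStrip_iff.1 (hspec hp h1 h2).2.2.1).1 i).1)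
      have h5 := (isVStrip_iff.1 h2).2
      dsimp only
      rcases h3 with h3 | h3
      · have : (tog κ μ).card - μ.card = p.1 + 1 := by omega
        rw [this]
        ring
      · have : p.1 = (tog κ μ).card - μ.card + 1 := by omega
        rw [this]
        ring
    · rintro ⟨p, κ, μ⟩ hx _ heq
      simp only [Finset.mem_sigma, Finset.HasAntidiagonal.mem_antidiagonal, mem_hDowns,
        mem_vDowns] at hx
      obtain ⟨hp, h1, h2⟩ := hx
      have h3 := (hspec hp h1 h2).1
      simp only [Sigma.mk.injEq, heq_eq_eq] at heq
      rw [heq.2.1] at h3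
      omega
    · rintro ⟨p, κ, μ⟩ hx
      simp only [Finset.mem_sigma, Finset.HasAntidiagonal.mem_antidiagonal, mem_hDowns,
        mem_vDowns] at hx ⊢
      obtain ⟨hp, h1, h2⟩ := hx
      obtain ⟨h3, h4, h5, h6, h7⟩ := hspec hp h1 h2
      exact ⟨h7, h4, h5⟩
    · rintro ⟨p, κ, μ⟩ hx
      simp only [Finset.mem_sigma, Finset.HasAntidiagonal.mem_antidiagonal, mem_hDowns,
        mem_vDowns] at hx
      obtain ⟨hp, h1, h2⟩ := hx
      obtain ⟨h3, h4, h5, h6, h7⟩ := hspec hp h1 h2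
      have h8 := (isVStrip_iff.1 h2).2
      have h9 := h1.2
      dsimp only
      rw [h6, show κ.card - μ.card = p.1 by omega, show Y.card - κ.card = p.2 by omega]

end YoungDiagram

/-! ### Schur functions and their branching rule -/

namespace YoungDiagram

theorem isHStrip_iff {a : ℕ} {ρ Y : YoungDiagram} : IsHStrip a ρ Y ↔
    (ρ ≤ Y ∧ ∀ i j, (i + 1, j) ∈ Y → (i, j) ∈ ρ) ∧ ρ.card + a = Y.card := by
  refine and_congr_left fun _ => ?_
  rw [forall_and, ← le_iff_rowLen]
  simp only [mem_iff_lt_rowLen]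
  exact and_congr_right fun _ => forall_congr' fun i => ⟨fun h j hj => hj.trans_le h,
    fun h => le_of_forall_lt h⟩

theorem hUps_zero (Y : YoungDiagram) : hUps 0 Y = {Y} := by
  ext ρ
  rw [mem_hUps, Finset.mem_singleton]
  refine ⟨fun h => (YoungDiagram.ext (Finset.eq_of_subset_of_card_le h.le h.2.ge)).symm, ?_⟩
  rintro rfl
  exact ⟨fun i => ⟨le_rfl, ρ.rowLen_anti _ _ (Nat.le_succ i)⟩, rfl⟩

end YoungDiagram

section SchurFunctions

open YoungDiagram

/-- The number of entries `k` in a semistandard Young tableau. -/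
def ssytWeight {Y : YoungDiagram} (T : SemistandardYoungTableau Y) (k : ℕ) : ℕ :=
  (Y.cells.filter fun p => T p.1 p.2 = k).card

/-- The semistandard Young tableaux of shape `Y` and weight `m`. -/
abbrev SSYTOf (Y : YoungDiagram) (m : ℕ →₀ ℕ) : Type :=
  {T : SemistandardYoungTableau Y // ∀ k, ssytWeight T k = m k}

theorem SSYTOf.entry_lt {Y : YoungDiagram} {m : ℕ →₀ ℕ} (T : SSYTOf Y m) {N : ℕ} (hm : SuppLT N m)
    {i j : ℕ} (h : (i, j) ∈ Y) : T.1 i j < N := by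
  by_contra! hcon
  have h1 := T.2 (T.1 i j)
  rw [hm _ hcon, ssytWeight, Finset.card_eq_zero, Finset.filter_eq_empty_iff] at h1
  exact h1 (x := (i, j)) h rfl

instance (Y : YoungDiagram) (m : ℕ →₀ ℕ) : Finite (SSYTOf Y m) := by
  obtain ⟨N, hN⟩ := exists_suppLT m
  refine Finite.of_injective (β := Y.cells → Fin N)
    (fun T p => ⟨T.1 p.1.1 p.1.2, T.entry_lt hN p.2⟩) fun T T' h => ?_
  refine Subtype.ext (SemistandardYoungTableau.ext fun i j => ?_)
  by_cases hij : (i, j) ∈ Y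
  · exact Fin.ext_iff.1 (congrFun h ⟨(i, j), hij⟩)
  · rw [T.1.zeros hij, T'.1.zeros hij]

theorem coeff_schur (Y : YoungDiagram) (m : ℕ →₀ ℕ) :
    MvPowerSeries.coeff m (schur Y) = (Nat.card (SSYTOf Y m) : ℤ[X]) := by
  have := Fintype.ofFinite (SSYTOf Y m)
  rw [schur, coeff_genFun]
  change ∑ᶠ T : SSYTOf Y m, (1 : ℤ[X]) = _
  rw [finsum_eq_sum_of_fintype, Nat.card_eq_fintype_card]
  simp

theorem nonempty_of_coeff_schur_ne_zero {Y : YoungDiagram} {m : ℕ →₀ ℕ}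
    (h : MvPowerSeries.coeff m (schur Y) ≠ 0) : Nonempty (SSYTOf Y m) := by
  by_contra hcon
  rw [not_nonempty_iff] at hcon
  rw [coeff_schur, Nat.card_of_isEmpty, Nat.cast_zero] at h
  exact h rfl

theorem coeff_schur_eq_zero {Y : YoungDiagram} {m : ℕ →₀ ℕ} (h : Y.card ≠ m.degree) :
    MvPowerSeries.coeff m (schur Y) = 0 := by
  by_contra hcon
  obtain ⟨T⟩ := nonempty_of_coeff_schur_ne_zero hcon
  refine h ?_
  rw [YoungDiagram.card, Finset.card_eq_sum_card_fiberwise (f := fun p => T.1 p.1 p.2)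
    (t := m.support)]
  · exact Finset.sum_congr rfl fun k _ => T.2 k
  · intro p hp
    rw [Finset.mem_coe, Finsupp.mem_support_iff, ← T.2, ssytWeight]
    exact Finset.card_ne_zero_of_mem (Finset.mem_filter.2 ⟨hp, rfl⟩)

/-- The extension of a tableau of shape `ρ` to `Y` by the entry `N`. -/
def SemistandardYoungTableau.extend {a : ℕ} {ρ Y : YoungDiagram} (h : IsHStrip a ρ Y)
    (T : SemistandardYoungTableau ρ) (N : ℕ) (hT : ∀ i j, (i, j) ∈ ρ → T i j < N) :
    SemistandardYoungTableau Y where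
  entry i j := if (i, j) ∈ ρ then T i j else if (i, j) ∈ Y then N else 0
  row_weak' {i j1 j2} hj hc := by
    have h1 := Y.up_left_mem le_rfl hj.le hc
    by_cases h2 : (i, j2) ∈ ρ
    · have h3 := ρ.up_left_mem le_rfl hj.le h2
      simp only [h2, h3, if_true]
      exact T.row_weak hj h2
    · simp only [h2, hc, h1, if_true, if_false]
      split_ifs with h3
      · exact (hT _ _ h3).le
      · exact le_rfl
  col_strict' {i1 i2 j} hi hc := by
    have h1 := (isHStrip_iff.1 h).1.2 (i2 - 1) j (by rwa [Nat.sub_add_cancel (by omega)])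
    have h3 := ρ.up_left_mem (by omega : i1 ≤ i2 - 1) le_rfl h1
    by_cases h2 : (i2, j) ∈ ρ
    · simp only [h2, h3, if_true]
      exact T.col_strict hi h2
    · simp only [h2, hc, h3, if_true, if_false]
      exact hT _ _ h3
  zeros' {i j} hij := by
    rw [if_neg fun hρ => hij ((isHStrip_iff.1 h).1.1 hρ), if_neg hij]

theorem SemistandardYoungTableau.extend_apply {a : ℕ} {ρ Y : YoungDiagram} (h : IsHStrip a ρ Y)
    (T : SemistandardYoungTableau ρ) (N : ℕ) (hT : ∀ i j, (i, j) ∈ ρ → T i j < N) (i j : ℕ) :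
    T.extend h N hT i j = if (i, j) ∈ ρ then T i j else if (i, j) ∈ Y then N else 0 := rfl

theorem SemistandardYoungTableau.extend_lt_iff {a : ℕ} {ρ Y : YoungDiagram} (h : IsHStrip a ρ Y)
    (T : SemistandardYoungTableau ρ) (N : ℕ) (hT : ∀ i j, (i, j) ∈ ρ → T i j < N) {i j : ℕ}
    (hij : (i, j) ∈ Y) : T.extend h N hT i j < N ↔ (i, j) ∈ ρ := by
  rw [extend_apply, if_pos hij]
  split_ifs with hρ
  · simp [hρ, hT i j hρ]
  · simp [hρ]

theorem ssytWeight_extend {a : ℕ} {ρ Y : YoungDiagram} (h : IsHStrip a ρ Y) {N : ℕ}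
    {m : ℕ →₀ ℕ} (hm : SuppLT N m) (T : SSYTOf ρ m) (k : ℕ) :
    ssytWeight (T.1.extend h N fun _ _ => T.entry_lt hm) k = (m + Finsupp.single N a) k := by
  have hlt := fun i j (hij : (i, j) ∈ Y) =>
    T.1.extend_lt_iff h N (fun _ _ => T.entry_lt hm) (i := i) (j := j) hij
  have happ := T.1.extend_apply h N (fun _ _ => T.entry_lt hm)
  generalize T.1.extend h N (fun _ _ => T.entry_lt hm) = T' at hlt happ
  rw [Finsupp.add_apply]
  rcases lt_trichotomy k N with hk | rfl | hk
  · rw [Finsupp.single_eq_of_ne (by omega), add_zero, ← T.2, ssytWeight, ssytWeight]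
    congr 1
    ext ⟨i, j⟩
    simp only [Finset.mem_filter, mem_cells]
    constructor
    · rintro ⟨h1, h2⟩
      have hρ := (hlt i j h1).1 (by omega)
      rw [happ, if_pos hρ] at h2
      exact ⟨hρ, h2⟩
    · rintro ⟨h1, h2⟩
      exact ⟨h.le h1, by rw [happ, if_pos h1, h2]⟩
  · rw [Finsupp.single_eq_same, hm k le_rfl, zero_add, ssytWeight]
    have h1 : (Y.cells.filter fun p => T' p.1 p.2 = k) = Y.cells \ ρ.cells := by
      ext ⟨i, j⟩
      simp only [Finset.mem_filter, mem_cells, Finset.mem_sdiff]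
      refine and_congr_right fun hY => ?_
      rw [← hlt i j hY, happ, if_pos hY]
      split_ifs with hρ
      · have := T.entry_lt hm hρ
        omega
      · simp
    rw [h1, Finset.card_sdiff_of_subset h.le]
    have := h.2
    simp only [YoungDiagram.card] at this
    omega
  · rw [Finsupp.single_eq_of_ne (by omega), hm k hk.le, add_zero, ssytWeight, Finset.card_eq_zero,
      Finset.filter_eq_empty_iff]
    rintro ⟨i, j⟩ hij
    dsimp only
    rw [happ]
    split_ifs with hρ
    · have := T.entry_lt hm hρ
      omega
    · omega
    · exact absurd hij ‹_›

/-- The branching rule: removing the boxes filled by the largest letter. -/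
theorem coeff_add_single_schur (Y : YoungDiagram) {N : ℕ} {m : ℕ →₀ ℕ} (hm : SuppLT N m) (a : ℕ) :
    MvPowerSeries.coeff (m + Finsupp.single N a) (schur Y) =
      ∑ ρ ∈ hDowns a Y, MvPowerSeries.coeff m (schur ρ) := by
  have hbij : Function.Bijective (fun x : Σ ρ : hDowns a Y, SSYTOf ρ.1 m =>
      (⟨x.2.1.extend (mem_hDowns.1 x.1.2) N fun _ _ => x.2.entry_lt hm,
        ssytWeight_extend _ hm x.2⟩ : SSYTOf Y (m + Finsupp.single N a))) := by
    constructor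
    · rintro ⟨⟨ρ, hρ⟩, T⟩ ⟨⟨ρ', hρ'⟩, T'⟩ h
      have h' : T.1.extend (mem_hDowns.1 hρ) N (fun _ _ => T.entry_lt hm) =
        T'.1.extend (mem_hDowns.1 hρ') N fun _ _ => T'.entry_lt hm := Subtype.ext_iff.1 h
      have hle : ρ = ρ' := by
        ext ⟨i, j⟩
        simp only [mem_cells]
        by_cases hij : (i, j) ∈ Y
        · rw [← T.1.extend_lt_iff (mem_hDowns.1 hρ) N (fun _ _ => T.entry_lt hm) hij, h',
            T'.1.extend_lt_iff _ N _ hij]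
        · exact ⟨fun h1 => absurd ((mem_hDowns.1 hρ).le h1) hij,
            fun h1 => absurd ((mem_hDowns.1 hρ').le h1) hij⟩
      subst hle
      congr 1
      refine Subtype.ext (SemistandardYoungTableau.ext fun i j => ?_)
      by_cases hij : (i, j) ∈ ρ
      · have h2 := congrArg (fun T : SemistandardYoungTableau Y => T i j) h'
        simpa only [SemistandardYoungTableau.extend_apply, if_pos hij] using h2
      · rw [T.1.zeros hij, T'.1.zeros hij]
    · intro T
      have hT1 : ∀ {i j}, (i, j) ∈ Y → T.1 i j ≤ N := fun {i j} hij => by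
        have := SSYTOf.entry_lt T (N := N + 1) (fun k hk => by
          rw [Finsupp.add_apply, hm k (by omega), Finsupp.single_eq_of_ne (by omega), add_zero]) hij
        omega
      let ρ : YoungDiagram := ⟨Y.cells.filter fun p => T.1 p.1 p.2 < N, by
        rintro ⟨i, j⟩ ⟨i', j'⟩ ⟨hi, hj⟩ h
        simp only [Finset.coe_filter, Set.mem_ofPred_eq, mem_cells] at *
        have h1 := Y.up_left_mem hi le_rfl h.1
        refine ⟨Y.up_left_mem hi hj h.1, ?_⟩
        exact ((T.1.row_weak_of_le hj h1).trans (T.1.col_weak hi h.1)).trans_lt h.2⟩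
      have hρ : ∀ {i j}, (i, j) ∈ ρ ↔ (i, j) ∈ Y ∧ T.1 i j < N := by
        intro i j
        rw [← mem_cells]
        simp [ρ]
      have hcount : (Y.cells.filter fun p => T.1 p.1 p.2 = N).card = a := by
        have := T.2 N
        rwa [Finsupp.add_apply, hm N le_rfl, Finsupp.single_eq_same, zero_add] at this
      have hstrip : IsHStrip a ρ Y := by
        rw [isHStrip_iff]
        refine ⟨⟨fun p hp => (hρ.1 hp).1, fun i j hij => ?_⟩, ?_⟩
        · exact hρ.2 ⟨Y.up_left_mem (Nat.le_succ i) le_rfl hij,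
            (T.1.col_strict (Nat.lt_succ_self i) hij).trans_le (hT1 hij)⟩
        · rw [← hcount, YoungDiagram.card, YoungDiagram.card,
            ← Finset.card_filter_add_card_filter_not (s := Y.cells) fun p => T.1 p.1 p.2 < N]
          congr 2
          ext ⟨i, j⟩
          simp only [Finset.mem_filter, mem_cells]
          refine and_congr_right fun hij => ?_
          have := hT1 hij
          omega
      let T' : SemistandardYoungTableau ρ :=
        { entry := fun i j => if (i, j) ∈ ρ then T.1 i j else 0
          row_weak' := fun {i j1 j2} hj hc => by
            rw [if_pos hc, if_pos (ρ.up_left_mem le_rfl hj.le hc)]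
            exact T.1.row_weak hj (hρ.1 hc).1
          col_strict' := fun {i1 i2 j} hi hc => by
            rw [if_pos hc, if_pos (ρ.up_left_mem hi.le le_rfl hc)]
            exact T.1.col_strict hi (hρ.1 hc).1
          zeros' := fun hij => if_neg hij }
      have hT' : ∀ i j, T' i j = if (i, j) ∈ ρ then T.1 i j else 0 := fun _ _ => rfl
      have hw : ∀ k, ssytWeight T' k = m k := by
        intro k
        by_cases hk : k < N
        · have h1 := T.2 k
          rw [Finsupp.add_apply, Finsupp.single_eq_of_ne (by omega), add_zero] at h1
          rw [← h1, ssytWeight, ssytWeight]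
          congr 1
          ext ⟨i, j⟩
          simp only [Finset.mem_filter, mem_cells, hT', hρ]
          constructor
          · rintro ⟨h2, h3⟩
            rw [if_pos h2] at h3
            exact ⟨h2.1, h3⟩
          · rintro ⟨h2, h3⟩
            have h4 : (i, j) ∈ Y ∧ T.1 i j < N := ⟨h2, by omega⟩
            rw [if_pos h4]
            exact ⟨h4, h3⟩
        · rw [hm k (by omega), ssytWeight, Finset.card_eq_zero, Finset.filter_eq_empty_iff]
          rintro ⟨i, j⟩ hij
          have hij' : (i, j) ∈ ρ := hij
          rw [hT', if_pos hij']
          have := (hρ.1 hij').2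
          dsimp only
          omega
      refine ⟨⟨⟨ρ, mem_hDowns.2 hstrip⟩, ⟨T', hw⟩⟩, ?_⟩
      refine Subtype.ext (SemistandardYoungTableau.ext fun i j => ?_)
      dsimp only
      rw [SemistandardYoungTableau.extend_apply, hT']
      by_cases hY : (i, j) ∈ Y
      · by_cases hij : (i, j) ∈ ρ
        · rw [if_pos hij, if_pos hij]
        · rw [if_neg hij, if_pos hY]
          have h1 := hT1 hY
          rw [hρ] at hij
          have : ¬ T.1 i j < N := fun h2 => hij ⟨hY, h2⟩
          omega
      · rw [if_neg fun hij => hY (hρ.1 hij).1, if_neg hY, T.1.zeros hY]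
  rw [coeff_schur, ← Nat.card_congr (Equiv.ofBijective _ hbij), Nat.card_sigma, Nat.cast_sum,
    ← Finset.sum_coe_sort (hDowns a Y) fun ρ => MvPowerSeries.coeff m (schur ρ)]
  exact Finset.sum_congr rfl fun ρ _ => (coeff_schur ρ.1 m).symm

end SchurFunctions

/-! ### Expansions into Schur functions and the Pieri rules -/

theorem sum_antidiagonal_add_single {M : Type*} [AddCommMonoid M] {N : ℕ} {m : ℕ →₀ ℕ}
    (hm : SuppLT N m) (a : ℕ) (F : (ℕ →₀ ℕ) → (ℕ →₀ ℕ) → M) :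
    ∑ p ∈ Finset.HasAntidiagonal.antidiagonal (m + Finsupp.single N a), F p.1 p.2 =
      ∑ q ∈ Finset.HasAntidiagonal.antidiagonal a,
        ∑ p ∈ Finset.HasAntidiagonal.antidiagonal m,
          F (p.1 + Finsupp.single N q.1) (p.2 + Finsupp.single N q.2) := by
  have hN : ∀ p : (ℕ →₀ ℕ) × (ℕ →₀ ℕ), p.1 + p.2 = m → p.1 N = 0 ∧ p.2 N = 0 := by
    intro p hp
    have h1 := hm N le_rfl
    rw [← hp, Finsupp.add_apply] at h1
    omega
  rw [← Finset.sum_product']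
  refine Finset.sum_bij' (fun p _ => ((p.1 N, p.2 N), (p.1.erase N, p.2.erase N)))
    (fun x _ => (x.2.1 + Finsupp.single N x.1.1, x.2.2 + Finsupp.single N x.1.2)) ?_ ?_ ?_ ?_ ?_
  · intro p hp
    rw [Finset.HasAntidiagonal.mem_antidiagonal] at hp
    simp only [Finset.mem_product, Finset.HasAntidiagonal.mem_antidiagonal]
    constructor
    · rw [← Finsupp.add_apply, hp, Finsupp.add_apply, hm N le_rfl, Finsupp.single_eq_same, zero_add]
    · ext k
      rcases eq_or_ne k N with rfl | hk
      · simp [hm k le_rfl]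
      · have h1 := DFunLike.congr_fun hp k
        rw [Finsupp.add_apply, Finsupp.add_apply, Finsupp.single_eq_of_ne hk, add_zero] at h1
        rw [Finsupp.add_apply, Finsupp.erase_ne hk, Finsupp.erase_ne hk, h1]
  · intro x hx
    simp only [Finset.mem_product, Finset.HasAntidiagonal.mem_antidiagonal] at hx ⊢
    rw [← hx.1, ← hx.2, Finsupp.single_add]
    abel
  · intro p _
    exact Prod.ext (Finsupp.erase_add_single N p.1) (Finsupp.erase_add_single N p.2)
  · intro x hx
    simp only [Finset.mem_product, Finset.HasAntidiagonal.mem_antidiagonal] at hx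
    obtain ⟨h1, h2⟩ := hN x.2 hx.2
    have h3 : ∀ (n : ℕ →₀ ℕ) (b : ℕ), n N = 0 → (n + Finsupp.single N b).erase N = n := by
      intro n b hn
      ext k
      rcases eq_or_ne k N with rfl | hk
      · simp [hn]
      · simp [hk]
    simp only [h3 _ _ h1, h3 _ _ h2, Finsupp.add_apply, h1, h2, Finsupp.single_eq_same, zero_add]
  · intro p _
    rw [Finsupp.erase_add_single, Finsupp.erase_add_single]

section Pieri

open YoungDiagram

/-- The Pieri rule for multiplication by a complete homogeneous symmetric function, as an identity
between numbers of tableaux: induction on the number of variables turns it into a commutation rule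
between adding and removing horizontal strips. -/
theorem sum_antidiagonal_coeff_schur {N : ℕ} {m : ℕ →₀ ℕ} (hm : SuppLT N m) (r : ℕ)
    (Y : YoungDiagram) :
    (∑ p ∈ Finset.HasAntidiagonal.antidiagonal m,
      if p.1.degree = r then MvPowerSeries.coeff p.2 (schur Y) else 0) =
      ∑ κ ∈ hUps r Y, MvPowerSeries.coeff m (schur κ) := by
  induction N generalizing m r Y with
  | zero =>
    have h0 : m = 0 := Finsupp.ext fun k => hm k (Nat.zero_le k)
    subst h0
    rw [Finset.HasAntidiagonal.antidiagonal_zero, Finset.sum_singleton]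
    rcases eq_or_ne r 0 with rfl | hr
    · rw [hUps_zero, Finset.sum_singleton]
      simp
    · rw [if_neg (by simpa using hr.symm)]
      refine (Finset.sum_eq_zero fun κ hκ => coeff_schur_eq_zero ?_).symm
      have := (mem_hUps.1 hκ).2
      rw [map_zero]
      omega
  | succ N ih =>
    obtain ⟨m, a, hm', rfl⟩ : ∃ m' a, SuppLT N m' ∧ m = m' + Finsupp.single N a := by
      refine ⟨m.erase N, m N, fun k hk => ?_, (Finsupp.erase_add_single N m).symm⟩
      rcases eq_or_ne k N with rfl | hne
      · exact Finsupp.erase_same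
      · rw [Finsupp.erase_ne hne, hm k (by omega)]
    rw [Finset.sum_congr rfl fun κ _ => coeff_add_single_schur κ hm' a, sum_hUps_hDowns,
      sum_antidiagonal_add_single hm' a fun p p' =>
        if p.degree = r then MvPowerSeries.coeff p' (schur Y) else 0, Finset.sum_filter]
    refine Finset.sum_congr rfl fun q _ => ?_
    split_ifs with hq
    · simp only [← ih hm']
      rw [Finset.sum_comm]
      refine Finset.sum_congr rfl fun p hp => ?_
      rw [Finset.HasAntidiagonal.mem_antidiagonal] at hp
      have hp2 : SuppLT N p.2 := fun k hk => by
        have := hm' k hk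
        rw [← hp, Finsupp.add_apply] at this
        omega
      rw [coeff_add_single_schur Y hp2, map_add, Finsupp.degree_single]
      by_cases h : p.1.degree = r - q.1
      · rw [if_pos (by omega)]
        simp only [h, if_true]
      · rw [if_neg (by omega)]
        simp only [h, if_false, Finset.sum_const_zero]
    · refine Finset.sum_eq_zero fun p _ => if_neg ?_
      rw [map_add, Finsupp.degree_single]
      omega

/-- The series with the expansion `∑ c Y * s_Y` into Schur functions. -/
noncomputable def schurSum (c : YoungDiagram → ℤ[X]) : Series :=
  fun m => ∑ Y ∈ sizeLE m.degree, c Y * MvPowerSeries.coeff m (schur Y)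

theorem coeff_schurSum (c : YoungDiagram → ℤ[X]) (m : ℕ →₀ ℕ) :
    MvPowerSeries.coeff m (schurSum c) =
      ∑ Y ∈ sizeLE m.degree, c Y * MvPowerSeries.coeff m (schur Y) := rfl

theorem coeff_schurSum_of_subset (c : YoungDiagram → ℤ[X]) {m : ℕ →₀ ℕ} {s : Finset YoungDiagram}
    (hs : sizeLE m.degree ⊆ s) : MvPowerSeries.coeff m (schurSum c) =
      ∑ Y ∈ s, c Y * MvPowerSeries.coeff m (schur Y) := by
  rw [coeff_schurSum]
  refine Finset.sum_subset hs fun Y _ hY => ?_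
  rw [mem_sizeLE] at hY
  rw [coeff_schur_eq_zero (by omega), mul_zero]

theorem schurSum_add (c c' : YoungDiagram → ℤ[X]) :
    schurSum (c + c') = schurSum c + schurSum c' := by
  ext m : 1
  simp only [map_add, coeff_schurSum, Pi.add_apply, add_mul, Finset.sum_add_distrib]

theorem schurSum_smul (a : ℤ[X]) (c : YoungDiagram → ℤ[X]) :
    schurSum (a • c) = a • schurSum c := by
  ext m : 1
  rw [MvPowerSeries.coeff_smul]
  simp only [coeff_schurSum, Pi.smul_apply, smul_eq_mul, mul_assoc, Finset.mul_sum]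

theorem schurSum_empty : schurSum (fun Y => if Y.card = 0 then 1 else 0) = 1 := by
  classical
  ext m : 1
  rw [coeff_schurSum, Finset.sum_eq_single ⊥]
  · rw [if_pos (by rfl), one_mul, MvPowerSeries.coeff_one]
    split_ifs with h
    · subst h
      have : Unique (SSYTOf ⊥ 0) := ⟨⟨⟨SemistandardYoungTableau.highestWeight ⊥, fun k => rfl⟩⟩,
        fun T => Subtype.ext (SemistandardYoungTableau.ext fun i j => by
          rw [T.1.zeros (notMem_bot _), SemistandardYoungTableau.zeros _ (notMem_bot _)])⟩
      rw [coeff_schur, Nat.card_unique, Nat.cast_one]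
    · refine coeff_schur_eq_zero fun h' => h ?_
      rw [← Finsupp.degree_eq_zero_iff, ← h']
      rfl
  · intro Y _ hY
    rw [if_neg fun h => hY (YoungDiagram.ext (Finset.card_eq_zero.1 h)), zero_mul]
  · intro h
    exact absurd (mem_sizeLE.2 (Nat.zero_le _)) h

theorem hasFormalSum_schur_iff (c : YoungDiagram → ℤ[X]) (f : Series) :
    HasFormalSum (fun Y => c Y • schur Y) f ↔ f = schurSum c := by
  rw [hasFormalSum_iff (fun m => sizeLE m.degree), MvPowerSeries.ext_iff]
  · exact Iff.rfl
  · intro m Y hY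
    rw [mem_sizeLE] at hY
    rw [MvPowerSeries.coeff_smul, coeff_schur_eq_zero (by omega), mul_zero]

/-- The exponent formed by the row lengths. -/
noncomputable def YoungDiagram.rowExp (Y : YoungDiagram) : ℕ →₀ ℕ :=
  Finsupp.ofSupportFinite Y.rowLen ((Set.finite_lt_nat Y.card).subset fun i hi => by
    by_contra hcon
    exact hi (rowLen_eq_zero (not_lt.1 hcon)))

theorem YoungDiagram.rowExp_apply (Y : YoungDiagram) (i : ℕ) : Y.rowExp i = Y.rowLen i := rfl

theorem coeff_rowExp_schur_ne_zero (Y : YoungDiagram) :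
    MvPowerSeries.coeff Y.rowExp (schur Y) ≠ 0 := by
  have : Nonempty (SSYTOf Y Y.rowExp) := by
    refine ⟨⟨SemistandardYoungTableau.highestWeight Y, fun k => ?_⟩⟩
    rw [rowExp_apply, rowLen_eq_card, ssytWeight]
    congr 1
    ext p
    simp only [Finset.mem_filter, mem_row_iff, mem_cells]
    refine and_congr_right fun hp => ?_
    rw [SemistandardYoungTableau.highestWeight_apply, if_pos hp]
  rw [coeff_schur]
  exact_mod_cast Nat.card_pos.ne'

theorem SemistandardYoungTableau.le_apply {Y : YoungDiagram} (T : SemistandardYoungTableau Y)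
    {i j : ℕ} (h : (i, j) ∈ Y) : i ≤ T i j := by
  induction i with
  | zero => exact Nat.zero_le _
  | succ i ih =>
    exact (ih (Y.up_left_mem (Nat.le_succ i) le_rfl h)).trans_lt
      (T.col_strict (Nat.lt_succ_self i) h)

/-- The entries of a tableau are at least their row indices. -/
theorem partialSums_le_rowExp {Y : YoungDiagram} {m : ℕ →₀ ℕ}
    (h : MvPowerSeries.coeff m (schur Y) ≠ 0) : partialSums m ≤ partialSums Y.rowExp := by
  obtain ⟨T⟩ := nonempty_of_coeff_schur_ne_zero h
  intro K
  have h1 : partialSums m K = (Y.cells.filter fun p => T.1 p.1 p.2 < K).card := by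
    rw [partialSums, Finset.card_eq_sum_card_fiberwise (f := fun p => T.1 p.1 p.2)
      (t := Finset.range K)]
    · refine Finset.sum_congr rfl fun k hk => ?_
      rw [← T.2, ssytWeight, Finset.filter_filter]
      congr 1
      ext p
      simp only [Finset.mem_filter, Finset.mem_range] at hk ⊢
      refine and_congr_right fun _ => ⟨fun h => ⟨by omega, h⟩, fun h => h.2⟩
    · intro p hp
      simp only [Finset.coe_filter, Set.mem_ofPred_eq] at hp
      simpa using hp.2
  have h2 : partialSums Y.rowExp K = (Y.cells.filter fun p => p.1 < K).card := by
    rw [partialSums, Finset.card_eq_sum_card_fiberwise (f := Prod.fst) (t := Finset.range K)]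
    · refine Finset.sum_congr rfl fun k hk => ?_
      rw [rowExp_apply, rowLen_eq_card, Finset.filter_filter]
      congr 1
      ext p
      simp only [Finset.mem_filter, Finset.mem_range, mem_row_iff, mem_cells] at hk ⊢
      refine and_congr_right fun _ => ⟨fun h => ⟨by omega, h⟩, fun h => h.2⟩
    · intro p hp
      simp only [Finset.coe_filter, Set.mem_ofPred_eq] at hp
      simpa using hp.2
  rw [h1, h2]
  refine Finset.card_le_card fun p hp => ?_
  simp only [Finset.mem_filter, mem_cells] at hp ⊢
  exact ⟨hp.1, (T.1.le_apply hp.1).trans_lt hp.2⟩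

theorem schurSum_injective : Function.Injective schurSum := by
  intro c c' h
  have hdiag := coeff_rowExp_schur_ne_zero
  have htri := fun (i j : YoungDiagram) => partialSums_le_rowExp (Y := j) (m := i.rowExp)
  have hrel : ∀ (d : ℕ) (i : YoungDiagram), i.card ≤ d →
      ∑ j ∈ sizeLE d, (c j - c' j) * MvPowerSeries.coeff i.rowExp (schur j) = 0 := by
    intro d i hi
    have hdeg : i.rowExp.degree = i.card := by
      by_contra hne
      exact hdiag i (coeff_schur_eq_zero (Ne.symm hne))
    have hs : sizeLE i.rowExp.degree ⊆ sizeLE d := fun Y hY => by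
      rw [mem_sizeLE] at hY ⊢
      omega
    simp only [sub_mul, Finset.sum_sub_distrib]
    rw [← coeff_schurSum_of_subset c hs, ← coeff_schurSum_of_subset c' hs, h, sub_self]
  have hA : ∀ (d : ℕ) (i j : YoungDiagram), i.card ≤ d → ¬ j.card ≤ d →
      MvPowerSeries.coeff i.rowExp (schur j) = 0 := by
    intro d i j hi hj
    have hdeg : i.rowExp.degree = i.card := by
      by_contra hne
      exact hdiag i (coeff_schur_eq_zero (Ne.symm hne))
    exact coeff_schur_eq_zero (by omega)
  -- The coefficients are made opaque to keep unification from unfolding them.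
  obtain ⟨F, hF⟩ : ∃ F : YoungDiagram → (ℕ →₀ ℕ) → ℤ[X],
      ∀ Y n, MvPowerSeries.coeff n (schur Y) = F Y n := ⟨_, fun _ _ => rfl⟩
  simp only [hF] at htri hdiag hrel hA
  funext Y
  have he : Function.Injective rowExp := fun Y Z hYZ =>
    rowLen_injective (funext fun i => DFunLike.congr_fun hYZ i)
  have := eq_zero_of_triangular he hdiag htri (sizeLE Y.card) (fun j => c j - c' j)
    (fun i => i.card ≤ Y.card) (hA _) (hrel _) Y (mem_sizeLE.2 le_rfl) le_rfl
  exact sub_eq_zero.1 this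

theorem omega_schurSum (c : YoungDiagram → ℤ[X]) :
    omega (schurSum c) = schurSum fun Y => c Y.transpose := by
  have h1 : schurCoeff (schurSum c) = c := by
    refine theUnique_eq ((hasFormalSum_schur_iff c _).2 rfl) fun c' hc' => ?_
    exact schurSum_injective ((hasFormalSum_schur_iff c' _).1 hc').symm
  rw [omega, h1]
  refine HasFormalSum.formalSum_eq ?_
  rw [hasFormalSum_iff (fun m => sizeLE m.degree)]
  · intro m
    rw [coeff_schurSum]
    refine Finset.sum_bij' (fun Y _ => Y.transpose) (fun Y _ => Y.transpose) ?_ ?_ ?_ ?_ ?_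
    · intro Y hY
      rwa [mem_sizeLE, card_transpose, ← mem_sizeLE]
    · intro Y hY
      rwa [mem_sizeLE, card_transpose, ← mem_sizeLE]
    · exact fun Y _ => transpose_transpose Y
    · exact fun Y _ => transpose_transpose Y
    · intro Y _
      rw [transpose_transpose, MvPowerSeries.coeff_smul]
  · intro m Y hY
    rw [mem_sizeLE] at hY
    rw [MvPowerSeries.coeff_smul, coeff_schur_eq_zero (by rw [card_transpose]; omega), mul_zero]

/-- The complete homogeneous symmetric function of degree `r`. -/
noncomputable def completeSeries (r : ℕ) : Series := fun m => if m.degree = r then 1 else 0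

theorem coeff_completeSeries (r : ℕ) (m : ℕ →₀ ℕ) :
    MvPowerSeries.coeff m (completeSeries r) = if m.degree = r then 1 else 0 := rfl

open Classical in
/-- The elementary symmetric function of degree `r`. -/
noncomputable def elementarySeries (r : ℕ) : Series :=
  fun m => if m.degree = r ∧ ∀ k, m k ≤ 1 then 1 else 0

open Classical in
theorem coeff_elementarySeries (r : ℕ) (m : ℕ →₀ ℕ) :
    MvPowerSeries.coeff m (elementarySeries r) =
      if m.degree = r ∧ ∀ k, m k ≤ 1 then 1 else 0 := rfl

theorem completeSeries_mul_schurSum (r : ℕ) (c : YoungDiagram → ℤ[X]) :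
    completeSeries r * schurSum c = schurSum fun κ => ∑ Y ∈ hDowns r κ, c Y := by
  classical
  ext m : 1
  obtain ⟨N, hN⟩ := exists_suppLT m
  have h1 : ∀ p ∈ Finset.HasAntidiagonal.antidiagonal m,
      MvPowerSeries.coeff p.1 (completeSeries r) * MvPowerSeries.coeff p.2 (schurSum c) =
      ∑ Y ∈ sizeLE m.degree,
        c Y * if p.1.degree = r then MvPowerSeries.coeff p.2 (schur Y) else 0 := by
    intro p hp
    rw [Finset.HasAntidiagonal.mem_antidiagonal] at hp
    rw [coeff_schurSum_of_subset c (s := sizeLE m.degree), coeff_completeSeries]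
    · split_ifs <;> simp
    · intro Y hY
      rw [mem_sizeLE] at hY ⊢
      rw [← hp, map_add]
      omega
  rw [MvPowerSeries.coeff_mul, Finset.sum_congr rfl h1, Finset.sum_comm, coeff_schurSum]
  simp only [← Finset.mul_sum, sum_antidiagonal_coeff_schur hN]
  simp only [Finset.mul_sum, Finset.sum_mul]
  have hK : ∀ κ : YoungDiagram, ¬ κ.card ≤ m.degree → MvPowerSeries.coeff m (schur κ) = 0 :=
    fun κ hκ => coeff_schur_eq_zero (by omega)
  have h2 : ∀ Y, ∑ κ ∈ hUps r Y, c Y * MvPowerSeries.coeff m (schur κ) =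
      ∑ κ ∈ sizeLE m.degree, if IsHStrip r Y κ then c Y * MvPowerSeries.coeff m (schur κ) else 0 := by
    intro Y
    rw [← Finset.sum_filter]
    refine (Finset.sum_subset (fun κ hκ => ?_) fun κ hκ hκ' => ?_).symm
    · rw [Finset.mem_filter] at hκ
      exact mem_hUps.2 hκ.2
    · rw [Finset.mem_filter, mem_sizeLE] at hκ'
      rw [hK κ fun h => hκ' ⟨h, mem_hUps.1 hκ⟩, mul_zero]
  rw [Finset.sum_congr rfl fun Y _ => h2 Y, Finset.sum_comm]
  refine Finset.sum_congr rfl fun κ hκ => ?_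
  rw [← Finset.sum_filter]
  refine Finset.sum_congr ?_ fun _ _ => rfl
  ext Y
  rw [Finset.mem_filter, mem_hDowns, mem_sizeLE, and_iff_right_iff_imp]
  intro h
  have := h.2
  rw [mem_sizeLE] at hκ
  omega

theorem sum_prod_antidiagonal_degree {M : Type*} [AddCommMonoid M] (m : ℕ →₀ ℕ)
    (s : Finset (ℕ × ℕ)) (F : ℕ → ℕ → (ℕ →₀ ℕ) → (ℕ →₀ ℕ) → M) :
    (∑ x ∈ s, ∑ p ∈ Finset.HasAntidiagonal.antidiagonal m,
      if p.1.degree = x.1 ∧ p.2.degree = x.2 then F x.1 x.2 p.1 p.2 else 0) =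
      ∑ p ∈ Finset.HasAntidiagonal.antidiagonal m,
        if (p.1.degree, p.2.degree) ∈ s then F p.1.degree p.2.degree p.1 p.2 else 0 := by
  rw [Finset.sum_comm]
  refine Finset.sum_congr rfl fun p _ => ?_
  have : ∀ x : ℕ × ℕ, (if p.1.degree = x.1 ∧ p.2.degree = x.2 then F x.1 x.2 p.1 p.2 else 0) =
      if (p.1.degree, p.2.degree) = x then F x.1 x.2 p.1 p.2 else 0 := fun x =>
    if_congr (by rw [Prod.ext_iff]) rfl rfl
  simp only [this]
  rw [Finset.sum_ite_eq]

end Pieri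

theorem coeff_infProd_geomSeries {A : Type*} [CommRing A] (b : A) (m : ℕ →₀ ℕ) :
    MvPowerSeries.coeff m (infProd (geomSeries b)) = b ^ m.degree := by
  rw [coeff_infProd, Finsupp.prod, Finsupp.degree_apply, ← Finset.prod_pow_eq_pow_sum]
  simp [geomSeries]

open Classical in
theorem coeff_infProd_one_add {A : Type*} [CommRing A] (a : A) (m : ℕ →₀ ℕ) :
    MvPowerSeries.coeff m (infProd (1 + PowerSeries.C a * PowerSeries.X)) =
      if ∀ k, m k ≤ 1 then a ^ m.degree else 0 := by
  have h : ∀ b, PowerSeries.coeff b (1 + PowerSeries.C a * PowerSeries.X) =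
      if b ≤ 1 then a ^ b else 0 := by
    rintro (_ | _ | b)
    · simp
    · simp [PowerSeries.coeff_one]
    · simp [PowerSeries.coeff_one]
  rw [coeff_infProd, Finsupp.prod]
  simp only [h]
  split_ifs with hm
  · rw [Finsupp.degree_apply, ← Finset.prod_pow_eq_pow_sum]
    exact Finset.prod_congr rfl fun k _ => if_pos (hm k)
  · rw [not_forall] at hm
    obtain ⟨k, hk⟩ := hm
    refine Finset.prod_eq_zero (i := k) (Finsupp.mem_support_iff.2 (by omega)) (if_neg hk)

open Classical in
theorem coeff_elementarySeries_mul_completeSeries (i j : ℕ) (m : ℕ →₀ ℕ) :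
    MvPowerSeries.coeff m (elementarySeries i * completeSeries j) =
      ∑ p ∈ Finset.HasAntidiagonal.antidiagonal m,
        if p.1.degree = i ∧ p.2.degree = j then if ∀ k, p.1 k ≤ 1 then 1 else 0 else 0 := by
  rw [MvPowerSeries.coeff_mul]
  refine Finset.sum_congr rfl fun p _ => ?_
  rw [coeff_elementarySeries, coeff_completeSeries]
  by_cases h1 : p.1.degree = i <;> by_cases h2 : p.2.degree = j <;> simp [h1, h2]

/-- The relation between elementary and complete symmetric functions expressed by
`∏ (1 - y_j) * ∏ (1 - y_j)⁻¹ = 1`. -/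
theorem sum_elementarySeries_mul_completeSeries (r : ℕ) :
    ∑ x ∈ Finset.HasAntidiagonal.antidiagonal r,
      (-1 : ℤ[X]) ^ x.1 • (elementarySeries x.1 * completeSeries x.2) = if r = 0 then 1 else 0 := by
  classical
  have hone : infProd (1 + PowerSeries.C (-1 : ℤ[X]) * PowerSeries.X) * infProd (geomSeries 1) = 1 := by
    rw [← infProd_mul (by simp) (constantCoeff_geomSeries _), ← infProd_one]
    rw [map_neg, neg_mul, ← sub_eq_add_neg, one_sub_mul_geomSeries]
  ext m : 1
  have h1 := congrArg (MvPowerSeries.coeff m) hone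
  rw [MvPowerSeries.coeff_mul] at h1
  simp only [coeff_infProd_geomSeries, coeff_infProd_one_add, one_pow, mul_one] at h1
  rw [map_sum]
  simp only [MvPowerSeries.coeff_smul, coeff_elementarySeries_mul_completeSeries, Finset.mul_sum,
    mul_ite, mul_one, mul_zero]
  rw [sum_prod_antidiagonal_degree m _ fun i j p _ => if ∀ k, p k ≤ 1 then (-1 : ℤ[X]) ^ i else 0]
  have h2 : ∀ p ∈ Finset.HasAntidiagonal.antidiagonal m,
      ((p.1.degree, p.2.degree) ∈ Finset.HasAntidiagonal.antidiagonal r ↔ m.degree = r) := by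
    intro p hp
    rw [Finset.HasAntidiagonal.mem_antidiagonal] at hp ⊢
    rw [← hp, map_add]
  by_cases hm : m.degree = r
  · rw [Finset.sum_congr rfl fun p hp => if_pos ((h2 p hp).2 hm), h1]
    subst hm
    rw [MvPowerSeries.coeff_one]
    split_ifs with h h' h'
    · simp [h]
    · exact absurd (by simp [h]) h'
    · exact absurd ((Finsupp.degree_eq_zero_iff m).1 h') h
    · simp
  · rw [Finset.sum_eq_zero fun p hp => if_neg fun h => hm ((h2 p hp).1 h)]
    split_ifs with hr
    · rw [MvPowerSeries.coeff_one, if_neg]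
      rintro rfl
      exact hm (by simp [hr])
    · simp

theorem completeSeries_zero : completeSeries 0 = 1 := by
  classical
  ext m : 1
  rw [coeff_completeSeries, MvPowerSeries.coeff_one]
  exact if_congr (Finsupp.degree_eq_zero_iff m) rfl rfl

theorem schurSum_zero : schurSum 0 = 0 := by
  ext m : 1
  simp [coeff_schurSum]

theorem schurSum_sum {ι : Type*} (s : Finset ι) (c : ι → YoungDiagram → ℤ[X]) :
    schurSum (∑ i ∈ s, c i) = ∑ i ∈ s, schurSum (c i) := by
  classical
  induction s using Finset.induction_on with
  | empty => simp [schurSum_zero]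
  | insert i s hi ih => rw [Finset.sum_insert hi, Finset.sum_insert hi, schurSum_add, ih]

section OmegaKernel

open YoungDiagram

theorem elementarySeries_mul_schurSum (r : ℕ) (c : YoungDiagram → ℤ[X]) :
    elementarySeries r * schurSum c = schurSum fun κ => ∑ Y ∈ vDowns r κ, c Y := by
  induction r using Nat.strong_induction_on with
  | _ r ih =>
    have h1 := congrArg (· * schurSum c) (sum_elementarySeries_mul_completeSeries r)
    have h2 : (∑ x ∈ Finset.HasAntidiagonal.antidiagonal r, (-1 : ℤ[X]) ^ x.1 •
        (completeSeries x.2 * schurSum fun κ => ∑ Y ∈ vDowns x.1 κ, c Y)) =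
        (if r = 0 then 1 else 0) * schurSum c := by
      simp only [completeSeries_mul_schurSum, ← schurSum_smul]
      rw [← schurSum_sum]
      have : (∑ x ∈ Finset.HasAntidiagonal.antidiagonal r, (-1 : ℤ[X]) ^ x.1 •
          fun κ => ∑ Y ∈ hDowns x.2 κ, ∑ Y ∈ vDowns x.1 Y, c Y) = if r = 0 then c else 0 := by
        funext κ
        rw [Finset.sum_apply]
        simp only [Pi.smul_apply, smul_eq_mul, sum_hDowns_vDowns]
        split_ifs <;> rfl
      rw [this]
      split_ifs
      · rw [one_mul]
      · rw [zero_mul, schurSum_zero]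
    rw [← h2, Finset.sum_mul] at h1
    -- only the terms with the full degree in the elementary factor are not known to agree
    have hmem : (r, 0) ∈ Finset.HasAntidiagonal.antidiagonal r := by simp
    rw [← Finset.add_sum_erase _ _ hmem, ← Finset.add_sum_erase _ (fun x : ℕ × ℕ =>
      (-1 : ℤ[X]) ^ x.1 • (completeSeries x.2 * schurSum fun κ => ∑ Y ∈ vDowns x.1 κ, c Y)) hmem,
      Finset.sum_congr rfl (g := fun x : ℕ × ℕ =>
      (-1 : ℤ[X]) ^ x.1 • (completeSeries x.2 * schurSum fun κ => ∑ Y ∈ vDowns x.1 κ, c Y))] at h1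
    · have h3 := add_right_cancel h1
      simp only [completeSeries_zero, mul_one, one_mul, smul_mul_assoc] at h3
      have h4 := congrArg (fun f => (-1 : ℤ[X]) ^ r • f) h3
      simpa only [smul_smul, ← mul_pow, neg_mul_neg, one_mul, one_pow, one_smul] using h4
    · rintro ⟨i, j⟩ hx
      rw [Finset.mem_erase, Finset.HasAntidiagonal.mem_antidiagonal] at hx
      have hi : i < r := by
        have h3 := hx.1
        have h4 := hx.2
        rw [Ne, Prod.mk.injEq] at h3
        dsimp only at h4
        omega
      dsimp only
      rw [← ih i hi, smul_mul_assoc]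
      congr 1
      ring

/-! ### The operator `ω` on the Cauchy kernel -/

/-- Multiplication by `f` preserves the expansions into Schur functions, and `ω` transforms it into
multiplication by `f'`. -/
def OmegaDual (f f' : Series) : Prop :=
  ∀ c, ∃ c', f * schurSum c = schurSum c' ∧
    f' * (schurSum fun Y => c Y.transpose) = schurSum fun Y => c' Y.transpose

theorem OmegaDual.symm {f f' : Series} (h : OmegaDual f f') : OmegaDual f' f := by
  intro c
  obtain ⟨c', h1, h2⟩ := h fun Y => c Y.transpose
  simp only [transpose_transpose] at h2
  exact ⟨_, h2, by simpa only [transpose_transpose] using h1⟩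

theorem OmegaDual.mul {f f' g g' : Series} (hf : OmegaDual f f') (hg : OmegaDual g g') :
    OmegaDual (f * g) (f' * g') := by
  intro c
  obtain ⟨c', h1, h2⟩ := hg c
  obtain ⟨c'', h3, h4⟩ := hf c'
  exact ⟨c'', by rw [mul_assoc, h1, h3], by rw [mul_assoc, h2, h4]⟩

theorem OmegaDual.one : OmegaDual 1 1 := fun c => ⟨c, one_mul _, one_mul _⟩

theorem OmegaDual.zero : OmegaDual 0 0 := fun c =>
  ⟨0, by rw [zero_mul, schurSum_zero], by rw [zero_mul]; exact schurSum_zero.symm⟩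

theorem OmegaDual.add {f f' g g' : Series} (hf : OmegaDual f f') (hg : OmegaDual g g') :
    OmegaDual (f + g) (f' + g') := by
  intro c
  obtain ⟨c', h1, h2⟩ := hf c
  obtain ⟨c'', h3, h4⟩ := hg c
  exact ⟨c' + c'', by rw [add_mul, h1, h3, schurSum_add],
    by rw [add_mul, h2, h4, ← schurSum_add]; rfl⟩

theorem OmegaDual.smul {f f' : Series} (a : ℤ[X]) (hf : OmegaDual f f') :
    OmegaDual (a • f) (a • f') := by
  intro c
  obtain ⟨c', h1, h2⟩ := hf c
  exact ⟨a • c', by rw [smul_mul_assoc, h1, schurSum_smul],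
    by rw [smul_mul_assoc, h2, ← schurSum_smul]; rfl⟩

theorem OmegaDual.sum {ι : Type*} (s : Finset ι) {f f' : ι → Series}
    (h : ∀ i, OmegaDual (f i) (f' i)) : OmegaDual (∑ i ∈ s, f i) (∑ i ∈ s, f' i) := by
  classical
  induction s using Finset.induction_on with
  | empty => exact OmegaDual.zero
  | insert i s hi ih =>
    rw [Finset.sum_insert hi, Finset.sum_insert hi]
    exact (h i).add ih

theorem OmegaDual.prod {ι : Type*} (s : Finset ι) {f f' : ι → Series}
    (h : ∀ i, OmegaDual (f i) (f' i)) : OmegaDual (∏ i ∈ s, f i) (∏ i ∈ s, f' i) := by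
  classical
  induction s using Finset.induction_on with
  | empty => exact OmegaDual.one
  | insert i s hi ih =>
    rw [Finset.prod_insert hi, Finset.prod_insert hi]
    exact (h i).mul ih

/-- The two Pieri rules are exchanged by transposition. -/
theorem omegaDual_completeSeries (r : ℕ) : OmegaDual (completeSeries r) (elementarySeries r) := by
  intro c
  refine ⟨_, completeSeries_mul_schurSum r c, ?_⟩
  rw [elementarySeries_mul_schurSum]
  simp only [sum_vDowns_transpose]

theorem PowerSeries.coeff_pow_mul_pow_eq_zero {A : Type*} [CommRing A] {a b : PowerSeries A}
    (ha : PowerSeries.constantCoeff a = 0) (hb : PowerSeries.constantCoeff b = 0) {i j r : ℕ}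
    (h : r < i + j) : PowerSeries.coeff r (a ^ i * b ^ j) = 0 := by
  have h1 : PowerSeries.X ^ (i + j) ∣ a ^ i * b ^ j := by
    rw [pow_add]
    exact mul_dvd_mul (pow_dvd_pow_of_dvd (PowerSeries.X_dvd_iff.2 ha) i)
      (pow_dvd_pow_of_dvd (PowerSeries.X_dvd_iff.2 hb) j)
  exact PowerSeries.X_pow_dvd_iff.1 h1 r h

theorem tCoeff_infProd_linFactor {a b : PowerSeries ℤ[X]} (ha : PowerSeries.constantCoeff a = 0)
    (hb : PowerSeries.constantCoeff b = 0) (r : ℕ) :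
    tCoeff r (infProd (linFactor a b)) =
      ∑ x ∈ Finset.range (r + 1) ×ˢ Finset.range (r + 1),
        PowerSeries.coeff r (a ^ x.1 * b ^ x.2) • (elementarySeries x.1 * completeSeries x.2) := by
  classical
  ext m : 1
  rw [map_sum]
  simp only [MvPowerSeries.coeff_smul, coeff_elementarySeries_mul_completeSeries, Finset.mul_sum,
    mul_ite, mul_one, mul_zero]
  rw [sum_prod_antidiagonal_degree m _ fun i j p _ => if ∀ k, p k ≤ 1 then
    PowerSeries.coeff r (a ^ i * b ^ j) else 0, coeff_tCoeff, linFactor,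
    infProd_mul (by simp) (constantCoeff_geomSeries _), MvPowerSeries.coeff_mul, map_sum]
  refine Finset.sum_congr rfl fun p _ => ?_
  rw [coeff_infProd_geomSeries, coeff_infProd_one_add]
  have h0 : (p.1.degree, p.2.degree) ∉ Finset.range (r + 1) ×ˢ Finset.range (r + 1) →
      PowerSeries.coeff r (a ^ p.1.degree * b ^ p.2.degree) = 0 := by
    intro h
    refine PowerSeries.coeff_pow_mul_pow_eq_zero ha hb ?_
    simp only [Finset.mem_product, Finset.mem_range] at h
    omega
  by_cases h1 : ∀ k, p.1 k ≤ 1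
  · by_cases h2 : (p.1.degree, p.2.degree) ∈ Finset.range (r + 1) ×ˢ Finset.range (r + 1)
    · rw [if_pos h1, if_pos h2, if_pos h1]
    · rw [if_pos h1, if_neg h2, h0 h2]
  · rw [if_neg h1, if_neg h1, zero_mul, map_zero, ite_self]

theorem omegaDual_tCoeff {a b : PowerSeries ℤ[X]} (ha : PowerSeries.constantCoeff a = 0)
    (hb : PowerSeries.constantCoeff b = 0) (r : ℕ) :
    OmegaDual (tCoeff r (infProd (linFactor a b))) (tCoeff r (infProd (linFactor b a))) := by
  rw [tCoeff_infProd_linFactor ha hb, tCoeff_infProd_linFactor hb ha, Finset.sum_product,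
    Finset.sum_product_right]
  refine OmegaDual.sum _ fun i => OmegaDual.sum _ fun j => ?_
  dsimp only
  rw [mul_comm (b ^ j), mul_comm (elementarySeries j)]
  exact ((omegaDual_completeSeries i).symm.mul (omegaDual_completeSeries j)).smul _

/-- The Cauchy kernel expands into Schur functions of `y`, and `ω` exchanges the roles of numerators
and denominators. -/
theorem exists_kernelCoeff_eq_schurSum {a b : PowerSeries ℤ[X]}
    (ha : PowerSeries.constantCoeff a = 0) (hb : PowerSeries.constantCoeff b = 0) (n : ℕ →₀ ℕ) :
    ∃ c, kernelCoeff (linFactor a b) n = schurSum c ∧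
      kernelCoeff (linFactor b a) n = schurSum fun Y => c Y.transpose := by
  have h : OmegaDual (kernelCoeff (linFactor a b) n) (kernelCoeff (linFactor b a) n) :=
    OmegaDual.prod _ fun _ => omegaDual_tCoeff ha hb _
  obtain ⟨c, h1, h2⟩ := h fun Y => if Y.card = 0 then 1 else 0
  simp only [card_transpose, schurSum_empty, mul_one] at h1 h2
  exact ⟨c, h1, h2⟩

end OmegaKernel

/-! ### Cauchy dual families -/

theorem coeff_inX_mul_inY (F F' : Series) (n m : ℕ →₀ ℕ) :
    MvPowerSeries.coeff (Finsupp.sumElim n m) (inX F * inY F') =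
      MvPowerSeries.coeff n F * MvPowerSeries.coeff m F' := by
  classical
  have : Filter.TendstoCofinite (Sum.inl : ℕ → ℕ ⊕ ℕ) := ⟨Sum.inl_injective.tendsto_cofinite⟩
  have : Filter.TendstoCofinite (Sum.inr : ℕ → ℕ ⊕ ℕ) := ⟨Sum.inr_injective.tendsto_cofinite⟩
  have hX : ∀ n, MvPowerSeries.coeff (Finsupp.sumElim n 0) (inX F) = MvPowerSeries.coeff n F := by
    intro n
    have h := MvPowerSeries.coeff_embDomain_rename (⟨Sum.inl, Sum.inl_injective⟩ : ℕ ↪ ℕ ⊕ ℕ) F n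
    rw [← h, Finsupp.embDomain_eq_mapDomain]
    congr 2
    ext (k | k)
    · exact (Finsupp.mapDomain_apply Sum.inl_injective n k).symm
    · refine (Finsupp.mapDomain_of_notMem_range _ _ ?_).symm
      rintro ⟨j, hj⟩
      exact Sum.inl_ne_inr hj
  have hY : ∀ n, MvPowerSeries.coeff (Finsupp.sumElim 0 n) (inY F') = MvPowerSeries.coeff n F' := by
    intro n
    have h := MvPowerSeries.coeff_embDomain_rename (⟨Sum.inr, Sum.inr_injective⟩ : ℕ ↪ ℕ ⊕ ℕ) F' n
    rw [← h, Finsupp.embDomain_eq_mapDomain]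
    congr 2
    ext (k | k)
    · refine (Finsupp.mapDomain_of_notMem_range _ _ ?_).symm
      rintro ⟨j, hj⟩
      exact Sum.inr_ne_inl hj
    · exact (Finsupp.mapDomain_apply Sum.inr_injective n k).symm
  have hX0 : ∀ d k, d (Sum.inr k) ≠ 0 → MvPowerSeries.coeff d (inX F) = 0 := by
    intro d k hk
    refine MvPowerSeries.coeff_rename_eq_zero _ _ ?_
    rintro ⟨x, rfl⟩
    refine hk (Finsupp.mapDomain_of_notMem_range _ _ ?_)
    rintro ⟨j, hj⟩
    exact Sum.inl_ne_inr hj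
  have hY0 : ∀ d k, d (Sum.inl k) ≠ 0 → MvPowerSeries.coeff d (inY F') = 0 := by
    intro d k hk
    refine MvPowerSeries.coeff_rename_eq_zero _ _ ?_
    rintro ⟨x, rfl⟩
    refine hk (Finsupp.mapDomain_of_notMem_range _ _ ?_)
    rintro ⟨j, hj⟩
    exact Sum.inr_ne_inl hj
  rw [MvPowerSeries.coeff_mul,
    Finset.sum_eq_single (Finsupp.sumElim n 0, Finsupp.sumElim 0 m), hX, hY]
  · rintro ⟨d, d'⟩ hd hne
    rw [Finset.HasAntidiagonal.mem_antidiagonal] at hd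
    dsimp only at hd ⊢
    by_cases h1 : ∃ k, d (Sum.inr k) ≠ 0
    · rw [hX0 d _ h1.choose_spec, zero_mul]
    by_cases h2 : ∃ k, d' (Sum.inl k) ≠ 0
    · rw [hY0 d' _ h2.choose_spec, mul_zero]
    push Not at h1 h2
    refine absurd (Prod.ext (Finsupp.ext ?_) (Finsupp.ext ?_)) hne
    · rintro (k | k)
      · have := DFunLike.congr_fun hd (Sum.inl k)
        simpa [h2] using this
      · simpa using h1 k
    · rintro (k | k)
      · simpa using h2 k
      · have := DFunLike.congr_fun hd (Sum.inr k)
        simpa [h1] using this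
  · intro h
    refine absurd ?_ h
    rw [Finset.HasAntidiagonal.mem_antidiagonal, sumElim_add, add_zero, zero_add]

open StrictPartition

/-- The Cauchy identity, coefficient by coefficient in `x`. -/
theorem IsCauchyDual.sum_smul {G g : StrictPartition → Series} (h : IsCauchyDual G g)
    (hdeg : ∀ l n, n.degree < l.size → MvPowerSeries.coeff n (G l) = 0) {n : ℕ →₀ ℕ}
    {s : Finset StrictPartition} (hs : sizeLE n.degree ⊆ s) :
    ∑ l ∈ s, MvPowerSeries.coeff n (G l) • g l = kernelCoeff cauchyFactor n := by
  have hd : ∀ d : ℕ ⊕ ℕ →₀ ℕ, Finsupp.sumElim (d.comapDomain Sum.inl Sum.inl_injective.injOn)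
      (d.comapDomain Sum.inr Sum.inr_injective.injOn) = d := fun d => by
    ext k
    cases k <;> rfl
  have h1 := (hasFormalSum_iff
    (fun d => sizeLE (d.comapDomain Sum.inl Sum.inl_injective.injOn).degree) (fun d l hl => by
      rw [mem_sizeLE, not_le] at hl
      rw [← hd d, coeff_inX_mul_inY, hdeg _ _ hl, zero_mul])).1 h
  rw [← Finset.sum_subset hs fun l _ hl => by
    rw [mem_sizeLE, not_le] at hl
    rw [hdeg _ _ hl, zero_smul]]
  ext m : 1
  have h2 := h1 (Finsupp.sumElim n m)
  have h3 : (Finsupp.sumElim n m).comapDomain Sum.inl Sum.inl_injective.injOn = n :=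
    Finsupp.ext fun _ => rfl
  rw [coeff_cauchyKernel, h3] at h2
  rw [h2, map_sum]
  refine Finset.sum_congr rfl fun l _ => ?_
  rw [coeff_inX_mul_inY, MvPowerSeries.coeff_smul]

/-- The coefficients in the expansion of `G m * G n`. -/
noncomputable def prodCoeff (G : StrictPartition → Series) (m n l : StrictPartition) : ℤ :=
  theUnique (IsProductExpansion G m n) l

/-- The coefficients in the expansion of `G m * G n`, including the powers of `β`. -/
noncomputable def prodCoeffPoly (G : StrictPartition → Series) (m n l : StrictPartition) : ℤ[X] :=
  C (prodCoeff G m n l) * X ^ (l.size - (m.size + n.size))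

/-- The skew dual functions. -/
noncomputable def skewDual (G g : StrictPartition → Series) (l m : StrictPartition) : Series :=
  ∑ᶠ n : StrictPartition, prodCoeffPoly G m n l • g n

theorem prodCoeff_spec {G : StrictPartition → Series} {m n l : StrictPartition}
    (h : prodCoeff G m n l ≠ 0) :
    (∃! c, IsProductExpansion G m n c) ∧ IsProductExpansion G m n (prodCoeff G m n) := by
  refine existsUnique_of_theUnique_ne_zero fun h0 => h ?_
  rw [prodCoeff, h0, Pi.zero_apply]

theorem prodCoeff_eq_zero (G : StrictPartition → Series) {m n l : StrictPartition}
    (h : l.size < m.size + n.size) : prodCoeff G m n l = 0 := by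
  by_contra hne
  exact hne ((prodCoeff_spec hne).2.1 l h)

theorem prodCoeffPoly_eq_zero (G : StrictPartition → Series) {m n l : StrictPartition}
    (h : l.size < m.size + n.size) : prodCoeffPoly G m n l = 0 := by
  rw [prodCoeffPoly, prodCoeff_eq_zero G h, map_zero, zero_mul]

theorem prodCoeff_eq_zero_of_prodCoeffPoly {G : StrictPartition → Series}
    {m n l : StrictPartition} (h : prodCoeffPoly G m n l = 0) : prodCoeff G m n l = 0 := by
  rw [prodCoeffPoly, mul_eq_zero] at h
  rcases h with h | h
  · exact C_eq_zero.1 h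
  · exact absurd h (pow_ne_zero _ X_ne_zero)

theorem skewDual_eq_sum (G g : StrictPartition → Series) (l m : StrictPartition) :
    skewDual G g l m = ∑ n ∈ sizeLE l.size, prodCoeffPoly G m n l • g n := by
  refine finsum_eq_sum_of_support_subset _ fun n hn => ?_
  rw [Finset.mem_coe, mem_sizeLE]
  by_contra hlt
  exact hn (by dsimp only; rw [prodCoeffPoly_eq_zero G (by omega), zero_smul])

theorem omega_zero : omega 0 = 0 := by
  rw [← schurSum_zero, omega_schurSum]
  rfl

/-- `ω` is only nonzero on series with an expansion into Schur functions. -/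
theorem exists_schurSum_of_omega_ne_zero {f : Series} (h : omega f ≠ 0) : ∃ c, f = schurSum c := by
  have hc : schurCoeff f ≠ 0 := by
    intro h0
    refine h ?_
    rw [omega, h0]
    refine HasFormalSum.formalSum_eq ?_
    rw [hasFormalSum_iff (fun _ => ∅)]
    · simp
    · simp
  exact ⟨_, (hasFormalSum_schur_iff _ _).1 (existsUnique_of_theUnique_ne_zero hc).2⟩

theorem isProductExpansion_empty {G : StrictPartition → Series} (h : G ∅ = 1)
    (hdeg : ∀ l n, n.degree < l.size → MvPowerSeries.coeff n (G l) = 0) (n : StrictPartition) :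
    IsProductExpansion G ∅ n (open Classical in fun l => if l = n then 1 else 0) := by
  classical
  refine ⟨fun l hl => if_neg ?_, ?_⟩
  · rintro rfl
    rw [size_empty] at hl
    omega
  · rw [h, one_mul, hasFormalSum_iff (fun d => sizeLE d.degree)]
    · intro d
      have h1 : ∀ l : StrictPartition, MvPowerSeries.coeff d
          ((C (if l = n then 1 else 0 : ℤ) * X ^ (l.size - ((∅ : StrictPartition).size + n.size)) :
            ℤ[X]) • G l) = if n = l then MvPowerSeries.coeff d (G n) else 0 := by
        intro l
        by_cases hl : l = n
        · subst hl
          simp [size_empty]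
        · simp [hl, Ne.symm hl]
      rw [Finset.sum_congr rfl fun l _ => h1 l, Finset.sum_ite_eq]
      split_ifs with hn
      · rfl
      · rw [mem_sizeLE] at hn
        exact hdeg _ _ (by omega)
    · intro d l hl
      rw [mem_sizeLE] at hl
      rw [MvPowerSeries.coeff_smul, hdeg _ _ (by omega), mul_zero]

theorem prodCoeff_empty {G : StrictPartition → Series} (h : G ∅ = 1)
    (hdeg : ∀ l n, n.degree < l.size → MvPowerSeries.coeff n (G l) = 0) {n l : StrictPartition}
    (hne : prodCoeff G ∅ n l ≠ 0) (k : StrictPartition) :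
    prodCoeff G ∅ n k = open Classical in if k = n then 1 else 0 := by
  have hs := prodCoeff_spec hne
  exact congrFun (hs.1.unique hs.2 (isProductExpansion_empty h hdeg n)) k

/-! ### Vanishing of the structure constants -/

/-- The family `G` starts with `1`, its members `G λ` have no terms of degree less than `|λ|`, its
Cauchy dual family is `g`, and `ω` maps the skew dual functions to the generating functions of shifted
bar tableaux. -/
structure HasSkewBarExpansion (b : Prop) (G g : StrictPartition → Series) : Prop where
  empty : G ∅ = 1
  coeff_eq_zero : ∀ l n, n.degree < l.size → MvPowerSeries.coeff n (G l) = 0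
  dual : g = theUnique (IsCauchyDual G)
  omega_skewDual : ∀ l m, m ⊆ l → omega (skewDual G g l m) = barSeries b (l.skewDiagram m)

namespace HasSkewBarExpansion

variable {b : Prop} {G g : StrictPartition → Series}

theorem barSeries_ne_zero (b : Prop) (l : StrictPartition) :
    barSeries b l.shiftedDiagram ≠ 0 := fun h0 =>
  coeff_exp_barSeries_ne_zero b l (by rw [h0, map_zero])

/-- The skew dual functions for `μ = ∅` are the dual functions: they do not vanish, hence the
expansion of some product `G ∅ * G n` is unique and involves `G l`. -/
theorem skewDual_empty (h : HasSkewBarExpansion b G g) (l : StrictPartition) :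
    skewDual G g l ∅ = g l := by
  classical
  have hne : skewDual G g l ∅ ≠ 0 := by
    intro h0
    have := h.omega_skewDual l ∅ (empty_subset l)
    rw [h0, omega_zero, skewDiagram_empty] at this
    exact barSeries_ne_zero b l this.symm
  rw [skewDual_eq_sum] at hne
  obtain ⟨n, _, hn⟩ := Finset.exists_ne_zero_of_sum_ne_zero hne
  have hn0 : prodCoeff G ∅ n l ≠ 0 := by
    intro h0
    rw [prodCoeffPoly, h0, map_zero, zero_mul, zero_smul] at hn
    exact hn rfl
  have hl := prodCoeff_empty h.empty h.coeff_eq_zero hn0 l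
  have hln : l = n := by
    by_contra hcon
    rw [if_neg hcon] at hl
    exact hn0 hl
  subst hln
  rw [skewDual_eq_sum, Finset.sum_eq_single l]
  · rw [prodCoeffPoly, hl, if_pos rfl, size_empty, zero_add, Nat.sub_self, pow_zero, mul_one,
      map_one, one_smul]
  · intro k _ hk
    by_cases hk0 : prodCoeff G ∅ k l = 0
    · rw [prodCoeffPoly, hk0, map_zero, zero_mul, zero_smul]
    · rw [prodCoeff_empty h.empty h.coeff_eq_zero hk0 l, if_neg hk.symm] at hk0
      exact absurd rfl hk0
  · intro hcon
    exact absurd (mem_sizeLE.2 le_rfl) hcon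

theorem exists_eq_schurSum (h : HasSkewBarExpansion b G g) (l : StrictPartition) :
    ∃ c, g l = schurSum c ∧ barSeries b l.shiftedDiagram = schurSum fun Y => c Y.transpose := by
  have h1 := h.omega_skewDual l ∅ (empty_subset l)
  rw [h.skewDual_empty, skewDiagram_empty] at h1
  obtain ⟨c, hc⟩ := exists_schurSum_of_omega_ne_zero (h1 ▸ barSeries_ne_zero b l)
  exact ⟨c, hc, by rw [← h1, hc, omega_schurSum]⟩

theorem isCauchyDual (h : HasSkewBarExpansion b G g) : IsCauchyDual G g := by
  have hne : theUnique (IsCauchyDual G) ≠ 0 := by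
    intro h0
    have h1 := h.omega_skewDual ∅ ∅ (empty_subset ∅)
    rw [h.skewDual_empty, h.dual, h0, Pi.zero_apply, omega_zero, skewDiagram_empty] at h1
    exact barSeries_ne_zero b ∅ h1.symm
  rw [h.dual]
  exact (existsUnique_of_theUnique_ne_zero hne).2

/-- `ω` is linear on finite combinations of the dual functions. -/
theorem omega_sum_smul (h : HasSkewBarExpansion b G g) (s : Finset StrictPartition)
    (d : StrictPartition → ℤ[X]) :
    omega (∑ l ∈ s, d l • g l) = ∑ l ∈ s, d l • barSeries b l.shiftedDiagram := by
  choose c hc hc' using h.exists_eq_schurSum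
  simp only [hc, hc', ← schurSum_smul]
  rw [← schurSum_sum, ← schurSum_sum, omega_schurSum]
  congr 1
  funext Y
  simp only [Finset.sum_apply, Pi.smul_apply]

/-- The Cauchy identity after applying `ω`. -/
theorem sum_smul_barSeries (h : HasSkewBarExpansion b G g) {n : ℕ →₀ ℕ}
    {s : Finset StrictPartition} (hs : sizeLE n.degree ⊆ s) :
    ∑ l ∈ s, MvPowerSeries.coeff n (G l) • barSeries b l.shiftedDiagram =
      kernelCoeff (linFactor PowerSeries.X negBar) n := by
  rw [← h.omega_sum_smul, h.isCauchyDual.sum_smul h.coeff_eq_zero hs]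
  obtain ⟨c, h1, h2⟩ := exists_kernelCoeff_eq_schurSum constantCoeff_negBar
    (b := PowerSeries.X) (by simp) n
  rw [cauchyFactor, h1, h2, omega_schurSum]

theorem barSeries_skewDiagram (h : HasSkewBarExpansion b G g) {l m : StrictPartition} (hml : m ⊆ l)
    {s : Finset StrictPartition} (hs : sizeLE l.size ⊆ s) : barSeries b (l.skewDiagram m) =
      ∑ n ∈ s, prodCoeffPoly G m n l • barSeries b n.shiftedDiagram := by
  rw [← h.omega_skewDual l m hml, skewDual_eq_sum, h.omega_sum_smul]
  refine Finset.sum_subset hs fun n _ hn => ?_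
  rw [mem_sizeLE, not_le] at hn
  rw [prodCoeffPoly_eq_zero G (by omega), zero_smul]

/-- Separating the variables `y` in the Cauchy identity yields a skew Cauchy identity. -/
theorem sum_subset_mul_coeff_skew (h : HasSkewBarExpansion b G g) {n : ℕ →₀ ℕ} {d : ℕ}
    (hd : n.degree ≤ d) {k : StrictPartition} (hk : k ∈ sizeLE d) (m : ℕ →₀ ℕ) :
    (∑ l ∈ sizeLE d, open Classical in if k ⊆ l then MvPowerSeries.coeff n (G l) *
      MvPowerSeries.coeff m (barSeries b (l.skewDiagram k)) else 0) =
      ∑ p ∈ Finset.HasAntidiagonal.antidiagonal n, MvPowerSeries.coeff p.1 (G k) *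
        MvPowerSeries.coeff m (kernelCoeff (linFactor PowerSeries.X negBar) p.2) := by
  classical
  have hc1 : PowerSeries.constantCoeff (linFactor (PowerSeries.X : PowerSeries ℤ[X]) negBar) = 1 :=
    constantCoeff_linFactor _ _
  have hc0 : PowerSeries.map PowerSeries.constantCoeff
      (linFactor (PowerSeries.X : PowerSeries ℤ[X]) negBar) = 1 :=
    map_linFactor_eq_one rfl (by simp) constantCoeff_negBar
  have hmono : ∀ {n' : ℕ →₀ ℕ}, n'.degree ≤ d → sizeLE n'.degree ⊆ sizeLE d := by
    intro n' hn' l hl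
    rw [mem_sizeLE] at hl ⊢
    omega
  refine sub_eq_zero.1 (eq_zero_of_forall_sum_barSeries b (sizeLE d) (fun k =>
    (∑ l ∈ sizeLE d, if k ⊆ l then MvPowerSeries.coeff n (G l) *
      MvPowerSeries.coeff m (barSeries b (l.skewDiagram k)) else 0) -
      ∑ p ∈ Finset.HasAntidiagonal.antidiagonal n, MvPowerSeries.coeff p.1 (G k) *
        MvPowerSeries.coeff m (kernelCoeff (linFactor PowerSeries.X negBar) p.2))
    (fun m' => ?_) k hk)
  obtain ⟨N, hN⟩ := exists_suppLT m'
  have h1 := congrArg (MvPowerSeries.coeff (m' + shiftExp N m)) (h.sum_smul_barSeries (hmono hd))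
  rw [coeff_kernelCoeff_add_shiftExp hc1 hc0 n hN, map_sum] at h1
  simp only [MvPowerSeries.coeff_smul, coeff_barSeries_add_shiftExp b _ hN] at h1
  simp only [sub_mul, Finset.sum_sub_distrib]
  rw [sub_eq_zero]
  calc ∑ k ∈ sizeLE d, (∑ l ∈ sizeLE d, if k ⊆ l then MvPowerSeries.coeff n (G l) *
        MvPowerSeries.coeff m (barSeries b (l.skewDiagram k)) else 0) *
        MvPowerSeries.coeff m' (barSeries b k.shiftedDiagram) =
      ∑ l ∈ sizeLE d, MvPowerSeries.coeff n (G l) *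
        ∑ k ∈ l.subs, MvPowerSeries.coeff m' (barSeries b k.shiftedDiagram) *
          MvPowerSeries.coeff m (barSeries b (l.skewDiagram k)) := by
        simp only [Finset.sum_mul]
        rw [Finset.sum_comm]
        refine Finset.sum_congr rfl fun l hl => ?_
        rw [Finset.mul_sum, ← Finset.sum_subset (s₁ := l.subs) (s₂ := sizeLE d)]
        · refine Finset.sum_congr rfl fun k hk => ?_
          rw [if_pos (mem_subs.1 hk)]
          ring
        · intro k hk
          have := size_le_of_subset (mem_subs.1 hk)
          rw [mem_sizeLE] at hl ⊢
          omega
        · intro k _ hk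
          rw [if_neg fun hkl => hk (mem_subs.2 hkl), zero_mul]
    _ = _ := h1
    _ = _ := by
        simp only [Finset.sum_mul]
        rw [Finset.sum_comm]
        refine Finset.sum_congr rfl fun p hp => ?_
        rw [Finset.HasAntidiagonal.mem_antidiagonal] at hp
        have hp1 : p.1.degree ≤ d := by
          rw [← hp, map_add] at hd
          omega
        rw [← h.sum_smul_barSeries (hmono hp1), map_sum, Finset.sum_mul]
        refine Finset.sum_congr rfl fun k _ => ?_
        rw [MvPowerSeries.coeff_smul]
        ring

/-- Only the `l` containing `k` are needed to expand the product `G k * G ν`. -/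
theorem coeff_mul_eq_sum (h : HasSkewBarExpansion b G g) {n : ℕ →₀ ℕ} {d : ℕ}
    (hd : n.degree ≤ d) {k ν : StrictPartition} (hk : k ∈ sizeLE d) (hν : ν ∈ sizeLE d) :
    MvPowerSeries.coeff n (G k * G ν) = ∑ l ∈ sizeLE d, open Classical in
      if k ⊆ l then prodCoeffPoly G k ν l * MvPowerSeries.coeff n (G l) else 0 := by
  classical
  refine (sub_eq_zero.1 (eq_zero_of_forall_sum_barSeries b (sizeLE d) (fun ν =>
    MvPowerSeries.coeff n (G k * G ν) - ∑ l ∈ sizeLE d,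
      if k ⊆ l then prodCoeffPoly G k ν l * MvPowerSeries.coeff n (G l) else 0)
    (fun m => ?_) ν hν))
  have h1 := h.sum_subset_mul_coeff_skew hd hk m
  simp only [sub_mul, Finset.sum_sub_distrib]
  rw [sub_eq_zero]
  refine Eq.trans ?_ (h1.symm.trans ?_)
  · simp only [MvPowerSeries.coeff_mul, Finset.sum_mul]
    rw [Finset.sum_comm]
    refine Finset.sum_congr rfl fun p hp => ?_
    rw [Finset.HasAntidiagonal.mem_antidiagonal] at hp
    rw [← h.sum_smul_barSeries (s := sizeLE d), map_sum, Finset.mul_sum]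
    · refine Finset.sum_congr rfl fun ν _ => ?_
      rw [MvPowerSeries.coeff_smul, mul_assoc]
    · intro l hl
      rw [← hp, map_add] at hd
      rw [mem_sizeLE] at hl ⊢
      omega
  · simp only [Finset.sum_mul]
    rw [Finset.sum_comm]
    refine Finset.sum_congr rfl fun l hl => ?_
    by_cases hkl : k ⊆ l
    · simp only [if_pos hkl]
      rw [h.barSeries_skewDiagram hkl (s := sizeLE d), map_sum, Finset.mul_sum]
      · refine Finset.sum_congr rfl fun ν _ => ?_
        rw [MvPowerSeries.coeff_smul]
        ring
      · intro l' hl'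
        rw [mem_sizeLE] at hl hl' ⊢
        omega
    · simp only [if_neg hkl, zero_mul, Finset.sum_const_zero]

theorem subset_of_prodCoeff_ne_zero (h : HasSkewBarExpansion b G g) {k ν l : StrictPartition}
    (hne : prodCoeff G k ν l ≠ 0) : k ⊆ l := by
  classical
  have hs := prodCoeff_spec hne
  have h1 : IsProductExpansion G k ν fun l => if k ⊆ l then prodCoeff G k ν l else 0 := by
    refine ⟨fun l hl => ?_, ?_⟩
    · dsimp only
      rw [hs.2.1 l hl, ite_self]
    · have hz : ∀ (n : ℕ →₀ ℕ) (l : StrictPartition), l ∉ sizeLE n.degree →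
          MvPowerSeries.coeff n (G l) = 0 := by
        intro n l hl
        rw [mem_sizeLE] at hl
        exact h.coeff_eq_zero _ _ (by omega)
      rw [hasFormalSum_iff (fun n => sizeLE n.degree)]
      · intro n
        rw [h.coeff_mul_eq_sum (d := n.degree + k.size + ν.size) (by omega)
          (mem_sizeLE.2 (by omega)) (mem_sizeLE.2 (by omega))]
        refine ((Finset.sum_subset (fun l hl => ?_) fun l _ hl => ?_).symm.trans
          (Finset.sum_congr rfl fun l _ => ?_))
        · rw [mem_sizeLE] at hl ⊢
          omega
        · rw [hz n l hl, mul_zero, ite_self]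
        · rw [MvPowerSeries.coeff_smul]
          dsimp only
          split_ifs
          · rfl
          · rw [map_zero, zero_mul, zero_mul]
      · intro n l hl
        rw [MvPowerSeries.coeff_smul, hz n l hl, mul_zero]
  have h2 := congrFun (hs.1.unique hs.2 h1) l
  by_contra hkl
  rw [if_neg hkl] at h2
  exact hne h2

/-- The expansion of a skew bar series vanishes in `ℓ(λ) - ℓ(μ) - 1` variables, and the series for
the `ν` with at most that many parts are independent there. -/
theorem prodCoeff_eq_zero (h : HasSkewBarExpansion b G g) {l m n : StrictPartition}
    (hlen : m.length + n.length < l.length) : prodCoeff G m n l = 0 := by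
  by_contra hne
  have hml := h.subset_of_prodCoeff_ne_zero hne
  have hsize : m.size + n.size ≤ l.size := by
    by_contra hcon
    exact hne (_root_.prodCoeff_eq_zero G (by omega))
  refine hne (prodCoeff_eq_zero_of_prodCoeffPoly (eq_zero_of_sum_barSeries b (sizeLE l.size)
    (fun n => prodCoeffPoly G m n l) n.length (fun x hx => ?_) n (mem_sizeLE.2 (by omega)) le_rfl))
  rw [← coeff_barSeries_skew_eq_zero b hlen hx, h.barSeries_skewDiagram hml subset_rfl, map_sum]
  rfl

end HasSkewBarExpansion

/-! ### The families `GP` and `GQ` -/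

theorem genFun_eq_one {τ : Type*} [Unique τ] {w : τ → ℕ → ℕ} {c : τ → ℤ[X]}
    (hw : ∀ T k, w T k = 0) (hc : ∀ T, c T = 1) : genFun w c = 1 := by
  classical
  ext m : 1
  rw [coeff_genFun, MvPowerSeries.coeff_one]
  simp only [hc]
  split_ifs with h
  · subst h
    have : Unique {T : τ // ∀ k, w T k = (0 : ℕ →₀ ℕ) k} :=
      ⟨⟨⟨default, hw default⟩⟩, fun T => Subtype.ext (Subsingleton.elim _ _)⟩
    exact finsum_unique _
  · have : IsEmpty {T : τ // ∀ k, w T k = m k} :=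
      ⟨fun T => h (Finsupp.ext fun k => by rw [← T.2 k, hw]; rfl)⟩
    exact finsum_of_isEmpty _

theorem genFun_coeff_eq_zero {τ : Type*} {w : τ → ℕ → ℕ} {c : τ → ℤ[X]} {m : ℕ →₀ ℕ}
    (h : ∀ T, ∃ k, w T k ≠ m k) : MvPowerSeries.coeff m (genFun w c) = 0 := by
  have : IsEmpty {T : τ // ∀ k, w T k = m k} := ⟨fun T => (h T.1).choose_spec (T.2 _)⟩
  rw [coeff_genFun]
  exact finsum_of_isEmpty _

namespace SetTableau

theorem card_le_degree {D : Finset (ℕ × ℕ)} (T : SetTableau D) {m : ℕ →₀ ℕ}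
    (h : ∀ k, T.weight k = m k) : D.card ≤ m.degree := by
  rw [Finsupp.degree_apply, ← Fintype.card_coe, ← Finset.card_univ, Finset.card_eq_sum_ones]
  simp only [← h, weight]
  rw [Finset.sum_comm]
  refine Finset.sum_le_sum fun p _ => ?_
  obtain ⟨e, he⟩ := T.nonempty p
  have hpos : 0 < ((T.entry p).filter fun a => varIndex a = varIndex e).card :=
    Finset.card_pos.2 ⟨e, Finset.mem_filter.2 ⟨he, rfl⟩⟩
  have hmem : varIndex e ∈ m.support := by
    rw [Finsupp.mem_support_iff, ← h, weight]
    exact (hpos.trans_le (Finset.single_le_sum (f := fun p =>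
      ((T.entry p).filter fun a => varIndex a = varIndex e).card) (fun _ _ => Nat.zero_le _)
      (Finset.mem_univ p))).ne'
  exact hpos.trans_le (Finset.single_le_sum (f := fun k =>
    ((T.entry p).filter fun a => varIndex a = k).card) (fun _ _ => Nat.zero_le _) hmem)

instance : Unique (SetTableau (∅ : StrictPartition).shiftedDiagram) where
  default :=
    { entry := fun _ => {0}
      nonempty := fun _ => Finset.singleton_nonempty 0
      row_weak := fun p => absurd p.2 (by simp [shiftedDiagram_empty])
      col_weak := fun p => absurd p.2 (by simp [shiftedDiagram_empty])
      col_strict := fun p => absurd p.2 (by simp [shiftedDiagram_empty])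
      row_strict := fun p => absurd p.2 (by simp [shiftedDiagram_empty]) }
  uniq T := by
    cases T
    congr
    funext p
    exact absurd p.2 (by simp [shiftedDiagram_empty])

end SetTableau

instance : IsEmpty (∅ : StrictPartition).shiftedDiagram :=
  ⟨fun p => absurd p.2 (by simp [shiftedDiagram_empty])⟩

theorem GQ_empty : GQ ∅ = 1 :=
  genFun_eq_one (fun _ _ => Finset.sum_of_isEmpty _) fun T => by
    rw [SetTableau.degree, Finset.sum_of_isEmpty, Nat.zero_sub, pow_zero]

theorem GP_empty : GP ∅ = 1 := by
  have : Unique {T : SetTableau (∅ : StrictPartition).shiftedDiagram // T.DiagonalUnprimed} :=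
    ⟨⟨⟨default, fun p => isEmptyElim p⟩⟩, fun T => Subtype.ext (Subsingleton.elim _ _)⟩
  refine genFun_eq_one (fun _ _ => Finset.sum_of_isEmpty _) fun T => ?_
  rw [SetTableau.degree, Finset.sum_of_isEmpty, Nat.zero_sub, pow_zero]

theorem coeff_GQ_eq_zero (l : StrictPartition) (n : ℕ →₀ ℕ) (h : n.degree < l.size) :
    MvPowerSeries.coeff n (GQ l) = 0 := by
  refine genFun_coeff_eq_zero fun T => ?_
  by_contra! hcon
  have := T.card_le_degree hcon
  rw [StrictPartition.size] at h
  omega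

theorem coeff_GP_eq_zero (l : StrictPartition) (n : ℕ →₀ ℕ) (h : n.degree < l.size) :
    MvPowerSeries.coeff n (GP l) = 0 := by
  refine genFun_coeff_eq_zero fun T => ?_
  by_contra! hcon
  have := T.1.card_le_degree hcon
  rw [StrictPartition.size] at h
  omega

theorem mainTheorem10 :
    ((∀ l m : StrictPartition, m ⊆ l → jqSkew l m = barSeriesQ l m) →
      ∀ l m n : StrictPartition, m.length + n.length < l.length → aCoeff m n l = 0) ∧
    ((∀ l m : StrictPartition, m ⊆ l → jpSkew l m = barSeriesP l m) →
      ∀ l m n : StrictPartition, m.length + n.length < l.length → bCoeff m n l = 0) := by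
  constructor
  · intro H l m n hlen
    have h : HasSkewBarExpansion False GP gq := ⟨GP_empty, coeff_GP_eq_zero, rfl,
      fun l m hml => (H l m hml).trans (barSeriesQ_eq l m)⟩
    exact h.prodCoeff_eq_zero hlen
  · intro H l m n hlen
    have h : HasSkewBarExpansion True GQ gp := ⟨GQ_empty, coeff_GQ_eq_zero, rfl,
      fun l m hml => (H l m hml).trans (barSeriesP_eq l m)⟩
    exact h.prodCoeff_eq_zero hlen
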